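/- Let $T>0$, $1\le l\le d$, $m\ge 0$, let $\sigma_0,\sigma_1,\dots,\sigma_m:\mathbb R^d\to\mathbb R^d$ be smooth and bounded with bounded derivatives of all orders, and let $\mathrm x_0\in\mathbb R^d$, $\mathrm a\in\mathbb R^l$. Let $H$ be the Cameron--Martin space of absolutely continuous $h:[0,T]\to\mathbb R^m$, $h(0)=0$, with $\|h\|_H^2=\int_0^T|\dot h_t|^2\,dt<\infty$. For $h\in H$ let $\phi^h_t(y)$, $t\in[0,T]$, be the solution of $d\phi_t=\sigma_0(\phi_t)\,dt+\sum_{i=1}^m\sigma_i(\phi_t)\,dh^i_t$, $\phi_0=y$, and put $\phi_T(h)=\phi^h_T(\mathrm x_0)$, $\Pi_l(x^1,\dots,x^d)=(x^1,\dots,x^l)$, $\psi_T=\Pi_l\circ\phi_T$, $\mathcal K_{\mathrm a}=\{h\in H:\psi_T(h)=\mathrm a\}$ and $N_{\mathrm a}=\{x\in\mathbb R^d:\Pi_l x=\mathrm a\}$. Let $\mathrm h_0\in\mathcal K_{\mathrm a}$ minimize the energy $I=\tfrac12\|\cdot\|_H^2$ over $\mathcal K_{\mathrm a}$, and assume that the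 deterministic Malliavin matrix $C(\mathrm h_0)=D\phi_T(\mathrm h_0)\,D\phi_T(\mathrm h_0)^*\in\mathbb R^{d\times d}$ is invertible. Let $\mathrm H_{t\leftarrow s}$ be the (local) flow of the Hamiltonian vector field $(\partial_p\mathcal H,-\partial_x\mathcal H)$ of $\mathcal H(x,p)=\langle p,\sigma_0(x)\rangle+\tfrac12\sum_{i=1}^m\langle p,\sigma_i(x)\rangle^2$, and let $\pi(x,p)=x$. Then: (a) There is a unique $\mathrm p_0\in\mathbb R^d$ such that $\mathrm H_{t\leftarrow 0}(\mathrm x_0,\mathrm p_0)$ exists and $\phi^{\mathrm h_0}_t(\mathrm x_0)=\pi\mathrm H_{t\leftarrow 0}(\mathrm x_0,\mathrm p_0)$ for all $t\in[0,T]$. Moreover $\mathrm p_0=\big(D_y\phi^{\mathrm h_0}_T(\mathrm x_0)\big)^*(q,0)$ for some $q\in\mathbb R^l$. Put $(\mathrm x_T,\mathrm p_T)=\mathrm H_{T\leftarrow 0}(\mathrm x_0,\mathrm p_0)$; the map $F(z,q)=\pi\mathrm H_{0\leftarrow T}\big(\mathrm x_T+(0,z),\ \mathrm p_T+(q,0)\big)$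 is defined for $(z,q)\in\mathbb R^{d-l}\times\mathbb R^l$ near $(0,0)$ and differentiable at $(0,0)$. (b) The tangent space at $\mathrm h_0$ (the set of velocities $\dot c(0)$ of $C^2$ curves $c$ in $\mathcal K_{\mathrm a}$ with $c(0)=\mathrm h_0$) is $\mathcal T_{\mathrm h_0}\mathcal K_{\mathrm a}=\ker D\psi_T(\mathrm h_0)$, and the Hessian $I''(\mathrm h_0)$ of $I|_{\mathcal K_{\mathrm a}}$ at $\mathrm h_0$ is well defined: it is the unique symmetric bilinear form on this space with $I''(\mathrm h_0)[k,k]=\frac{d^2}{dt^2}\big|_{t=0}I(c(t))$ for every such curve $c$ with $\dot c(0)=k$. (c) The following are equivalent: (i) $I''(\mathrm h_0)[k,k]>0$ for all $0\ne k\in\mathcal T_{\mathrm h_0}\mathcal K_{\mathrm a}$; (ii) $I''(\mathrm h_0)$ is non-degenerate, i.e. $I''(\mathrm h_0)[k,\cdot]=0$ on $\mathcal T_{\mathrm h_0}\mathcal K_{\mathrm a}$ only for $k=0$; (iii) $\mathrm x_0$ is non-focal for $N_{\mathrm a}$ along $\mathrm h_0$, i.e. the derivative $\partial_{(z,q)}|_{(z,q)=(0,0)}F$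 is an invertible $d\times d$ matrix. -/

import Mathlib

open MeasureTheory Set Filter Topology
open scoped ContDiff

namespace NonFocality

noncomputable section

/-- `ℝ^d` with its Euclidean structure; covectors are identified with vectors through the
Euclidean pairing `⟨p, v⟩ = inner ℝ p v`. -/
abbrev Euc (d : ℕ) : Type := EuclideanSpace ℝ (Fin d)

/-- A map `ℝ^d → ℝ^d` that is smooth and bounded with bounded derivatives of all orders. -/
def SmoothBounded {d : ℕ} (V : Euc d → Euc d) : Prop :=
  ContDiff ℝ ∞ V ∧ ∀ k : ℕ, ∃ C : ℝ, ∀ x, ‖iteratedFDeriv ℝ k V x‖ ≤ C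

/-! ### Controls and the controlled equation -/

/-- The Cameron-Martin space `H` of absolutely continuous paths `[0,T] → ℝ^m` started at `0` with
square integrable derivative. A path is represented by its derivative in `L²([0,T]; ℝ^m)`; the
norm of `H` is the `L²` norm of the derivative. -/
abbrev CameronMartin (m : ℕ) (T : ℝ) : Type :=
  Lp (Euc m) 2 (volume.restrict (Icc (0 : ℝ) T))

section Control

variable {d m : ℕ} {T : ℝ}

/-- `x` solves `dx_t = σ₀(x_t) dt + ∑ i, σ_i(x_t) dh^i_t`, `x_0 = y`, on `[0,T]`
(`h` stands for the derivative of the control path). -/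
def IsControlledPath (σ₀ : Euc d → Euc d) (σ : Fin m → Euc d → Euc d) (h : CameronMartin m T)
    (y : Euc d) (x : ℝ → Euc d) : Prop :=
  ContinuousOn x (Icc 0 T) ∧
    ∀ t ∈ Icc 0 T, x t = y + ∫ s in (0 : ℝ)..t, (σ₀ (x s) + ∑ i, (h s) i • σ i (x s))

/-- `φ_t^h(y)` for `t ∈ [0,T]`: the solution at time `t` of the controlled equation started at
time `0` from `y`. (For smooth bounded vector fields with bounded derivatives the solution exists
and is unique on `[0,T]`.) -/
def controlFlow (σ₀ : Euc d → Euc d) (σ : Fin m → Euc d → Euc d) (h : CameronMartin m T)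
    (t : ℝ) (y : Euc d) : Euc d :=
  Classical.epsilon (IsControlledPath σ₀ σ h y) t

/-- The endpoint map `φ_T : H → ℝ^d`, with the starting point `x₀` fixed. -/
def endpoint (σ₀ : Euc d → Euc d) (σ : Fin m → Euc d → Euc d) (x₀ : Euc d)
    (h : CameronMartin m T) : Euc d :=
  controlFlow σ₀ σ h T x₀

/-- The deterministic Malliavin covariance `C(h) = Dφ_T(h) Dφ_T(h)^*`. -/
def malliavin (σ₀ : Euc d → Euc d) (σ : Fin m → Euc d → Euc d) (x₀ : Euc d)
    (h : CameronMartin m T) : Euc d →L[ℝ] Euc d :=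
  (fderiv ℝ (endpoint σ₀ σ x₀) h) ∘L
    ContinuousLinearMap.adjoint (fderiv ℝ (endpoint σ₀ σ x₀) h)

end Control

/-! ### Splitting `ℝ^(l+n) = ℝ^l ⊕ ℝ^n` -/

/-- `Π_l (x¹, …, x^{l+n}) = (x¹, …, x^l)`. -/
def proj (l n : ℕ) (x : Euc (l + n)) : Euc l :=
  WithLp.toLp 2 fun i => x (Fin.castAdd n i)

/-- `q ↦ (q, 0)`. -/
def padRight {l n : ℕ} (q : Euc l) : Euc (l + n) :=
  WithLp.toLp 2 (Fin.append (fun i => q i) (fun _ : Fin n => (0 : ℝ)))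

/-- `z ↦ (0, z)`. -/
def padLeft {l n : ℕ} (z : Euc n) : Euc (l + n) :=
  WithLp.toLp 2 (Fin.append (fun _ : Fin l => (0 : ℝ)) (fun i => z i))

section Variational

variable {l n m : ℕ} {T : ℝ}

/-- `ψ_T = Π_l ∘ φ_T : H → ℝ^l`. -/
def projEndpoint (σ₀ : Euc (l + n) → Euc (l + n)) (σ : Fin m → Euc (l + n) → Euc (l + n))
    (x₀ : Euc (l + n)) (h : CameronMartin m T) : Euc l :=
  proj l n (endpoint σ₀ σ x₀ h)

/-- `K_a`: the controls steering `x₀` at time `T` into `N_a = {x | Π_l x = a}`. -/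
def admissible (T : ℝ) (σ₀ : Euc (l + n) → Euc (l + n)) (σ : Fin m → Euc (l + n) → Euc (l + n))
    (x₀ : Euc (l + n)) (a : Euc l) : Set (CameronMartin m T) :=
  {h | projEndpoint σ₀ σ x₀ h = a}

/-- The energy functional `h ↦ ½ ‖h‖_H²`. -/
def energy (h : CameronMartin m T) : ℝ := (1 / 2) * ‖h‖ ^ 2

/-- `K_a^min`: the elements of `K_a` whose energy is the infimum of the energy over `K_a`. -/
def minimizers (T : ℝ) (σ₀ : Euc (l + n) → Euc (l + n)) (σ : Fin m → Euc (l + n) → Euc (l + n))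
    (x₀ : Euc (l + n)) (a : Euc l) : Set (CameronMartin m T) :=
  {h | h ∈ admissible T σ₀ σ x₀ a ∧ energy h = sInf (energy '' admissible T σ₀ σ x₀ a)}

/-- `H₀ = ker D(Π_l ∘ φ_T)(h)`. -/
def kerSpace (σ₀ : Euc (l + n) → Euc (l + n)) (σ : Fin m → Euc (l + n) → Euc (l + n))
    (x₀ : Euc (l + n)) (h : CameronMartin m T) : Submodule ℝ (CameronMartin m T) :=
  LinearMap.ker (fderiv ℝ (projEndpoint σ₀ σ x₀) h).toLinearMap

end Variational

/-! ### Tangent spaces and Hessians on subsets of a normed space -/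

section Hessian

variable {E : Type*} [NormedAddCommGroup E] [NormedSpace ℝ E]

/-- `c` is, near time `0`, a `C²` curve inside `K` with `c 0 = x` and velocity `v` at time `0`. -/
def IsCurveThrough (K : Set E) (x v : E) (c : ℝ → E) : Prop :=
  ContDiffAt ℝ 2 c 0 ∧ (∀ᶠ t in 𝓝 (0 : ℝ), c t ∈ K) ∧ c 0 = x ∧ deriv c 0 = v

/-- `V` is the tangent space of `K` at `x`: the set of velocities at `x` of curves in `K`. -/
def IsTangentSpaceAt (K : Set E) (x : E) (V : Submodule ℝ E) : Prop :=
  ∀ v, v ∈ V ↔ ∃ c, IsCurveThrough K x v c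

/-- `B` is the Hessian at `x` of the restriction of `f` to `K` (`x` a critical point of that
restriction, `V` the tangent space): the symmetric bilinear form with
`B v v = (d²/dt²) f (c t)` at `t = 0` for every curve `c` in `K` through `x` with velocity `v`. -/
def IsHessianAt (K : Set E) (f : E → ℝ) (x : E) (V : Submodule ℝ E)
    (B : LinearMap.BilinForm ℝ V) : Prop :=
  B.IsSymm ∧ ∀ (v : V) (c : ℝ → E), IsCurveThrough K x v c →
    iteratedDeriv 2 (fun t => f (c t)) 0 = B v v

end Hessian

/-! ### The Hamiltonian flow -/

section Hamiltonian

variable {d m : ℕ}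

/-- `𝓗(x,p) = ⟨p, σ₀(x)⟩ + ½ ∑ i, ⟨p, σ_i(x)⟩²`. -/
def hamiltonian (σ₀ : Euc d → Euc d) (σ : Fin m → Euc d → Euc d) (x p : Euc d) : ℝ :=
  inner ℝ p (σ₀ x) + (1 / 2) * ∑ i, (inner ℝ p (σ i x)) ^ 2

/-- The vector field `(∂_p 𝓗, -∂_x 𝓗)` on `T^*ℝ^d = ℝ^d × ℝ^d`. -/
def hamField (σ₀ : Euc d → Euc d) (σ : Fin m → Euc d → Euc d) (z : Euc d × Euc d) :
    Euc d × Euc d :=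
  (gradient (fun p => hamiltonian σ₀ σ z.1 p) z.2,
    -gradient (fun x => hamiltonian σ₀ σ x z.2) z.1)

/-- `γ` solves the Hamiltonian equations on the closed interval between the times `s` and `t`
(in either order) and passes through `z` at time `s`. -/
def IsHamCurve (σ₀ : Euc d → Euc d) (σ : Fin m → Euc d → Euc d) (s t : ℝ) (z : Euc d × Euc d)
    (γ : ℝ → Euc d × Euc d) : Prop :=
  γ s = z ∧ IsIntegralCurveOn γ (fun _ => hamField σ₀ σ) (uIcc s t)

/-- The domain of the (a priori only local) flow map `H_{t←s}`. -/
def hamDomain (σ₀ : Euc d → Euc d) (σ : Fin m → Euc d → Euc d) (s t : ℝ) :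
    Set (Euc d × Euc d) :=
  {z | ∃ γ, IsHamCurve σ₀ σ s t z γ}

/-- The Hamiltonian flow map `H_{t←s}`, meaningful on `hamDomain σ₀ σ s t`. -/
def hamFlow (σ₀ : Euc d → Euc d) (σ : Fin m → Euc d → Euc d) (s t : ℝ) (z : Euc d × Euc d) :
    Euc d × Euc d :=
  Classical.epsilon (IsHamCurve σ₀ σ s t z) t

/-- `p₀` is an initial covector for the control `h`: the Hamiltonian curve started from `(x₀,p₀)`
exists on `[0,T]` and projects to the controlled path, `φ_t^h(x₀) = π H_{t←0}(x₀,p₀)`. -/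
def IsInitialCovector {T : ℝ} (σ₀ : Euc d → Euc d) (σ : Fin m → Euc d → Euc d) (x₀ : Euc d)
    (h : CameronMartin m T) (p₀ : Euc d) : Prop :=
  (x₀, p₀) ∈ hamDomain σ₀ σ 0 T ∧
    ∀ t ∈ Icc 0 T, controlFlow σ₀ σ h t x₀ = (hamFlow σ₀ σ 0 t (x₀, p₀)).1

end Hamiltonian

section Focal

variable {l n m : ℕ}

/-- The perturbed terminal point `(x_T + (0,z), p_T + (q,0))`, where
`(x_T, p_T) = H_{T←0}(x₀, p₀)` and `w = (z,q) ∈ ℝ^n × ℝ^l`. -/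
def terminalPoint (T : ℝ) (σ₀ : Euc (l + n) → Euc (l + n))
    (σ : Fin m → Euc (l + n) → Euc (l + n)) (x₀ p₀ : Euc (l + n)) (w : Euc n × Euc l) :
    Euc (l + n) × Euc (l + n) :=
  ((hamFlow σ₀ σ 0 T (x₀, p₀)).1 + padLeft w.1, (hamFlow σ₀ σ 0 T (x₀, p₀)).2 + padRight w.2)

/-- `(z,q) ↦ π H_{0←T}(x_T + (0,z), p_T + (q,0))`. -/
def backwardProj (T : ℝ) (σ₀ : Euc (l + n) → Euc (l + n))
    (σ : Fin m → Euc (l + n) → Euc (l + n)) (x₀ p₀ : Euc (l + n)) (w : Euc n × Euc l) :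
    Euc (l + n) :=
  (hamFlow σ₀ σ T 0 (terminalPoint T σ₀ σ x₀ p₀ w)).1

/-- `x₀` is non-focal for `N_a` along the control with initial covector `p₀`: the derivative at
`(z,q) = (0,0)` of `(z,q) ↦ π H_{0←T}(x_T + (0,z), p_T + (q,0))` is an invertible linear map
`ℝ^n × ℝ^l → ℝ^(l+n)`. -/
def NonFocal (T : ℝ) (σ₀ : Euc (l + n) → Euc (l + n))
    (σ : Fin m → Euc (l + n) → Euc (l + n)) (x₀ p₀ : Euc (l + n)) : Prop :=
  Function.Bijective (fderiv ℝ (backwardProj T σ₀ σ x₀ p₀) 0)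

end Focal

end

end NonFocality

/-!
The control system, its Hamiltonian lift to `ℝ^d × ℝ^d` and the (time reversed) Hamiltonian equation
are all treated as instances of one integral equation `x_t = y + ∫₀ᵗ V(x_s) u_s ds` in `C([0,T], E)`
with a control `u ∈ L²([0,T], W)` and an operator valued field `V`. The implicit function theorem in
`C([0,T], E)` shows that solutions exist near a given solution and depend smoothly on `(u, y)`, with
derivative given by the linearised equation (`IsSol.eventually_and_contDiffAt`, `IsSol.fderiv_sol`).

*Momenta.* If `p` solves the adjoint equation along the path of `h`, the product rule shows that
`Dφ_T(h)^* p_T` is the control with components `⟨p, σ_i(x)⟩` and `(D_yφ_T)^* p_T = p_0`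
(`adjoint_fderiv_endpoint_of_isAdj`, `adjoint_fderiv_controlFlow_of_isAdj`). The Hamiltonian field is
the lift of the control fields driven by these momenta (`hamField_eq_lift`), so a lifted path whose
control equals its own momenta is a Hamiltonian path (`isSol_hamField_iff`).

*Initial covector.* Since `C(h₀)` is invertible, `ψ_T` is a submersion at `h₀`; its level set has
tangent space `ker Dψ_T(h₀)` (`isTangentSpaceAt_levelSet`), and minimality gives a multiplier `q` with
`h₀ = Dψ_T(h₀)^* q = Dφ_T(h₀)^* (q, 0)` (`exists_multiplier_of_isMin_norm`). Hence the lift of the path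
with terminal covector `(q, 0)` is Hamiltonian. Any other Hamiltonian lift of the same path has momenta
`u` which steer along that path and satisfy `⟨u, h₀ - u⟩ = 0`, so minimality forces `u = h₀`, and the
terminal covector is recovered from `u` because `Dφ_T(h₀)^*` is injective
(`IsInitialCovector.eq_of_isMin`).

*Hessian.* On `ker Dψ_T(h₀)` the Hessian is the second derivative of `½ ‖h‖² - ⟨q, ψ_T(h)⟩`, that is
`⟨k - Dg(h₀) k, k'⟩` with `g(h) = Dψ_T(h)^* q`; it is nonnegative by minimality
(`exists_isHessianAt_levelSet`), so that positivity and non-degeneracy are the same.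

*Focality.* A variation `k` lies in the radical when `k = Dg(h₀) k + Dφ_T(h₀)^* (δq, 0)` for some `δq`.
By `fderiv_gradient_add_adjoint` the right-hand side is the variation of the momenta along the solution
`Ξ` of the linearised lifted equation which starts in the fibre over `x₀`, ends at a covector
`(δq, 0)` and is driven by `k`. The equation thus says that `Ξ` solves the linearised Hamiltonian
equation with `Ξ_T = ((0, z), (δq, 0))` and no base component at time `0`, which is the statement that
`(z, δq)` is in the kernel of the derivative of the backward projection
(`injective_iff_radical_trivial`).
-/

namespace NonFocality

noncomputable section

/-! ### Composition operators on spaces of continuous maps -/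

section Superposition

variable {K : Type*} [TopologicalSpace K] [CompactSpace K]
  {E F : Type*} [NormedAddCommGroup E] [NormedSpace ℝ E] [NormedAddCommGroup F] [NormedSpace ℝ F]

/-- Pointwise evaluation of a continuous family of operators on a continuous family of vectors, as
a continuous bilinear map. -/
def pointwiseApply (K : Type*) [TopologicalSpace K] [CompactSpace K] (E F : Type*)
    [NormedAddCommGroup E] [NormedSpace ℝ E] [NormedAddCommGroup F] [NormedSpace ℝ F] :
    C(K, E →L[ℝ] F) →L[ℝ] C(K, E) →L[ℝ] C(K, F) :=
  LinearMap.mkContinuous₂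
    (LinearMap.mk₂ ℝ
      (fun (a : C(K, E →L[ℝ] F)) (x : C(K, E)) => (⟨fun t => a t (x t), by fun_prop⟩ : C(K, F)))
      (by intros; ext; simp) (by intros; ext; simp) (by intros; ext; simp) (by intros; ext; simp))
    1 (by
      intro (a : C(K, E →L[ℝ] F)) (x : C(K, E))
      rw [one_mul, ContinuousMap.norm_le _ (by positivity)]
      intro t
      exact (ContinuousLinearMap.le_opNorm _ _).trans
        (mul_le_mul (a.norm_coe_le_norm t) (x.norm_coe_le_norm t) (norm_nonneg _) (norm_nonneg a)))

/-- The derivative of `x ↦ f ∘ x` is pointwise application of `fderiv f ∘ x`. The uniform estimate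
comes from the continuity of `y ↦ fderiv f ∘ y` in the uniform norm. -/
lemma hasFDerivAt_comp_left {f : E → F} (hf : ContDiff ℝ 1 f) (x : C(K, E)) :
    HasFDerivAt (fun y : C(K, E) => (⟨f, hf.continuous⟩ : C(E, F)).comp y)
      (pointwiseApply K E F
        ((⟨fderiv ℝ f, hf.continuous_fderiv one_ne_zero⟩ : C(E, E →L[ℝ] F)).comp x)) x := by
  set g : C(E, E →L[ℝ] F) := ⟨fderiv ℝ f, hf.continuous_fderiv one_ne_zero⟩ with hg
  rw [hasFDerivAt_iff_isLittleO_nhds_zero, Asymptotics.isLittleO_iff]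
  intro ε hε
  have hc : Tendsto (fun y : C(K, E) => g.comp y) (𝓝 x) (𝓝 (g.comp x)) :=
    (ContinuousMap.continuous_postcomp g).tendsto x
  obtain ⟨δ, hδ, hball⟩ := Metric.eventually_nhds_iff.mp
    (hc.eventually (Metric.ball_mem_nhds (g.comp x) hε))
  rw [Metric.eventually_nhds_iff]
  refine ⟨δ, hδ, fun h hh => ?_⟩
  rw [dist_zero_right] at hh
  rw [ContinuousMap.norm_le _ (by positivity)]
  intro t
  have key : ‖f (x t + h t) - f (x t) - fderiv ℝ f (x t) (x t + h t - x t)‖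
      ≤ ε * ‖x t + h t - x t‖ := by
    refine (convex_segment (x t) (x t + h t)).norm_image_sub_le_of_norm_fderiv_le'
      (𝕜 := ℝ) (f := f) (fun z _ => (hf.differentiable one_ne_zero) z) ?_
      (left_mem_segment ℝ _ _) (right_mem_segment ℝ _ _)
    intro z hz
    rw [segment_eq_image'] at hz
    obtain ⟨s, hs, rfl⟩ := hz
    have h1 : dist (x + s • h) x < δ := by
      rw [dist_eq_norm, add_sub_cancel_left, norm_smul, Real.norm_eq_abs, abs_of_nonneg hs.1]
      exact lt_of_le_of_lt (mul_le_of_le_one_left (norm_nonneg _) hs.2) hh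
    have h2 := (ContinuousMap.dist_apply_le_dist (f := g.comp (x + s • h)) (g := g.comp x) t).trans
      (Metric.mem_ball.mp (hball h1)).le
    rw [dist_eq_norm] at h2
    simpa [hg] using h2
  simp only [add_sub_cancel_left] at key
  exact key.trans (mul_le_mul_of_nonneg_left (h.norm_coe_le_norm t) hε.le)

end Superposition

section SuperpositionSmooth

universe u

variable {K : Type u} [TopologicalSpace K] [CompactSpace K]
  {E : Type u} [NormedAddCommGroup E] [NormedSpace ℝ E]

/-- For smooth `f` the superposition operator `x ↦ f ∘ x` is smooth in the uniform norm: its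
derivative is built from the superposition operator of `fderiv f`, so one can induct on the order
of differentiability. The target changes from `F` to `E →L[ℝ] F` along the induction, whence the
common universe. -/
lemma contDiff_comp_left {F : Type u} [NormedAddCommGroup F] [NormedSpace ℝ F]
    {f : E → F} (hf : ContDiff ℝ ∞ f) :
    ContDiff ℝ ∞ (fun y : C(K, E) => (⟨f, hf.continuous⟩ : C(E, F)).comp y) := by
  rw [contDiff_infty]
  intro n
  induction n generalizing F with
  | zero =>
    exact contDiff_zero.mpr (ContinuousMap.continuous_postcomp _)
  | succ n ih =>
    have h1 : ContDiff ℝ 1 f := hf.of_le (by exact_mod_cast le_top)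
    have hd : ContDiff ℝ ∞ (fderiv ℝ f) := hf.fderiv_right (by simp)
    push_cast
    rw [contDiff_succ_iff_hasFDerivAt]
    exact ⟨fun x => pointwiseApply K E F
        ((⟨fderiv ℝ f, h1.continuous_fderiv one_ne_zero⟩ : C(E, E →L[ℝ] F)).comp x),
      ContDiff.comp (g := pointwiseApply K E F)
        (by fun_prop) (ih hd), fun x => hasFDerivAt_comp_left h1 x⟩

end SuperpositionSmooth

/-! ### Square integrable controls and the Volterra bilinear map -/

/-- Controls: the square integrable functions `[0,T] → W`. -/
abbrev Ctl (T : ℝ) (W : Type*) [NormedAddCommGroup W] : Type _ :=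
  Lp W 2 (volume.restrict (Icc (0 : ℝ) T))

section Volterra

variable {T : ℝ}

lemma Ctl.integrable {W : Type*} [NormedAddCommGroup W] (u : Ctl T W) :
    IntegrableOn u (Icc (0 : ℝ) T) volume :=
  (Lp.memLp u).integrable one_le_two

lemma Ctl.intervalIntegrable_of_integrable {E : Type*} [NormedAddCommGroup E] {f : ℝ → E}
    (hf : IntegrableOn f (Icc (0 : ℝ) T) volume) {t : ℝ} (ht : t ∈ Icc 0 T) :
    IntervalIntegrable f volume 0 t := by
  rw [intervalIntegrable_iff_integrableOn_Ioc_of_le ht.1]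
  exact IntegrableOn.mono_set hf (fun s hs => ⟨hs.1.le, hs.2.trans ht.2⟩)

lemma Ctl.integral_norm_sq {W : Type*} [NormedAddCommGroup W] (u : Ctl T W) :
    ∫ s in Icc (0 : ℝ) T, ‖u s‖ ^ 2 = ‖u‖ ^ 2 := by
  have h := (Lp.memLp u).eLpNorm_eq_integral_rpow_norm (by norm_num) (by norm_num)
  have hn : 0 ≤ ∫ s in Icc (0 : ℝ) T, ‖u s‖ ^ 2 := integral_nonneg fun s => by positivity
  rw [Lp.norm_def, h, ENNReal.toReal_ofReal (by positivity)]
  simp only [ENNReal.toReal_ofNat, Real.rpow_ofNat]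
  rw [← Real.rpow_natCast, ← Real.rpow_mul hn]
  norm_num

variable {E W : Type*} [NormedAddCommGroup E] [NormedSpace ℝ E]
  [NormedAddCommGroup W] [NormedSpace ℝ W]

lemma Ctl.integrable_apply {v : ℝ → W →L[ℝ] E} (hv : Continuous v) (u : Ctl T W) :
    IntegrableOn (fun s => v s (u s)) (Icc (0 : ℝ) T) volume := by
  obtain ⟨C, hC⟩ := (isCompact_Icc (a := (0 : ℝ)) (b := T)).exists_bound_of_continuousOn
    hv.continuousOn
  refine (u.integrable.norm.const_mul C).mono' ?_ ?_
  · exact (ContinuousLinearMap.id ℝ (W →L[ℝ] E)).aestronglyMeasurable_comp₂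
      hv.aestronglyMeasurable u.integrable.aestronglyMeasurable
  · filter_upwards [ae_restrict_mem measurableSet_Icc] with s hs
    exact (ContinuousLinearMap.le_opNorm _ _).trans
      (mul_le_mul_of_nonneg_right (hC s hs) (norm_nonneg _))

/-- Cauchy–Schwarz in time. -/
lemma Ctl.sq_integral_mul_norm_le {f : ℝ → ℝ} (hf : Continuous f) (h0 : ∀ s, 0 ≤ f s)
    {W : Type*} [NormedAddCommGroup W] (u : Ctl T W) {t : ℝ} (ht : t ∈ Icc 0 T) :
    (∫ s in (0 : ℝ)..t, f s * ‖u s‖) ^ 2 ≤ ‖u‖ ^ 2 * ∫ s in (0 : ℝ)..t, f s ^ 2 := by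
  have hsub : Ioc 0 t ⊆ Icc 0 T := fun s hs => ⟨hs.1.le, hs.2.trans ht.2⟩
  have hle : volume.restrict (Ioc 0 t) ≤ volume.restrict (Icc (0 : ℝ) T) :=
    Measure.restrict_mono hsub le_rfl
  have hu : MemLp (fun s => ‖u s‖) (ENNReal.ofReal 2) (volume.restrict (Ioc 0 t)) := by
    simpa using ((Lp.memLp u).mono_measure hle).norm
  have hfm : MemLp f (ENNReal.ofReal 2) (volume.restrict (Ioc 0 t)) := by
    refine MemLp.mono_measure (Measure.restrict_mono Ioc_subset_Icc_self le_rfl) ?_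
    obtain ⟨C, hC⟩ := (isCompact_Icc (a := (0 : ℝ)) (b := t)).exists_bound_of_continuousOn
      hf.continuousOn
    exact MemLp.of_bound hf.aestronglyMeasurable C
      ((ae_restrict_mem measurableSet_Icc).mono hC)
  have hCS := integral_mul_le_Lp_mul_Lq_of_nonneg (μ := volume.restrict (Ioc 0 t))
    Real.HolderConjugate.two_two (Eventually.of_forall h0)
    (Eventually.of_forall fun s => norm_nonneg (u s)) hfm hu
  have hu2 : ∫ s in Ioc 0 t, ‖u s‖ ^ 2 ≤ ‖u‖ ^ 2 := by
    rw [← Ctl.integral_norm_sq u]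
    refine integral_mono_measure hle (Eventually.of_forall fun s => by positivity) ?_
    exact (Lp.memLp u).integrable_norm_pow (by norm_num)
  rw [intervalIntegral.integral_of_le ht.1, intervalIntegral.integral_of_le ht.1]
  simp only [Real.rpow_ofNat, ← Real.sqrt_eq_rpow] at hCS
  have hI : 0 ≤ ∫ s in Ioc 0 t, f s ^ 2 := integral_nonneg fun s => by positivity
  have hJ : 0 ≤ ∫ s in Ioc 0 t, ‖u s‖ ^ 2 := integral_nonneg fun s => by positivity
  calc (∫ s in Ioc 0 t, f s * ‖u s‖) ^ 2
      ≤ (√(∫ s in Ioc 0 t, f s ^ 2) * √(∫ s in Ioc 0 t, ‖u s‖ ^ 2)) ^ 2 :=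
        pow_le_pow_left₀ (integral_nonneg fun s => mul_nonneg (h0 s) (norm_nonneg _)) hCS 2
    _ = (∫ s in Ioc 0 t, f s ^ 2) * ∫ s in Ioc 0 t, ‖u s‖ ^ 2 := by
        rw [mul_pow, Real.sq_sqrt hI, Real.sq_sqrt hJ]
    _ ≤ ‖u‖ ^ 2 * ∫ s in Ioc 0 t, f s ^ 2 := by
        rw [mul_comm]; exact mul_le_mul_of_nonneg_right hu2 hI

variable (hT : 0 ≤ T)

lemma sq_norm_integral_apply_le {v : ℝ → W →L[ℝ] E} (hv : Continuous v) (u : Ctl T W) {t : ℝ}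
    (ht : t ∈ Icc 0 T) :
    ‖∫ s in (0 : ℝ)..t, v s (u s)‖ ^ 2 ≤ ‖u‖ ^ 2 * ∫ s in (0 : ℝ)..t, ‖v s‖ ^ 2 := by
  refine le_trans (pow_le_pow_left₀ (norm_nonneg _) ?_ 2)
    (Ctl.sq_integral_mul_norm_le hv.norm (fun s => norm_nonneg _) u ht)
  refine intervalIntegral.norm_integral_le_of_norm_le ht.1
    (ae_of_all _ fun s _ => ContinuousLinearMap.le_opNorm _ _) ?_
  refine Ctl.intervalIntegrable_of_integrable ?_ ht
  obtain ⟨C, hC⟩ := (isCompact_Icc (a := (0 : ℝ)) (b := T)).exists_bound_of_continuousOn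
    hv.continuousOn
  refine (u.integrable.norm.const_mul C).mono'
    (hv.norm.aestronglyMeasurable.mul u.integrable.norm.aestronglyMeasurable) ?_
  filter_upwards [ae_restrict_mem measurableSet_Icc] with s hs
  rw [norm_mul, norm_norm, norm_norm]
  exact mul_le_mul_of_nonneg_right (hC s hs) (norm_nonneg _)

lemma continuous_extend {F : Type*} [TopologicalSpace F] (v : C(Icc (0 : ℝ) T, F)) :
    Continuous fun s => v (projIcc 0 T hT s) := v.continuous.comp continuous_projIcc

/-- The continuous path `t ↦ ∫₀ᵗ v(s) u(s) ds`. A path on `[0,T]` is extended to the line by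
`projIcc`, so that it can stand under an integral over the real line. -/
def volterraPath (v : C(Icc (0 : ℝ) T, W →L[ℝ] E)) (u : Ctl T W) : C(Icc (0 : ℝ) T, E) where
  toFun t := ∫ s in (0 : ℝ)..t, v (projIcc 0 T hT s) (u s)
  continuous_toFun := by
    have h := intervalIntegral.continuousOn_primitive_interval (μ := volume)
      (f := fun s => v (projIcc 0 T hT s) (u s)) (a := 0) (b := T)
      (by rw [uIcc_of_le hT]; exact Ctl.integrable_apply (continuous_extend hT v) u)
    rw [uIcc_of_le hT] at h
    exact continuousOn_iff_continuous_domRestrict.mp h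

lemma volterraPath_apply (v : C(Icc (0 : ℝ) T, W →L[ℝ] E)) (u : Ctl T W) (t : Icc (0 : ℝ) T) :
    volterraPath hT v u t = ∫ s in (0 : ℝ)..t, v (projIcc 0 T hT s) (u s) := rfl

lemma Ctl.ae_Ioc {p : ℝ → Prop} (h : ∀ᵐ s ∂(volume.restrict (Icc (0 : ℝ) T)), p s) {t : ℝ}
    (ht : t ∈ Icc 0 T) : ∀ᵐ s ∂(volume.restrict (uIoc 0 t)), p s := by
  rw [uIoc_of_le ht.1]
  have hsub : Ioc 0 t ⊆ Icc 0 T := fun s hs => ⟨hs.1.le, hs.2.trans ht.2⟩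
  exact ae_restrict_of_ae_restrict_of_subset hsub h

/-- The Volterra map `(v, u) ↦ (t ↦ ∫₀ᵗ v(s) u(s) ds)`. -/
def volterra (E W : Type*) [NormedAddCommGroup E] [NormedSpace ℝ E]
    [NormedAddCommGroup W] [NormedSpace ℝ W] :
    C(Icc (0 : ℝ) T, W →L[ℝ] E) →L[ℝ] Ctl T W →L[ℝ] C(Icc (0 : ℝ) T, E) :=
  LinearMap.mkContinuous₂
    (LinearMap.mk₂ ℝ (volterraPath (E := E) (W := W) hT)
      (by
        intro v w u; ext t
        simp only [volterraPath_apply, ContinuousMap.add_apply, _root_.add_apply]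
        exact intervalIntegral.integral_add
          (Ctl.intervalIntegrable_of_integrable (Ctl.integrable_apply (continuous_extend hT v) u) t.2)
          (Ctl.intervalIntegrable_of_integrable (Ctl.integrable_apply (continuous_extend hT w) u) t.2))
      (by intro c v u; ext t; simp [volterraPath_apply])
      (by
        intro v u w; ext t
        simp only [volterraPath_apply, ContinuousMap.add_apply]
        rw [← intervalIntegral.integral_add
          (Ctl.intervalIntegrable_of_integrable (Ctl.integrable_apply (continuous_extend hT v) u) t.2)
          (Ctl.intervalIntegrable_of_integrable (Ctl.integrable_apply (continuous_extend hT v) w) t.2)]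
        refine intervalIntegral.integral_congr_ae_restrict ?_
        filter_upwards [Ctl.ae_Ioc (Lp.coeFn_add u w) t.2] with s hs
        rw [hs, Pi.add_apply, map_add])
      (by
        intro c v u; ext t
        simp only [volterraPath_apply, ContinuousMap.smul_apply]
        rw [← intervalIntegral.integral_smul]
        refine intervalIntegral.integral_congr_ae_restrict ?_
        filter_upwards [Ctl.ae_Ioc (Lp.coeFn_smul c u) t.2] with s hs
        rw [hs, Pi.smul_apply, map_smul]))
    (√T) (by
      intro (v : C(Icc (0 : ℝ) T, W →L[ℝ] E)) (u : Ctl T W)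
      rw [ContinuousMap.norm_le _ (by positivity)]
      intro t
      refine (pow_le_pow_iff_left₀ (norm_nonneg _) (by positivity) two_ne_zero).mp ?_
      refine (sq_norm_integral_apply_le (continuous_extend hT v) u t.2).trans ?_
      have h1 : ∫ s in (0 : ℝ)..t, ‖v (projIcc 0 T hT s)‖ ^ 2 ≤ ∫ s in (0 : ℝ)..t, ‖v‖ ^ 2 :=
        intervalIntegral.integral_mono_on t.2.1
          (((continuous_extend hT v).norm.pow 2).intervalIntegrable _ _)
          (by simp) (fun s _ => by gcongr; exact v.norm_coe_le_norm _)
      have h2 : ∫ s in (0 : ℝ)..t, ‖v‖ ^ 2 ≤ T * ‖v‖ ^ 2 := by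
        simpa using mul_le_mul_of_nonneg_right t.2.2 (sq_nonneg ‖v‖)
      rw [mul_pow, mul_pow, Real.sq_sqrt hT, mul_comm]
      exact mul_le_mul_of_nonneg_right (h1.trans h2) (sq_nonneg _))

@[simp]
lemma volterra_apply (v : C(Icc (0 : ℝ) T, W →L[ℝ] E)) (u : Ctl T W) (t : Icc (0 : ℝ) T) :
    volterra hT E W v u t = ∫ s in (0 : ℝ)..t, v (projIcc 0 T hT s) (u s) := rfl

end Volterra

/-! ### Fixed points of Volterra type maps -/

section FixedPoint

/-- Iterated integration gains a factorial. -/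
lemma le_pow_div_factorial_of_le_integral {T M c : ℝ} (hM : 0 ≤ M) (w : ℕ → ℝ → ℝ)
    (hw : ∀ n, Continuous (w n)) (h0 : ∀ t ∈ Icc 0 T, w 0 t ≤ c)
    (hs : ∀ n, ∀ t ∈ Icc 0 T, w (n + 1) t ≤ M * ∫ s in (0 : ℝ)..t, w n s) (n : ℕ) :
    ∀ t ∈ Icc 0 T, w n t ≤ (M * t) ^ n / n.factorial * c := by
  induction n with
  | zero => intro t ht; simpa using h0 t ht
  | succ n ih =>
    intro t ht
    have h1 : ∫ s in (0 : ℝ)..t, w n s ≤ ∫ s in (0 : ℝ)..t, (M ^ n / n.factorial * c) * s ^ n := by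
      refine intervalIntegral.integral_mono_on ht.1 ((hw n).intervalIntegrable _ _)
        ((by fun_prop : Continuous _).intervalIntegrable _ _) fun s hs => ?_
      refine (ih s ⟨hs.1, hs.2.trans ht.2⟩).trans_eq ?_
      rw [mul_pow]; ring
    refine (hs n t ht).trans ((mul_le_mul_of_nonneg_left h1 hM).trans_eq ?_)
    rw [intervalIntegral.integral_const_mul, integral_pow, Nat.factorial_succ]
    push_cast
    have : (n.factorial : ℝ) ≠ 0 := by positivity
    field_simp
    ring

variable {T : ℝ} (hT : 0 ≤ T) {E : Type*} [NormedAddCommGroup E]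

lemma exists_pow_div_factorial_le (a : ℝ) : ∃ n : ℕ, a ^ n / n.factorial ≤ 1 / 4 :=
  ((FloorSemiring.tendsto_pow_div_factorial_atTop a).eventually_le_const (by norm_num)).exists

/-- Grönwall's inequality in the form of a uniqueness statement; squares appear because the controls
are only square integrable. -/
lemma eq_of_sq_norm_sub_le_integral {M : ℝ} (hM : 0 ≤ M) {x y : C(Icc (0 : ℝ) T, E)}
    (h : ∀ t : Icc (0 : ℝ) T, ‖x t - y t‖ ^ 2 ≤
      M * ∫ s in (0 : ℝ)..t, ‖x (projIcc 0 T hT s) - y (projIcc 0 T hT s)‖ ^ 2) : x = y := by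
  obtain ⟨n, hn⟩ := exists_pow_div_factorial_le (M * T)
  have hle := le_pow_div_factorial_of_le_integral (T := T) (c := ‖x - y‖ ^ 2) hM
    (fun _ s => ‖x (projIcc 0 T hT s) - y (projIcc 0 T hT s)‖ ^ 2)
    (fun _ => (((continuous_extend hT x).sub (continuous_extend hT y)).norm.pow 2))
    (fun t _ => by gcongr; exact (x - y).norm_coe_le_norm _)
    (fun _ t ht => by simpa [projIcc_of_mem hT ht] using h ⟨t, ht⟩) n
  have h2 : ‖x - y‖ ≤ ‖x - y‖ / 2 := by
    rw [ContinuousMap.norm_le _ (by positivity)]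
    intro t
    refine (pow_le_pow_iff_left₀ (norm_nonneg _) (by positivity) two_ne_zero).mp ?_
    have h3 := hle t t.2
    rw [projIcc_val] at h3
    have h4 : (M * (t : ℝ)) ^ n / n.factorial ≤ (M * T) ^ n / n.factorial := by
      have := t.2.1
      have := t.2.2
      gcongr
    rw [ContinuousMap.sub_apply]
    nlinarith [sq_nonneg ‖x - y‖]
  have h5 : ‖x - y‖ = 0 := by linarith [norm_nonneg (x - y)]
  exact sub_eq_zero.mp (norm_eq_zero.mp h5)

/-- A self-map of `C([0,T], E)` of Volterra type has a fixed point: some iterate contracts. -/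
lemma exists_fixedPoint_of_volterra [CompleteSpace E] {M : ℝ} (hM : 0 ≤ M)
    (Φ : C(Icc (0 : ℝ) T, E) → C(Icc (0 : ℝ) T, E))
    (hΦ : ∀ x y, ∀ t : Icc (0 : ℝ) T, ‖Φ x t - Φ y t‖ ^ 2 ≤
      M * ∫ s in (0 : ℝ)..t, ‖x (projIcc 0 T hT s) - y (projIcc 0 T hT s)‖ ^ 2) :
    ∃ x, Φ x = x := by
  obtain ⟨n, hn⟩ := exists_pow_div_factorial_le (M * T)
  have hcontr : ContractingWith (1 / 2) (Φ^[n]) := by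
    refine ⟨by rw [← NNReal.coe_lt_coe]; norm_num, LipschitzWith.of_dist_le_mul fun x y => ?_⟩
    have hle := le_pow_div_factorial_of_le_integral (T := T) (c := ‖x - y‖ ^ 2) hM
      (fun k s => ‖Φ^[k] x (projIcc 0 T hT s) - Φ^[k] y (projIcc 0 T hT s)‖ ^ 2)
      (fun k => (((continuous_extend hT (Φ^[k] x)).sub
        (continuous_extend hT (Φ^[k] y))).norm.pow 2))
      (fun t _ => by gcongr; exact (x - y).norm_coe_le_norm _)
      (fun k t ht => by
        have := hΦ (Φ^[k] x) (Φ^[k] y) ⟨t, ht⟩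
        simpa only [projIcc_of_mem hT ht, Function.iterate_succ_apply'] using this) n
    rw [dist_eq_norm, dist_eq_norm, ContinuousMap.norm_le _ (by positivity)]
    intro t
    refine (pow_le_pow_iff_left₀ (norm_nonneg _) (by positivity) two_ne_zero).mp ?_
    have h3 := hle t t.2
    rw [projIcc_val] at h3
    have h4 : (M * (t : ℝ)) ^ n / n.factorial ≤ (M * T) ^ n / n.factorial := by
      have := t.2.1
      have := t.2.2
      gcongr
    rw [ContinuousMap.sub_apply]
    push_cast
    nlinarith [sq_nonneg ‖x - y‖]
  have : Nonempty C(Icc (0 : ℝ) T, E) := ⟨0⟩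
  exact ⟨_, hcontr.isFixedPt_fixedPoint_iterate⟩

end FixedPoint

/-! ### Controlled integral equations and smooth dependence on the data -/

section Solutions

variable {T : ℝ} (hT : 0 ≤ T) {E W : Type} [NormedAddCommGroup E] [NormedSpace ℝ E]
  [NormedAddCommGroup W] [NormedSpace ℝ W]

/-- `x` solves `x_t = y + ∫₀ᵗ V(x_s) u_s ds` on `[0,T]`. -/
def IsSol (V : E → W →L[ℝ] E) (u : Ctl T W) (y : E) (x : C(Icc (0 : ℝ) T, E)) : Prop :=
  ∀ t : Icc (0 : ℝ) T, x t = y + ∫ s in (0 : ℝ)..t, V (x (projIcc 0 T hT s)) (u s)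

/-- The solution of `x_t = y + ∫₀ᵗ V(x_s) u_s ds`, arbitrary if there is none. -/
def sol (V : E → W →L[ℝ] E) (u : Ctl T W) (y : E) : C(Icc (0 : ℝ) T, E) :=
  Classical.epsilon (IsSol hT V u y)

variable {hT} {V : E → W →L[ℝ] E}

lemma isSol_sol {u : Ctl T W} {y : E} (h : ∃ x, IsSol hT V u y x) :
    IsSol hT V u y (sol hT V u y) := Classical.epsilon_spec h

lemma isSol_iff_eq (hV : Continuous V) {u : Ctl T W} {y : E} {x : C(Icc (0 : ℝ) T, E)} :
    IsSol hT V u y x ↔ x = ContinuousLinearMap.const (R := ℝ) (M := E) (Icc (0 : ℝ) T) y +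
      volterra hT E W ((⟨V, hV⟩ : C(E, W →L[ℝ] E)).comp x) u := by
  rw [ContinuousMap.ext_iff]
  rfl

lemma IsSol.apply_zero {u : Ctl T W} {y : E} {x : C(Icc (0 : ℝ) T, E)} (h : IsSol hT V u y x) :
    x ⟨0, le_rfl, hT⟩ = y := by
  simpa using h ⟨0, le_rfl, hT⟩

lemma sq_norm_integral_sub_le (hV : Continuous V) (u : Ctl T W) {L : ℝ} {s : Set E}
    (hL : ∀ a ∈ s, ∀ b ∈ s, ‖V a - V b‖ ≤ L * ‖a - b‖)
    {x y : C(Icc (0 : ℝ) T, E)} (hx : ∀ t, x t ∈ s) (hy : ∀ t, y t ∈ s) (t : Icc (0 : ℝ) T) :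
    ‖(∫ s in (0 : ℝ)..t, V (x (projIcc 0 T hT s)) (u s)) -
      ∫ s in (0 : ℝ)..t, V (y (projIcc 0 T hT s)) (u s)‖ ^ 2 ≤
      (‖u‖ ^ 2 * L ^ 2) * ∫ s in (0 : ℝ)..t,
        ‖x (projIcc 0 T hT s) - y (projIcc 0 T hT s)‖ ^ 2 := by
  have hcx : Continuous fun s => V (x (projIcc 0 T hT s)) := hV.comp (continuous_extend hT x)
  have hcy : Continuous fun s => V (y (projIcc 0 T hT s)) := hV.comp (continuous_extend hT y)
  rw [← intervalIntegral.integral_sub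
    (Ctl.intervalIntegrable_of_integrable (Ctl.integrable_apply hcx u) t.2)
    (Ctl.intervalIntegrable_of_integrable (Ctl.integrable_apply hcy u) t.2)]
  have h := sq_norm_integral_apply_le (hcx.sub hcy) u t.2
  refine h.trans ?_
  rw [mul_assoc]
  refine mul_le_mul_of_nonneg_left ?_ (sq_nonneg ‖u‖)
  rw [← intervalIntegral.integral_const_mul]
  refine intervalIntegral.integral_mono_on t.2.1
    (((hcx.sub hcy).norm.pow 2).intervalIntegrable _ _)
    ((((((continuous_extend hT x).sub (continuous_extend hT y)).norm.pow 2)).const_smul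
      (L ^ 2)).intervalIntegrable _ _) fun r _ => ?_
  rw [← mul_pow]
  exact pow_le_pow_left₀ (by positivity) (hL _ (hx _) _ (hy _)) 2

/-- Uniqueness needs only the Lipschitz constant of `V` on the compact ranges of the two solutions. -/
lemma IsSol.unique (hV : ContDiff ℝ 1 V) {u : Ctl T W} {y : E} {x x' : C(Icc (0 : ℝ) T, E)}
    (h : IsSol hT V u y x) (h' : IsSol hT V u y x') : x = x' := by
  obtain ⟨L, hL⟩ := (hV.locallyLipschitz.locallyLipschitzOn
    (s := range x ∪ range x')).exists_lipschitzOnWith_of_compact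
    ((isCompact_range x.continuous).union (isCompact_range x'.continuous))
  refine eq_of_sq_norm_sub_le_integral hT (M := ‖u‖ ^ 2 * (L : ℝ) ^ 2) (by positivity) fun t => ?_
  rw [h t, h' t, add_sub_add_left_eq_sub]
  refine sq_norm_integral_sub_le hV.continuous u (s := range x ∪ range x') (fun a ha b hb => ?_)
    (fun t => Or.inl (mem_range_self t)) (fun t => Or.inr (mem_range_self t)) t
  simpa [dist_eq_norm] using hL.dist_le_mul a ha b hb

lemma IsSol.eq_sol (hV : ContDiff ℝ 1 V) {u : Ctl T W} {y : E} {x : C(Icc (0 : ℝ) T, E)}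
    (h : IsSol hT V u y x) : sol hT V u y = x :=
  (isSol_sol ⟨x, h⟩).unique hV h

lemma exists_isSol_of_lipschitz [CompleteSpace E] (hV : Continuous V) {L : ℝ}
    (hL : ∀ a b, ‖V a - V b‖ ≤ L * ‖a - b‖) (u : Ctl T W) (y : E) : ∃ x, IsSol hT V u y x := by
  obtain ⟨x, hx⟩ := exists_fixedPoint_of_volterra hT (M := ‖u‖ ^ 2 * L ^ 2) (by positivity)
    (fun x => ContinuousLinearMap.const (R := ℝ) (M := E) (Icc (0 : ℝ) T) y +
      volterra hT E W ((⟨V, hV⟩ : C(E, W →L[ℝ] E)).comp x) u) (fun x x' t => by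
        have := sq_norm_integral_sub_le (hT := hT) hV u (s := univ) (fun a _ b _ => hL a b)
          (fun t => mem_univ (x t)) (fun t => mem_univ (x' t)) t
        simpa using this)
  exact ⟨x, (isSol_iff_eq hV).mpr hx.symm⟩

variable (hT)

/-- The linear Volterra operator `ξ ↦ (t ↦ ∫₀ᵗ a(s)(ξ(s)) u(s) ds)`. -/
def linVolterra (a : C(Icc (0 : ℝ) T, E →L[ℝ] W →L[ℝ] E)) (u : Ctl T W) :
    C(Icc (0 : ℝ) T, E) →L[ℝ] C(Icc (0 : ℝ) T, E) :=
  ((volterra hT E W).flip u) ∘L (pointwiseApply (Icc (0 : ℝ) T) E (W →L[ℝ] E) a)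

lemma linVolterra_apply (a : C(Icc (0 : ℝ) T, E →L[ℝ] W →L[ℝ] E)) (u : Ctl T W)
    (ξ : C(Icc (0 : ℝ) T, E)) (t : Icc (0 : ℝ) T) :
    linVolterra hT a u ξ t =
      ∫ s in (0 : ℝ)..t, a (projIcc 0 T hT s) (ξ (projIcc 0 T hT s)) (u s) := rfl

lemma exists_norm_le_of_continuousMap (a : C(Icc (0 : ℝ) T, E →L[ℝ] W →L[ℝ] E)) :
    ∃ A, ∀ t, ‖a t‖ ≤ A := by
  obtain ⟨A, hA⟩ := isCompact_univ.exists_bound_of_continuousOn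
    (E := E →L[ℝ] W →L[ℝ] E) (f := a) a.continuous.continuousOn
  exact ⟨A, fun t => hA t (mem_univ t)⟩

lemma sq_norm_linVolterra_le {a : C(Icc (0 : ℝ) T, E →L[ℝ] W →L[ℝ] E)} {A : ℝ}
    (hA : ∀ t, ‖a t‖ ≤ A) (u : Ctl T W) (ξ : C(Icc (0 : ℝ) T, E)) (t : Icc (0 : ℝ) T) :
    ‖linVolterra hT a u ξ t‖ ^ 2 ≤
      (‖u‖ ^ 2 * A ^ 2) * ∫ s in (0 : ℝ)..t, ‖ξ (projIcc 0 T hT s)‖ ^ 2 := by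
  have hc : Continuous fun s => a (projIcc 0 T hT s) (ξ (projIcc 0 T hT s)) :=
    (continuous_extend hT a).clm_apply (continuous_extend hT ξ)
  rw [linVolterra_apply]
  refine (sq_norm_integral_apply_le hc u t.2).trans ?_
  rw [mul_assoc]
  refine mul_le_mul_of_nonneg_left ?_ (sq_nonneg ‖u‖)
  rw [← intervalIntegral.integral_const_mul]
  refine intervalIntegral.integral_mono_on t.2.1 ((hc.norm.pow 2).intervalIntegrable _ _)
    ((((continuous_extend hT ξ).norm.pow 2).const_smul (A ^ 2)).intervalIntegrable _ _)
    fun r _ => ?_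
  rw [← mul_pow]
  exact pow_le_pow_left₀ (by positivity) ((ContinuousLinearMap.le_opNorm _ _).trans
    (mul_le_mul_of_nonneg_right (hA _) (norm_nonneg _))) 2

lemma eq_of_linVolterra {a : C(Icc (0 : ℝ) T, E →L[ℝ] W →L[ℝ] E)} {u : Ctl T W}
    {b ξ ξ' : C(Icc (0 : ℝ) T, E)} (h : ξ = b + linVolterra hT a u ξ)
    (h' : ξ' = b + linVolterra hT a u ξ') : ξ = ξ' := by
  obtain ⟨A, hA⟩ := exists_norm_le_of_continuousMap a
  refine eq_of_sq_norm_sub_le_integral hT (M := ‖u‖ ^ 2 * A ^ 2) (by positivity) fun t => ?_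
  have h1 : ξ t - ξ' t = linVolterra hT a u (ξ - ξ') t := by
    conv_lhs => rw [h, h']
    simp [map_sub]
  rw [h1]
  exact sq_norm_linVolterra_le hT hA u (ξ - ξ') t

lemma exists_eq_linVolterra [CompleteSpace E] (a : C(Icc (0 : ℝ) T, E →L[ℝ] W →L[ℝ] E))
    (u : Ctl T W) (b : C(Icc (0 : ℝ) T, E)) : ∃ ξ, ξ = b + linVolterra hT a u ξ := by
  obtain ⟨A, hA⟩ := exists_norm_le_of_continuousMap a
  obtain ⟨ξ, hξ⟩ := exists_fixedPoint_of_volterra hT (M := ‖u‖ ^ 2 * A ^ 2) (by positivity)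
    (fun ξ => b + linVolterra hT a u ξ) (fun ξ ξ' t => by
      have := sq_norm_linVolterra_le hT hA u (ξ - ξ') t
      simpa [map_sub] using this)
  exact ⟨ξ, hξ.symm⟩

lemma isInvertible_id_sub_linVolterra [CompleteSpace E]
    (a : C(Icc (0 : ℝ) T, E →L[ℝ] W →L[ℝ] E)) (u : Ctl T W) :
    (ContinuousLinearMap.id ℝ C(Icc (0 : ℝ) T, E) - linVolterra hT a u).IsInvertible := by
  have hker : (ContinuousLinearMap.id ℝ C(Icc (0 : ℝ) T, E) - linVolterra hT a u).ker = ⊥ := by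
    rw [LinearMap.ker_eq_bot']
    intro ξ hξ
    refine eq_of_linVolterra hT (b := 0) (a := a) (u := u) ?_ (by simp)
    have : ξ - linVolterra hT a u ξ = 0 := hξ
    rw [zero_add]
    exact sub_eq_zero.mp this
  have hrange : (ContinuousLinearMap.id ℝ C(Icc (0 : ℝ) T, E) - linVolterra hT a u).range = ⊤ := by
    rw [LinearMap.range_eq_top]
    intro b
    obtain ⟨ξ, hξ⟩ := exists_eq_linVolterra hT a u b
    exact ⟨ξ, sub_eq_of_eq_add hξ⟩
  exact ⟨ContinuousLinearEquiv.ofBijective _ hker hrange, ContinuousLinearEquiv.coe_ofBijective _ _ _⟩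

variable {hT}

/-- The map whose zeros `((u, y), x)` are the solutions. -/
def solEq (hV : Continuous V) (q : (Ctl T W × E) × C(Icc (0 : ℝ) T, E)) : C(Icc (0 : ℝ) T, E) :=
  q.2 - ContinuousLinearMap.const (R := ℝ) (M := E) (Icc (0 : ℝ) T) q.1.2 -
    volterra hT E W ((⟨V, hV⟩ : C(E, W →L[ℝ] E)).comp q.2) q.1.1

lemma contDiff_sub_bilin {X Y U Z : Type*} [NormedAddCommGroup X] [NormedSpace ℝ X]
    [NormedAddCommGroup Y] [NormedSpace ℝ Y] [NormedAddCommGroup U] [NormedSpace ℝ U]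
    [NormedAddCommGroup Z] [NormedSpace ℝ Z] {N : X → Y} {n : WithTop ℕ∞} (hN : ContDiff ℝ n N)
    (B : Y →L[ℝ] U →L[ℝ] X) (c : Z →L[ℝ] X) :
    ContDiff ℝ n fun q : (U × Z) × X => q.2 - c q.1.2 - B (N q.2) q.1.1 := by
  fun_prop

lemma hasFDerivAt_sub_bilin {X Y U Z : Type*} [NormedAddCommGroup X] [NormedSpace ℝ X]
    [NormedAddCommGroup Y] [NormedSpace ℝ Y] [NormedAddCommGroup U] [NormedSpace ℝ U]
    [NormedAddCommGroup Z] [NormedSpace ℝ Z] {N : X → Y} {N' : X →L[ℝ] Y} {u : U} {z : Z} {x : X}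
    (hN : HasFDerivAt N N' x) (B : Y →L[ℝ] U →L[ℝ] X) (c : Z →L[ℝ] X) :
    HasFDerivAt (fun q : (U × Z) × X => q.2 - c q.1.2 - B (N q.2) q.1.1)
      (ContinuousLinearMap.snd ℝ (U × Z) X -
        c ∘L (ContinuousLinearMap.snd ℝ U Z ∘L ContinuousLinearMap.fst ℝ (U × Z) X) -
        ((B.flip u ∘L N') ∘L ContinuousLinearMap.snd ℝ (U × Z) X +
          B (N x) ∘L (ContinuousLinearMap.fst ℝ U Z ∘L ContinuousLinearMap.fst ℝ (U × Z) X)))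
      ((u, z), x) := by
  have h2 : HasFDerivAt (fun q : (U × Z) × X => q.2) (ContinuousLinearMap.snd ℝ (U × Z) X)
    ((u, z), x) := hasFDerivAt_snd
  have h1 : HasFDerivAt (fun q : (U × Z) × X => q.1) (ContinuousLinearMap.fst ℝ (U × Z) X)
    ((u, z), x) := hasFDerivAt_fst
  have h11 : HasFDerivAt (fun q : (U × Z) × X => q.1.1)
    (ContinuousLinearMap.fst ℝ U Z ∘L ContinuousLinearMap.fst ℝ (U × Z) X) ((u, z), x) := h1.fst
  have h12 : HasFDerivAt (fun q : (U × Z) × X => q.1.2)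
    (ContinuousLinearMap.snd ℝ U Z ∘L ContinuousLinearMap.fst ℝ (U × Z) X) ((u, z), x) := h1.snd
  have hBN := (B.hasFDerivAt (x := N x)).comp ((u, z), x)
    (HasFDerivAt.comp (x := ((u, z), x)) (g := N) (f := fun q : (U × Z) × X => q.2) hN h2)
  refine ((h2.sub (c.hasFDerivAt.comp _ h12)).sub (hBN.clm_apply h11)).congr_fderiv ?_
  ext q <;> simp

lemma contDiff_solEq (hV : ContDiff ℝ ∞ V) : ContDiff ℝ ∞ (solEq (hT := hT) hV.continuous) :=
  contDiff_sub_bilin (Y := C(Icc (0 : ℝ) T, W →L[ℝ] E))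
    (contDiff_comp_left (K := Icc (0 : ℝ) T) hV) (volterra hT E W)
    (ContinuousLinearMap.const (R := ℝ) (M := E) (Icc (0 : ℝ) T))

lemma isSol_iff_solEq (hV : Continuous V) {u : Ctl T W} {y : E} {x : C(Icc (0 : ℝ) T, E)} :
    IsSol hT V u y x ↔ solEq (hT := hT) hV ((u, y), x) = 0 := by
  rw [isSol_iff_eq hV, solEq, sub_sub, sub_eq_zero]

/-- The coefficient `fderiv V ∘ x` of the linearised equation along `x`. -/
def linCoeff (hV : ContDiff ℝ ∞ V) (x : C(Icc (0 : ℝ) T, E)) :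
    C(Icc (0 : ℝ) T, E →L[ℝ] W →L[ℝ] E) :=
  (⟨fderiv ℝ V, hV.continuous_fderiv (by simp)⟩ : C(E, E →L[ℝ] W →L[ℝ] E)).comp x

set_option maxHeartbeats 400000 in
lemma hasFDerivAt_solEq (hV : ContDiff ℝ ∞ V) (u : Ctl T W) (y : E) (x : C(Icc (0 : ℝ) T, E)) :
    HasFDerivAt (solEq (hT := hT) hV.continuous)
      (ContinuousLinearMap.snd ℝ (Ctl T W × E) C(Icc (0 : ℝ) T, E) -
        (ContinuousLinearMap.const (R := ℝ) (M := E) (Icc (0 : ℝ) T)) ∘L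
          (ContinuousLinearMap.snd ℝ _ _ ∘L ContinuousLinearMap.fst ℝ _ _) -
        (linVolterra hT (linCoeff hV x) u ∘L ContinuousLinearMap.snd ℝ _ _ +
          volterra hT E W ((⟨V, hV.continuous⟩ : C(E, W →L[ℝ] E)).comp x) ∘L
            (ContinuousLinearMap.fst ℝ _ _ ∘L ContinuousLinearMap.fst ℝ _ _))) ((u, y), x) := by
  have hN := hasFDerivAt_comp_left (K := Icc (0 : ℝ) T) (hV.of_le (by exact_mod_cast le_top)) x
  have h := hasFDerivAt_sub_bilin (Y := C(Icc (0 : ℝ) T, W →L[ℝ] E)) (u := u) (z := y) hN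
    (volterra hT E W) (ContinuousLinearMap.const (R := ℝ) (M := E) (Icc (0 : ℝ) T))
  exact h

lemma fderiv_solEq_isInvertible [CompleteSpace E] (hV : ContDiff ℝ ∞ V) (u : Ctl T W) (y : E)
    (x : C(Icc (0 : ℝ) T, E)) :
    (fderiv ℝ (solEq (hT := hT) hV.continuous) ((u, y), x) ∘L
      ContinuousLinearMap.inr ℝ (Ctl T W × E) C(Icc (0 : ℝ) T, E)).IsInvertible := by
  have h : fderiv ℝ (solEq (hT := hT) hV.continuous) ((u, y), x) ∘L
      ContinuousLinearMap.inr ℝ (Ctl T W × E) C(Icc (0 : ℝ) T, E) =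
      ContinuousLinearMap.id ℝ C(Icc (0 : ℝ) T, E) - linVolterra hT (linCoeff hV x) u := by
    rw [(hasFDerivAt_solEq hV u y x).fderiv]
    ext ξ t
    simp
  rw [h]
  exact isInvertible_id_sub_linVolterra hT (linCoeff hV x) u

/-- Smooth dependence on control and initial value near an existing solution, by the implicit function
theorem for `solEq` on the space of paths. -/
lemma IsSol.eventually_and_contDiffAt [CompleteSpace E] [CompleteSpace W]
    (hV : ContDiff ℝ ∞ V) {u : Ctl T W} {y : E} {x : C(Icc (0 : ℝ) T, E)} (h : IsSol hT V u y x) :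
    (∀ᶠ q : Ctl T W × E in 𝓝 (u, y), IsSol hT V q.1 q.2 (sol hT V q.1 q.2)) ∧
      ContDiffAt ℝ ∞ (fun q : Ctl T W × E => sol hT V q.1 q.2) (u, y) := by
  have hV1 : ContDiff ℝ 1 V := hV.of_le (by exact_mod_cast le_top)
  have cdf : ContDiffAt ℝ ∞ (solEq (hT := hT) hV.continuous) ((u, y), x) :=
    (contDiff_solEq hV).contDiffAt
  have hinv := fderiv_solEq_isInvertible (hT := hT) hV u y x
  have h0 := (isSol_iff_solEq hV.continuous).mp h
  have hev := cdf.eventually_apply_implicitFunction (by simp) hinv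
  have hsol : ∀ᶠ q : Ctl T W × E in 𝓝 (u, y),
      IsSol hT V q.1 q.2 (cdf.implicitFunction (by simp) hinv q) := by
    filter_upwards [hev] with q hq
    exact (isSol_iff_solEq hV.continuous).mpr (hq.trans h0)
  refine ⟨hsol.mono fun q hq => isSol_sol ⟨_, hq⟩, ?_⟩
  exact (cdf.contDiffAt_implicitFunction (by simp) hinv).congr_of_eventuallyEq
    (hsol.mono fun q hq => hq.eq_sol hV1)

/-- The linearised equation: the derivative of the solution in the direction of a control `k` and
an initial vector `η`. -/
lemma IsSol.fderiv_sol [CompleteSpace E] [CompleteSpace W] (hV : ContDiff ℝ ∞ V) {u : Ctl T W}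
    {y : E} {x : C(Icc (0 : ℝ) T, E)} (h : IsSol hT V u y x) (k : Ctl T W) (η : E) :
    fderiv ℝ (fun q : Ctl T W × E => sol hT V q.1 q.2) (u, y) (k, η) =
      (ContinuousLinearMap.const (R := ℝ) (M := E) (Icc (0 : ℝ) T) η +
        volterra hT E W ((⟨V, hV.continuous⟩ : C(E, W →L[ℝ] E)).comp x) k) +
        linVolterra hT (linCoeff hV x) u
          (fderiv ℝ (fun q : Ctl T W × E => sol hT V q.1 q.2) (u, y) (k, η)) := by
  have hV1 : ContDiff ℝ 1 V := hV.of_le (by exact_mod_cast le_top)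
  obtain ⟨hev, hcd⟩ := h.eventually_and_contDiffAt hV
  have hd := (hcd.differentiableAt (by simp)).hasFDerivAt
  set D := fderiv ℝ (fun q : Ctl T W × E => sol hT V q.1 q.2) (u, y)
  have hS : sol hT V u y = x := h.eq_sol hV1
  have hF := hasFDerivAt_solEq (hT := hT) hV u y x
  rw [← hS] at hF
  have hcomp := HasFDerivAt.comp (x := (u, y))
    (f := fun q : Ctl T W × E => (q, sol hT V q.1 q.2)) hF ((hasFDerivAt_id (u, y)).prodMk hd)
  have hzero : HasFDerivAt (solEq (hT := hT) hV.continuous ∘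
      fun q : Ctl T W × E => (q, sol hT V q.1 q.2))
      (0 : Ctl T W × E →L[ℝ] C(Icc (0 : ℝ) T, E)) (u, y) := by
    refine (hasFDerivAt_const (0 : C(Icc (0 : ℝ) T, E)) _).congr_of_eventuallyEq ?_
    filter_upwards [hev] with q hq
    exact (isSol_iff_solEq hV.continuous).mp hq
  have heq := congrArg (fun A => A (k, η)) (hcomp.unique hzero)
  rw [hS] at heq
  simp only [ContinuousLinearMap.comp_apply, ContinuousLinearMap.prod_apply, _root_.sub_apply,
    _root_.add_apply, ContinuousLinearMap.coe_snd', ContinuousLinearMap.coe_fst',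
    ContinuousLinearMap.id_apply, _root_.zero_apply] at heq
  rw [sub_sub, sub_eq_zero] at heq
  rw [add_assoc, add_comm (volterra hT E W _ k)]
  exact heq

/-- The fixed point form of the linearised equation, written out. -/
lemma isLin_iff (a : C(Icc (0 : ℝ) T, E →L[ℝ] W →L[ℝ] E)) (v : C(Icc (0 : ℝ) T, W →L[ℝ] E))
    (u k : Ctl T W) (η : E) (ξ : C(Icc (0 : ℝ) T, E)) :
    ξ = (ContinuousLinearMap.const (R := ℝ) (M := E) (Icc (0 : ℝ) T) η + volterra hT E W v k) +
        linVolterra hT a u ξ ↔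
      ∀ t : Icc (0 : ℝ) T, ξ t = η + ∫ s in (0 : ℝ)..t,
        (a (projIcc 0 T hT s) (ξ (projIcc 0 T hT s)) (u s) + v (projIcc 0 T hT s) (k s)) := by
  rw [ContinuousMap.ext_iff]
  refine forall_congr' fun t => ?_
  have hc : Continuous fun s => a (projIcc 0 T hT s) (ξ (projIcc 0 T hT s)) :=
    (continuous_extend hT a).clm_apply (continuous_extend hT ξ)
  rw [intervalIntegral.integral_add
    (Ctl.intervalIntegrable_of_integrable (Ctl.integrable_apply hc u) t.2)
    (Ctl.intervalIntegrable_of_integrable (Ctl.integrable_apply (continuous_extend hT v) k) t.2),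
    add_comm (∫ s in (0 : ℝ)..t, a (projIcc 0 T hT s) (ξ (projIcc 0 T hT s)) (u s)), ← add_assoc]
  rfl

end Solutions

/-! ### Product rule for primitives of integrable functions -/

section ProductRule

lemma mul_eq_add_integral_of_primitives {t a b : ℝ} {φ γ : ℝ → ℝ}
    (hφ : IntervalIntegrable φ volume 0 t) (hγ : IntervalIntegrable γ volume 0 t) :
    (a + ∫ r in (0 : ℝ)..t, φ r) * (b + ∫ r in (0 : ℝ)..t, γ r) = a * b +
      ∫ s in (0 : ℝ)..t, (φ s * (b + ∫ r in (0 : ℝ)..s, γ r) +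
        (a + ∫ r in (0 : ℝ)..s, φ r) * γ s) := by
  have hconst : ∀ c : ℝ, AbsolutelyContinuousOnInterval (fun _ : ℝ => c) 0 t := fun c =>
    (LipschitzWith.const c).lipschitzOnWith.absolutelyContinuousOnInterval
  have hf : AbsolutelyContinuousOnInterval (fun s => a + ∫ r in (0 : ℝ)..s, φ r) 0 t :=
    (hconst a).add (hφ.absolutelyContinuousOnInterval_intervalIntegral left_mem_uIcc)
  have hg : AbsolutelyContinuousOnInterval (fun s => b + ∫ r in (0 : ℝ)..s, γ r) 0 t :=
    (hconst b).add (hγ.absolutelyContinuousOnInterval_intervalIntegral left_mem_uIcc)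
  have h := hf.integral_deriv_mul_eq_sub hg
  simp only [intervalIntegral.integral_same, add_zero] at h
  rw [← sub_eq_iff_eq_add', ← h]
  refine intervalIntegral.integral_congr_ae ?_
  filter_upwards [hφ.ae_hasDerivAt_integral, hγ.ae_hasDerivAt_integral] with s h1 h2 hs
  have hs' := uIoc_subset_uIcc hs
  rw [((h1 hs' 0 left_mem_uIcc).const_add a).deriv, ((h2 hs' 0 left_mem_uIcc).const_add b).deriv]

/-- Product rule for the Euclidean pairing of two primitives of merely integrable functions. -/
lemma inner_eq_add_integral_of_primitives {d : ℕ} {T : ℝ} {f g φ γ : ℝ → Euc d} {a b : Euc d}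
    (hφ : IntegrableOn φ (Icc 0 T) volume) (hγ : IntegrableOn γ (Icc 0 T) volume)
    (hf : ∀ s ∈ Icc 0 T, f s = a + ∫ r in (0 : ℝ)..s, φ r)
    (hg : ∀ s ∈ Icc 0 T, g s = b + ∫ r in (0 : ℝ)..s, γ r) {t : ℝ} (ht : t ∈ Icc 0 T) :
    inner ℝ (f t) (g t) = inner ℝ a b +
      ∫ s in (0 : ℝ)..t, (inner ℝ (φ s) (g s) + inner ℝ (f s) (γ s)) := by
  have hφi : ∀ s ∈ Icc 0 T, IntervalIntegrable φ volume 0 s :=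
    fun s hs => Ctl.intervalIntegrable_of_integrable hφ hs
  have hγi : ∀ s ∈ Icc 0 T, IntervalIntegrable γ volume 0 s :=
    fun s hs => Ctl.intervalIntegrable_of_integrable hγ hs
  have hcoord : ∀ (ψ : ℝ → Euc d) (s : ℝ) (i : Fin d), IntervalIntegrable ψ volume 0 s →
      (∫ r in (0 : ℝ)..s, ψ r) i = ∫ r in (0 : ℝ)..s, ψ r i := fun ψ s i h =>
    ((EuclideanSpace.proj (𝕜 := ℝ) i).intervalIntegral_comp_comm h).symm
  have hint : ∀ (ψ : ℝ → Euc d) (i : Fin d), IntervalIntegrable ψ volume 0 t →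
      IntervalIntegrable (fun s => ψ s i) volume 0 t := fun ψ i h =>
    ⟨(EuclideanSpace.proj (𝕜 := ℝ) i).integrable_comp h.1,
      (EuclideanSpace.proj (𝕜 := ℝ) i).integrable_comp h.2⟩
  have hsub : ∀ s ∈ uIcc 0 t, s ∈ Icc 0 T := fun s hs => by
    rw [uIcc_of_le ht.1] at hs
    exact ⟨hs.1, hs.2.trans ht.2⟩
  have hprim : ∀ (c : ℝ) (ψ : ℝ → ℝ), IntervalIntegrable ψ volume 0 t →
      ContinuousOn (fun s => c + ∫ r in (0 : ℝ)..s, ψ r) (uIcc 0 t) := fun c ψ h =>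
    continuousOn_const.add (intervalIntegral.continuousOn_primitive_interval'
      h left_mem_uIcc)
  have key : ∀ i : Fin d, f t i * g t i = a i * b i +
      ∫ s in (0 : ℝ)..t, (φ s i * g s i + f s i * γ s i) := by
    intro i
    have h := mul_eq_add_integral_of_primitives (a := a i) (b := b i) (hint φ i (hφi t ht))
      (hint γ i (hγi t ht))
    rw [hf t ht, hg t ht, PiLp.add_apply, PiLp.add_apply, hcoord φ t i (hφi t ht),
      hcoord γ t i (hγi t ht), h]
    congr 1
    refine intervalIntegral.integral_congr fun s hs => ?_
    simp only [hf s (hsub s hs), hg s (hsub s hs), PiLp.add_apply,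
      hcoord φ s i (hφi s (hsub s hs)), hcoord γ s i (hγi s (hsub s hs))]
  have hii : ∀ i ∈ (Finset.univ : Finset (Fin d)),
      IntervalIntegrable (fun s => φ s i * g s i + f s i * γ s i) volume 0 t := by
    intro i _
    have hgc : ContinuousOn (fun s => g s i) (uIcc 0 t) := by
      refine (hprim (b i) _ (hint γ i (hγi t ht))).congr fun s hs => ?_
      simp only [hg s (hsub s hs), PiLp.add_apply, hcoord γ s i (hγi s (hsub s hs))]
    have hfc : ContinuousOn (fun s => f s i) (uIcc 0 t) := by
      refine (hprim (a i) _ (hint φ i (hφi t ht))).congr fun s hs => ?_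
      simp only [hf s (hsub s hs), PiLp.add_apply, hcoord φ s i (hφi s (hsub s hs))]
    exact ((hint φ i (hφi t ht)).mul_continuousOn hgc).add
      ((hint γ i (hγi t ht)).continuousOn_mul hfc)
  have hinner : ∀ v w : Euc d, inner ℝ v w = ∑ i, v i * w i := fun v w => by
    simp [PiLp.inner_apply, mul_comm]
  simp only [hinner, ← Finset.sum_add_distrib]
  rw [intervalIntegral.integral_finsetSum hii, ← Finset.sum_add_distrib]
  exact Finset.sum_congr rfl fun i _ => key i

end ProductRule

/-! ### Continuous controls -/

section ToCtl

variable {T : ℝ} (hT : 0 ≤ T)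

lemma memLp_extend {F : Type*} [NormedAddCommGroup F] (f : C(Icc (0 : ℝ) T, F)) :
    MemLp (fun s => f (projIcc 0 T hT s)) 2 (volume.restrict (Icc (0 : ℝ) T)) :=
  MemLp.of_bound (continuous_extend hT f).aestronglyMeasurable ‖f‖
    (Eventually.of_forall fun _ => f.norm_coe_le_norm _)

/-- A continuous path regarded as a square integrable control. -/
def toCtl (F : Type*) [NormedAddCommGroup F] [NormedSpace ℝ F] :
    C(Icc (0 : ℝ) T, F) →L[ℝ] Ctl T F :=
  LinearMap.mkContinuous
    { toFun := fun f => (memLp_extend hT f).toLp _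
      map_add' := fun f g => by
        rw [← MemLp.toLp_add]; rfl
      map_smul' := fun c f => by
        rw [← MemLp.toLp_const_smul]; rfl }
    (√T) (by
      intro f
      refine (pow_le_pow_iff_left₀ (norm_nonneg _) (by positivity) two_ne_zero).mp ?_
      rw [← Ctl.integral_norm_sq, mul_pow, Real.sq_sqrt hT]
      have h1 : ∫ s in Icc (0 : ℝ) T, ‖(memLp_extend hT f).toLp _ s‖ ^ 2 =
          ∫ s in Icc (0 : ℝ) T, ‖f (projIcc 0 T hT s)‖ ^ 2 := by
        refine integral_congr_ae ?_
        filter_upwards [(memLp_extend hT f).coeFn_toLp] with s hs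
        rw [hs]
      refine h1.trans_le ?_
      have h2 : ∫ s in Icc (0 : ℝ) T, ‖f (projIcc 0 T hT s)‖ ^ 2 ≤
          ∫ _ in Icc (0 : ℝ) T, ‖f‖ ^ 2 := by
        refine integral_mono_of_nonneg (Eventually.of_forall fun s => by positivity)
          (integrable_const _) (Eventually.of_forall fun s => ?_)
        exact pow_le_pow_left₀ (norm_nonneg _) (f.norm_coe_le_norm _) 2
      refine h2.trans_eq ?_
      simp [hT])

lemma coeFn_toCtl {F : Type*} [NormedAddCommGroup F] [NormedSpace ℝ F] (f : C(Icc (0 : ℝ) T, F)) :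
    toCtl hT F f =ᵐ[volume.restrict (Icc (0 : ℝ) T)] fun s => f (projIcc 0 T hT s) :=
  (memLp_extend hT f).coeFn_toLp

lemma inner_toCtl {d : ℕ} (f : C(Icc (0 : ℝ) T, Euc d)) (k : Ctl T (Euc d)) :
    inner ℝ (toCtl hT (Euc d) f) k = ∫ s in (0 : ℝ)..T, inner ℝ (f (projIcc 0 T hT s)) (k s) := by
  rw [L2.inner_def, intervalIntegral.integral_of_le hT, ← integral_Icc_eq_integral_Ioc]
  refine integral_congr_ae ?_
  filter_upwards [coeFn_toCtl hT f] with s hs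
  rw [hs]

end ToCtl

/-! ### Adjoint equations and Hamiltonian lifts -/

section Lift

variable {d : ℕ} {W : Type} [NormedAddCommGroup W] [NormedSpace ℝ W]

/-- The real-linear map `A ↦ A^*` on operators of `ℝ^d`. -/
def adjointCLM (d : ℕ) : (Euc d →L[ℝ] Euc d) →L[ℝ] (Euc d →L[ℝ] Euc d) :=
  LinearMap.mkContinuous
    { toFun := fun A => ContinuousLinearMap.adjoint A
      map_add' := fun A B => map_add _ A B
      map_smul' := fun c A => by simp }
    1 (fun A => by simp)

/-- The coefficient of the adjoint equation: `(p, w) ↦ -(D(V(·)w)(x))^* p`. -/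
def adjCoeff (V : Euc d → W →L[ℝ] Euc d) (x : Euc d) : Euc d →L[ℝ] W →L[ℝ] Euc d :=
  -(adjointCLM d ∘L (fderiv ℝ V x).flip).flip

lemma adjCoeff_apply (V : Euc d → W →L[ℝ] Euc d) (x p : Euc d) (w : W) :
    adjCoeff V x p w = -(ContinuousLinearMap.adjoint ((fderiv ℝ V x).flip w) p) := rfl

lemma inner_adjCoeff (V : Euc d → W →L[ℝ] Euc d) (x p ξ : Euc d) (w : W) :
    inner ℝ (adjCoeff V x p w) ξ = -inner ℝ p (fderiv ℝ V x ξ w) := by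
  rw [adjCoeff_apply, inner_neg_left, ContinuousLinearMap.adjoint_inner_left]
  rfl

lemma contDiff_flip {X G₁ G₂ G₃ : Type*} [NormedAddCommGroup X] [NormedSpace ℝ X]
    [NormedAddCommGroup G₁] [NormedSpace ℝ G₁] [NormedAddCommGroup G₂] [NormedSpace ℝ G₂]
    [NormedAddCommGroup G₃] [NormedSpace ℝ G₃] {f : X → G₁ →L[ℝ] G₂ →L[ℝ] G₃}
    (hf : ContDiff ℝ ∞ f) : ContDiff ℝ ∞ fun x => (f x).flip := by
  have h : ContDiff ℝ ∞ fun A : G₁ →L[ℝ] G₂ →L[ℝ] G₃ => A.flip :=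
    IsBoundedLinearMap.contDiff
      ⟨⟨fun A B => by ext; simp, fun c A => by ext; simp⟩, 1, one_pos, fun A => by simp⟩
  exact h.comp hf

lemma contDiff_adjCoeff {V : Euc d → W →L[ℝ] Euc d} (hV : ContDiff ℝ ∞ V) :
    ContDiff ℝ ∞ (adjCoeff V) := by
  have hd : ContDiff ℝ ∞ (fderiv ℝ V) := hV.fderiv_right (by simp)
  have h1 : ContDiff ℝ ∞ fun x => (fderiv ℝ V x).flip := contDiff_flip hd
  have h2 : ContDiff ℝ ∞ fun x => adjointCLM d ∘L (fderiv ℝ V x).flip :=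
    contDiff_const.clm_comp h1
  exact (contDiff_flip h2).neg

/-- The Hamiltonian lift of the fields `V(·)w`: the Hamiltonian vector field of
`(x, p) ↦ ⟨p, V(x)w⟩` on `ℝ^d × ℝ^d`. -/
def lift (V : Euc d → W →L[ℝ] Euc d) (z : Euc d × Euc d) : W →L[ℝ] Euc d × Euc d :=
  (V z.1).prod (adjCoeff V z.1 z.2)

lemma lift_apply (V : Euc d → W →L[ℝ] Euc d) (z : Euc d × Euc d) (w : W) :
    lift V z w = (V z.1 w, adjCoeff V z.1 z.2 w) := rfl

lemma contDiff_lift {V : Euc d → W →L[ℝ] Euc d} (hV : ContDiff ℝ ∞ V) :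
    ContDiff ℝ ∞ (lift V) := by
  have h1 : ContDiff ℝ ∞ fun z : Euc d × Euc d => V z.1 := hV.comp contDiff_fst
  have h2 : ContDiff ℝ ∞ fun z : Euc d × Euc d => adjCoeff V z.1 z.2 :=
    ((contDiff_adjCoeff hV).comp contDiff_fst).clm_apply contDiff_snd
  exact (ContinuousLinearMap.prodₗᵢ (E := W) (F := Euc d) (G := Euc d) ℝ).contDiff.comp (h1.prodMk h2)

lemma fst_fderiv_lift {V : Euc d → W →L[ℝ] Euc d} (hV : ContDiff ℝ ∞ V) (z ζ : Euc d × Euc d)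
    (w : W) : (fderiv ℝ (lift V) z ζ w).1 = fderiv ℝ V z.1 ζ.1 w := by
  have hd : HasFDerivAt (lift V) (fderiv ℝ (lift V) z) z :=
    ((contDiff_lift hV).differentiable (by simp) z).hasFDerivAt
  have h1 : HasFDerivAt (fun z : Euc d × Euc d => (lift V z w).1)
      ((ContinuousLinearMap.fst ℝ (Euc d) (Euc d)) ∘L
        (ContinuousLinearMap.apply ℝ (Euc d × Euc d) w) ∘L (fderiv ℝ (lift V) z)) z :=
    ((ContinuousLinearMap.fst ℝ (Euc d) (Euc d)) ∘L
      (ContinuousLinearMap.apply ℝ (Euc d × Euc d) w)).hasFDerivAt.comp z hd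
  have h2 : HasFDerivAt (fun z : Euc d × Euc d => V z.1 w)
      ((ContinuousLinearMap.apply ℝ (Euc d) w) ∘L (fderiv ℝ V z.1) ∘L
        (ContinuousLinearMap.fst ℝ (Euc d) (Euc d))) z :=
    (ContinuousLinearMap.apply ℝ (Euc d) w).hasFDerivAt.comp z
      ((hV.differentiable (by simp) z.1).hasFDerivAt.comp z hasFDerivAt_fst)
  exact congrArg (fun A => A ζ) (h1.unique h2)

lemma fderiv_lift_inr {V : Euc d → W →L[ℝ] Euc d} (hV : ContDiff ℝ ∞ V) (z : Euc d × Euc d)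
    (r : Euc d) (w : W) : fderiv ℝ (lift V) z (0, r) w = (0, adjCoeff V z.1 r w) := by
  have hd : HasFDerivAt (lift V) (fderiv ℝ (lift V) z) z :=
    ((contDiff_lift hV).differentiable (by simp) z).hasFDerivAt
  have h1 : HasFDerivAt (fun p : Euc d => lift V (z.1, p) w)
      ((ContinuousLinearMap.apply ℝ (Euc d × Euc d) w) ∘L (fderiv ℝ (lift V) z) ∘L
        (ContinuousLinearMap.inr ℝ (Euc d) (Euc d))) z.2 :=
    (ContinuousLinearMap.apply ℝ (Euc d × Euc d) w).hasFDerivAt.comp z.2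
      (HasFDerivAt.comp z.2 (f := fun p : Euc d => (z.1, p)) hd (hasFDerivAt_prodMk_right z.1 z.2))
  have h2 : HasFDerivAt (fun p : Euc d => lift V (z.1, p) w)
      ((0 : Euc d →L[ℝ] Euc d).prod ((adjCoeff V z.1).flip w)) z.2 :=
    (hasFDerivAt_const (V z.1 w) z.2).prodMk ((adjCoeff V z.1).flip w).hasFDerivAt
  exact congrArg (fun A => A r) (h1.unique h2)

variable {T : ℝ} {hT : 0 ≤ T}

/-- The adjoint equation is dual to the linearised equation: the pairing of `p` with a variation `ξ`
grows only through the variation `k` of the control. -/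
lemma inner_adjoint_linearised {V : Euc d → W →L[ℝ] Euc d} (hV : ContDiff ℝ ∞ V)
    {u k : Ctl T W} {x p ξ : C(Icc (0 : ℝ) T, Euc d)} {p₀ η : Euc d}
    (hp : ∀ t : Icc (0 : ℝ) T, p t = p₀ + ∫ s in (0 : ℝ)..t,
      adjCoeff V (x (projIcc 0 T hT s)) (p (projIcc 0 T hT s)) (u s))
    (hξ : ∀ t : Icc (0 : ℝ) T, ξ t = η + ∫ s in (0 : ℝ)..t,
      (fderiv ℝ V (x (projIcc 0 T hT s)) (ξ (projIcc 0 T hT s)) (u s) +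
        V (x (projIcc 0 T hT s)) (k s))) (t : Icc (0 : ℝ) T) :
    inner ℝ (p t) (ξ t) = inner ℝ p₀ η + ∫ s in (0 : ℝ)..t,
      inner ℝ (p (projIcc 0 T hT s)) (V (x (projIcc 0 T hT s)) (k s)) := by
  have hx := continuous_extend hT x
  have hpc := continuous_extend hT p
  have hξc := continuous_extend hT ξ
  have h1 : IntegrableOn (fun s => adjCoeff V (x (projIcc 0 T hT s)) (p (projIcc 0 T hT s)) (u s))
      (Icc 0 T) volume :=
    Ctl.integrable_apply (((contDiff_adjCoeff hV).continuous.comp hx).clm_apply hpc) u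
  have h2 : IntegrableOn (fun s => fderiv ℝ V (x (projIcc 0 T hT s)) (ξ (projIcc 0 T hT s)) (u s) +
      V (x (projIcc 0 T hT s)) (k s)) (Icc 0 T) volume :=
    (Ctl.integrable_apply (((hV.continuous_fderiv (by simp)).comp hx).clm_apply hξc) u).add
      (Ctl.integrable_apply (hV.continuous.comp hx) k)
  have h := inner_eq_add_integral_of_primitives (f := fun s => p (projIcc 0 T hT s))
    (g := fun s => ξ (projIcc 0 T hT s)) h1 h2
    (fun s hs => by simpa [projIcc_of_mem hT hs] using hp ⟨s, hs⟩)
    (fun s hs => by simpa [projIcc_of_mem hT hs] using hξ ⟨s, hs⟩) t.2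
  simp only [projIcc_val] at h
  rw [h]
  congr 1
  refine intervalIntegral.integral_congr fun s _ => ?_
  simp only [inner_adjCoeff, inner_add_right]
  ring

lemma exists_adjoint_solution {V : Euc d → W →L[ℝ] Euc d} (hV : ContDiff ℝ ∞ V)
    (u : Ctl T W) (x : C(Icc (0 : ℝ) T, Euc d)) (p₀ : Euc d) :
    ∃ p : C(Icc (0 : ℝ) T, Euc d), ∀ t : Icc (0 : ℝ) T, p t = p₀ + ∫ s in (0 : ℝ)..t,
      adjCoeff V (x (projIcc 0 T hT s)) (p (projIcc 0 T hT s)) (u s) := by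
  obtain ⟨p, hp⟩ := exists_eq_linVolterra hT
    ((⟨adjCoeff V, (contDiff_adjCoeff hV).continuous⟩ :
      C(Euc d, Euc d →L[ℝ] W →L[ℝ] Euc d)).comp x) u (ContinuousMap.const _ p₀)
  exact ⟨p, fun t => congrArg (fun f => f t) hp⟩

/-- A solution of the lifted system is a solution of the base system with a solution of the adjoint
equation along it. -/
lemma isSol_lift_iff {V : Euc d → W →L[ℝ] Euc d} (hV : ContDiff ℝ ∞ V) {u : Ctl T W}
    {y p₀ : Euc d} {x p : C(Icc (0 : ℝ) T, Euc d)} :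
    IsSol hT (lift V) u (y, p₀) (x.prodMk p) ↔ IsSol hT V u y x ∧
      ∀ t : Icc (0 : ℝ) T, p t = p₀ + ∫ s in (0 : ℝ)..t,
        adjCoeff V (x (projIcc 0 T hT s)) (p (projIcc 0 T hT s)) (u s) := by
  have hx := continuous_extend hT x
  have hpc := continuous_extend hT p
  unfold IsSol
  rw [← forall_and]
  refine forall_congr' fun t => ?_
  have h1 := Ctl.intervalIntegrable_of_integrable
    (Ctl.integrable_apply (((contDiff_adjCoeff hV).continuous.comp hx).clm_apply hpc) u) t.2
  have h2 := Ctl.intervalIntegrable_of_integrable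
    (Ctl.integrable_apply (hV.continuous.comp hx) u) t.2
  have h3 : ∫ s in (0 : ℝ)..t, lift V ((x.prodMk p) (projIcc 0 T hT s)) (u s) =
      (∫ s in (0 : ℝ)..t, V (x (projIcc 0 T hT s)) (u s), ∫ s in (0 : ℝ)..t,
        adjCoeff V (x (projIcc 0 T hT s)) (p (projIcc 0 T hT s)) (u s)) := by
    have h4 := Ctl.intervalIntegrable_of_integrable
      (Ctl.integrable_apply ((contDiff_lift hV).continuous.comp
        (continuous_extend hT (x.prodMk p))) u) t.2
    exact Prod.ext ((ContinuousLinearMap.fst ℝ (Euc d) (Euc d)).intervalIntegral_comp_comm h4).symm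
      ((ContinuousLinearMap.snd ℝ (Euc d) (Euc d)).intervalIntegral_comp_comm h4).symm
  rw [h3, Prod.ext_iff]
  rfl

end Lift

/-! ### Linearised and adjoint equations along a path -/

section Linearised

variable {T : ℝ} (hT : 0 ≤ T) {E W : Type} [NormedAddCommGroup E] [NormedSpace ℝ E]
  [NormedAddCommGroup W] [NormedSpace ℝ W]

/-- `ξ` solves the linearisation along `x` of the equation with control `u`, for the variation `k`
of the control and the variation `η` of the initial value. -/
def IsLin (V : E → W →L[ℝ] E) (u : Ctl T W) (x : C(Icc (0 : ℝ) T, E)) (k : Ctl T W) (η : E)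
    (ξ : C(Icc (0 : ℝ) T, E)) : Prop :=
  ∀ t : Icc (0 : ℝ) T, ξ t = η + ∫ s in (0 : ℝ)..t,
    (fderiv ℝ V (x (projIcc 0 T hT s)) (ξ (projIcc 0 T hT s)) (u s) +
      V (x (projIcc 0 T hT s)) (k s))

variable {hT} {V : E → W →L[ℝ] E} {u : Ctl T W} {x : C(Icc (0 : ℝ) T, E)}

lemma isLin_iff_eq (hV : ContDiff ℝ ∞ V) {k : Ctl T W} {η : E} {ξ : C(Icc (0 : ℝ) T, E)} :
    IsLin hT V u x k η ξ ↔
      ξ = (ContinuousLinearMap.const (R := ℝ) (M := E) (Icc (0 : ℝ) T) η +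
        volterra hT E W ((⟨V, hV.continuous⟩ : C(E, W →L[ℝ] E)).comp x) k) +
        linVolterra hT (linCoeff hV x) u ξ :=
  (isLin_iff (linCoeff hV x) ((⟨V, hV.continuous⟩ : C(E, W →L[ℝ] E)).comp x) u k η ξ).symm

lemma IsLin.unique (hV : ContDiff ℝ ∞ V) {k : Ctl T W} {η : E} {ξ ξ' : C(Icc (0 : ℝ) T, E)}
    (h : IsLin hT V u x k η ξ) (h' : IsLin hT V u x k η ξ') : ξ = ξ' :=
  eq_of_linVolterra hT ((isLin_iff_eq hV).mp h) ((isLin_iff_eq hV).mp h')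

lemma IsLin.sub (hV : ContDiff ℝ ∞ V) {k k' : Ctl T W} {η η' : E} {ξ ξ' : C(Icc (0 : ℝ) T, E)}
    (h : IsLin hT V u x k η ξ) (h' : IsLin hT V u x k' η' ξ') :
    IsLin hT V u x (k - k') (η - η') (ξ - ξ') := by
  rw [isLin_iff_eq hV] at *
  rw [map_sub, map_sub, map_sub]
  conv_lhs => rw [h, h']
  abel

lemma isLin_zero (hV : ContDiff ℝ ∞ V) : IsLin hT V u x 0 0 0 := by
  rw [isLin_iff_eq hV]
  simp

lemma IsLin.apply_zero {k : Ctl T W} {η : E} {ξ : C(Icc (0 : ℝ) T, E)}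
    (h : IsLin hT V u x k η ξ) : ξ ⟨0, le_rfl, hT⟩ = η := by
  simpa using h ⟨0, le_rfl, hT⟩

end Linearised

section Adjoint

variable {T : ℝ} (hT : 0 ≤ T) {d : ℕ} {W : Type} [NormedAddCommGroup W] [NormedSpace ℝ W]

/-- `p` solves the adjoint equation `p_t = p₀ - ∫₀ᵗ (D(V(·)u_s)(x_s))^* p_s ds` along `x`. -/
def IsAdj (V : Euc d → W →L[ℝ] Euc d) (u : Ctl T W) (x : C(Icc (0 : ℝ) T, Euc d)) (p₀ : Euc d)
    (p : C(Icc (0 : ℝ) T, Euc d)) : Prop :=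
  ∀ t : Icc (0 : ℝ) T, p t = p₀ + ∫ s in (0 : ℝ)..t,
    adjCoeff V (x (projIcc 0 T hT s)) (p (projIcc 0 T hT s)) (u s)

variable {hT} {V : Euc d → W →L[ℝ] Euc d} {u : Ctl T W} {x : C(Icc (0 : ℝ) T, Euc d)}

/-- If `r` solves the adjoint equation, the vertical variation `(0, r)` of a lifted path solves the
linearised lifted equation: the lift is linear in the covector. -/
lemma IsAdj.isLin_lift (hV : ContDiff ℝ ∞ V) {p r : C(Icc (0 : ℝ) T, Euc d)} {r₀ : Euc d}
    (h : IsAdj hT V u x r₀ r) :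
    IsLin hT (lift V) u (x.prodMk p) 0 (0, r₀) ((0 : C(Icc (0 : ℝ) T, Euc d)).prodMk r) := by
  intro t
  have hx := continuous_extend hT x
  have hr := continuous_extend hT r
  have h1 : IntervalIntegrable (fun s => adjCoeff V (x (projIcc 0 T hT s))
      (r (projIcc 0 T hT s)) (u s)) volume 0 t := Ctl.intervalIntegrable_of_integrable
    (Ctl.integrable_apply (((contDiff_adjCoeff hV).continuous.comp hx).clm_apply hr) u) t.2
  have h2 : ∫ s in (0 : ℝ)..t, (fderiv ℝ (lift V) ((x.prodMk p) (projIcc 0 T hT s))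
      (((0 : C(Icc (0 : ℝ) T, Euc d)).prodMk r) (projIcc 0 T hT s)) (u s) +
        lift V ((x.prodMk p) (projIcc 0 T hT s)) ((0 : Ctl T W) s)) =
      ∫ s in (0 : ℝ)..t, (ContinuousLinearMap.inr ℝ (Euc d) (Euc d))
        (adjCoeff V (x (projIcc 0 T hT s)) (r (projIcc 0 T hT s)) (u s)) := by
    refine intervalIntegral.integral_congr_ae_restrict ?_
    filter_upwards [Ctl.ae_Ioc (Lp.coeFn_zero W 2 (volume.restrict (Icc (0 : ℝ) T))) t.2] with s hs
    rw [hs, Pi.zero_apply, map_zero, add_zero]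
    exact fderiv_lift_inr hV _ _ _
  rw [h2, ContinuousLinearMap.intervalIntegral_comp_comm _ h1, Prod.ext_iff]
  exact ⟨by simp, by simpa using h t⟩

lemma IsLin.fst_lift (hV : ContDiff ℝ ∞ V) {z : C(Icc (0 : ℝ) T, Euc d × Euc d)} {k : Ctl T W}
    {ζ : Euc d × Euc d} {Ξ : C(Icc (0 : ℝ) T, Euc d × Euc d)}
    (h : IsLin hT (lift V) u z k ζ Ξ) :
    IsLin hT V u ((⟨Prod.fst, continuous_fst⟩ : C(Euc d × Euc d, Euc d)).comp z) k ζ.1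
      ((⟨Prod.fst, continuous_fst⟩ : C(Euc d × Euc d, Euc d)).comp Ξ) := by
  intro t
  have hz := continuous_extend hT z
  have hΞ := continuous_extend hT Ξ
  have hl := contDiff_lift hV
  have h1 := Ctl.intervalIntegrable_of_integrable
    ((Ctl.integrable_apply (((hl.continuous_fderiv (by simp)).comp hz).clm_apply hΞ) u).add
      (Ctl.integrable_apply (hl.continuous.comp hz) k)) t.2
  have h2 := congrArg Prod.fst (h t)
  have h3 := (ContinuousLinearMap.fst ℝ (Euc d) (Euc d)).intervalIntegral_comp_comm h1
  refine h2.trans ?_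
  rw [Prod.fst_add]
  congr 1
  refine h3.symm.trans (intervalIntegral.integral_congr fun s _ => ?_)
  exact congrArg (· + V (z (projIcc 0 T hT s)).1 (k s)) (fst_fderiv_lift hV _ _ _)

end Adjoint

/-! ### The control system -/

section ControlSystem

variable {d m : ℕ}

/-- The fields of the control system as a single operator valued map,
`V(x)(r, w) = r σ₀(x) + ∑ i, w_i σ_i(x)`; the drift is driven by the constant control `r = 1`. -/
def ctrlField (σ₀ : Euc d → Euc d) (σ : Fin m → Euc d → Euc d) (x : Euc d) :
    ℝ × Euc m →L[ℝ] Euc d :=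
  (ContinuousLinearMap.fst ℝ ℝ (Euc m)).smulRight (σ₀ x) +
    ∑ i, ((EuclideanSpace.proj (𝕜 := ℝ) i) ∘L
      (ContinuousLinearMap.snd ℝ ℝ (Euc m))).smulRight (σ i x)

variable {σ₀ : Euc d → Euc d} {σ : Fin m → Euc d → Euc d}

lemma ctrlField_apply (x : Euc d) (w : ℝ × Euc m) :
    ctrlField σ₀ σ x w = w.1 • σ₀ x + ∑ i, w.2 i • σ i x := by
  simp [ctrlField]

lemma contDiff_ctrlField (hσ₀ : ContDiff ℝ ∞ σ₀) (hσ : ∀ i, ContDiff ℝ ∞ (σ i)) :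
    ContDiff ℝ ∞ (ctrlField σ₀ σ) := by
  have h : ∀ (c : ℝ × Euc m →L[ℝ] ℝ) (f : Euc d → Euc d), ContDiff ℝ ∞ f →
      ContDiff ℝ ∞ fun x => c.smulRight (f x) := fun c f hf =>
    (ContinuousLinearMap.smulRightL ℝ (ℝ × Euc m) (Euc d) c).contDiff.comp hf
  exact (h _ _ hσ₀).add (ContDiff.sum fun i _ => h _ _ (hσ i))

lemma SmoothBounded.exists_lipschitz {V : Euc d → Euc d} (hV : SmoothBounded V) :
    ∃ L : ℝ, ∀ a b, ‖V a - V b‖ ≤ L * ‖a - b‖ := by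
  obtain ⟨C, hC⟩ := hV.2 1
  refine ⟨C, fun a b => ?_⟩
  refine convex_univ.norm_image_sub_le_of_norm_fderiv_le (𝕜 := ℝ) (f := V)
    (fun x _ => hV.1.differentiable (by simp) x) (fun x _ => ?_) (mem_univ b) (mem_univ a)
  simpa using ((norm_iteratedFDeriv_one (𝕜 := ℝ) (f := V) (x := x)) ▸ hC x)

lemma exists_lipschitz_ctrlField (hσ₀ : SmoothBounded σ₀) (hσ : ∀ i, SmoothBounded (σ i)) :
    ∃ L : ℝ, ∀ a b, ‖ctrlField σ₀ σ a - ctrlField σ₀ σ b‖ ≤ L * ‖a - b‖ := by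
  obtain ⟨L₀, hL₀⟩ := hσ₀.exists_lipschitz
  choose L hL using fun i => (hσ i).exists_lipschitz
  refine ⟨L₀ + ∑ i, L i, fun a b => ?_⟩
  have hnn : 0 ≤ (L₀ + ∑ i, L i) * ‖a - b‖ := by
    rw [add_mul, Finset.sum_mul]
    exact add_nonneg ((norm_nonneg _).trans (hL₀ a b))
      (Finset.sum_nonneg fun i _ => (norm_nonneg _).trans (hL i a b))
  refine ContinuousLinearMap.opNorm_le_bound _ hnn fun w => ?_
  have h1 : (ctrlField σ₀ σ a - ctrlField σ₀ σ b) w =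
      w.1 • (σ₀ a - σ₀ b) + ∑ i, w.2 i • (σ i a - σ i b) := by
    rw [_root_.sub_apply, ctrlField_apply, ctrlField_apply]
    simp only [smul_sub, Finset.sum_sub_distrib]
    abel
  rw [h1, add_mul, add_mul, Finset.sum_mul, Finset.sum_mul]
  refine (norm_add_le _ _).trans (add_le_add ?_ ((norm_sum_le _ _).trans
    (Finset.sum_le_sum fun i _ => ?_)))
  · rw [norm_smul, mul_comm]
    exact mul_le_mul (hL₀ a b) (norm_fst_le w) (norm_nonneg _) ((norm_nonneg _).trans (hL₀ a b))
  · rw [norm_smul, mul_comm]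
    exact mul_le_mul (hL i a b) ((PiLp.norm_apply_le w.2 i).trans (norm_snd_le w)) (norm_nonneg _)
      ((norm_nonneg _).trans (hL i a b))

/-- Existence on all of `[0,T]` for every control. -/
def GlobalSol {T : ℝ} (hT : 0 ≤ T) {E W : Type} [NormedAddCommGroup E] [NormedSpace ℝ E]
    [NormedAddCommGroup W] [NormedSpace ℝ W] (V : E → W →L[ℝ] E) : Prop :=
  ∀ (u : Ctl T W) (y : E), ∃ x, IsSol hT V u y x

variable {T : ℝ} {hT : 0 ≤ T}

lemma globalSol_ctrlField (hσ₀ : SmoothBounded σ₀) (hσ : ∀ i, SmoothBounded (σ i)) :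
    GlobalSol hT (ctrlField σ₀ σ) := by
  obtain ⟨L, hL⟩ := exists_lipschitz_ctrlField hσ₀ hσ
  exact exists_isSol_of_lipschitz (contDiff_ctrlField hσ₀.1 fun i => (hσ i).1).continuous hL

lemma GlobalSol.lift {W : Type} [NormedAddCommGroup W] [NormedSpace ℝ W]
    {V : Euc d → W →L[ℝ] Euc d} (hV : ContDiff ℝ ∞ V) (h : GlobalSol hT V) :
    GlobalSol hT (lift V) := by
  rintro u ⟨y, p₀⟩
  obtain ⟨x, hx⟩ := h u y
  obtain ⟨p, hp⟩ := exists_adjoint_solution (hT := hT) hV u x p₀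
  exact ⟨x.prodMk p, (isSol_lift_iff hV).mpr ⟨hx, hp⟩⟩

/-- The linear part `k ↦ (0, k)` of the extension of controls. -/
def augL (T : ℝ) (m : ℕ) : CameronMartin m T →L[ℝ] Ctl T (ℝ × Euc m) :=
  ContinuousLinearMap.compLpL 2 (volume.restrict (Icc (0 : ℝ) T))
    (ContinuousLinearMap.inr ℝ ℝ (Euc m))

lemma coeFn_augL (k : CameronMartin m T) :
    augL T m k =ᵐ[volume.restrict (Icc (0 : ℝ) T)] fun s => (0, k s) :=
  ContinuousLinearMap.coeFn_compLpL _ _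

/-- The extended control `(1, h)`. -/
def aug (h : CameronMartin m T) : Ctl T (ℝ × Euc m) :=
  (memLp_const ((1, 0) : ℝ × Euc m)).toLp _ + augL T m h

lemma coeFn_aug (h : CameronMartin m T) :
    aug h =ᵐ[volume.restrict (Icc (0 : ℝ) T)] fun s => (1, h s) := by
  filter_upwards [Lp.coeFn_add ((memLp_const ((1, 0) : ℝ × Euc m)).toLp _) (augL T m h),
    coeFn_augL h, (memLp_const (μ := volume.restrict (Icc (0 : ℝ) T)) (p := 2)
      ((1, 0) : ℝ × Euc m)).coeFn_toLp] with s h1 h2 h3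
  rw [aug, h1, Pi.add_apply, h2, h3]
  simp

/-- The solution of a control system with drift as a function of the control `h` and the initial
value `y`. -/
def ctrlSol (hT : 0 ≤ T) {E : Type} [NormedAddCommGroup E] [NormedSpace ℝ E]
    (V : E → ℝ × Euc m →L[ℝ] E) (h : CameronMartin m T) (y : E) : C(Icc (0 : ℝ) T, E) :=
  sol hT V (aug h) y

section Generic

variable {E : Type} [NormedAddCommGroup E] [NormedSpace ℝ E] {V : E → ℝ × Euc m →L[ℝ] E}

lemma GlobalSol.isSol_ctrlSol (hex : GlobalSol hT V) (h : CameronMartin m T) (y : E) :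
    IsSol hT V (aug h) y (ctrlSol hT V h y) := isSol_sol (hex _ _)

variable [CompleteSpace E]

lemma hasFDerivAt_ctrlSol (hV : ContDiff ℝ ∞ V) (hex : GlobalSol hT V) (q : CameronMartin m T × E) :
    HasFDerivAt (fun q : CameronMartin m T × E => ctrlSol hT V q.1 q.2)
      ((fderiv ℝ (fun q : Ctl T (ℝ × Euc m) × E => sol hT V q.1 q.2) (aug q.1, q.2)) ∘L
        ((augL T m).prodMap (ContinuousLinearMap.id ℝ E))) q := by
  have h1 := (((hex.isSol_ctrlSol q.1 q.2).eventually_and_contDiffAt hV).2.differentiableAt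
    (by simp)).hasFDerivAt
  have h2 : HasFDerivAt (fun q : CameronMartin m T × E => (aug q.1, q.2))
      ((augL T m).prodMap (ContinuousLinearMap.id ℝ E)) q :=
    (((augL T m).hasFDerivAt.comp q hasFDerivAt_fst).const_add _).prodMk hasFDerivAt_snd
  exact HasFDerivAt.comp q (g := fun q : Ctl T (ℝ × Euc m) × E => sol hT V q.1 q.2) h1 h2

lemma contDiff_ctrlSol (hV : ContDiff ℝ ∞ V) (hex : GlobalSol hT V) :
    ContDiff ℝ ∞ fun q : CameronMartin m T × E => ctrlSol hT V q.1 q.2 := by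
  rw [contDiff_iff_contDiffAt]
  intro q
  have h1 := ((hex.isSol_ctrlSol q.1 q.2).eventually_and_contDiffAt hV).2
  have h2 : ContDiff ℝ ∞ fun q : CameronMartin m T × E => (aug q.1, q.2) :=
    (contDiff_const.add ((augL T m).contDiff.comp contDiff_fst)).prodMk contDiff_snd
  exact ContDiffAt.comp q (g := fun q : Ctl T (ℝ × Euc m) × E => sol hT V q.1 q.2) h1 h2.contDiffAt

lemma isLin_fderiv_ctrlSol (hV : ContDiff ℝ ∞ V) (hex : GlobalSol hT V)
    (q dq : CameronMartin m T × E) :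
    IsLin hT V (aug q.1) (ctrlSol hT V q.1 q.2) (augL T m dq.1) dq.2
      (fderiv ℝ (fun q : CameronMartin m T × E => ctrlSol hT V q.1 q.2) q dq) := by
  rw [(hasFDerivAt_ctrlSol hV hex q).fderiv, isLin_iff_eq hV]
  exact (hex.isSol_ctrlSol q.1 q.2).fderiv_sol hV (augL T m dq.1) dq.2

end Generic

/-- `controlFlow`, defined through paths on the real line, is the solution of the control system with
drift in the space of paths on `[0,T]`. -/
lemma controlFlow_eq (hσ₀ : SmoothBounded σ₀) (hσ : ∀ i, SmoothBounded (σ i))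
    (h : CameronMartin m T) (y : Euc d) (t : Icc (0 : ℝ) T) :
    controlFlow σ₀ σ h t y = ctrlSol hT (ctrlField σ₀ σ) h y t := by
  have hV := contDiff_ctrlField hσ₀.1 fun i => (hσ i).1
  have hsol := (globalSol_ctrlField (hT := hT) hσ₀ hσ).isSol_ctrlSol h y
  have hint : ∀ (x : ℝ → Euc d) (x' : C(Icc (0 : ℝ) T, Euc d)),
      (∀ s (hs : s ∈ Icc 0 T), x s = x' ⟨s, hs⟩) → ∀ t : Icc (0 : ℝ) T,
      ∫ s in (0 : ℝ)..t, (σ₀ (x s) + ∑ i, (h s) i • σ i (x s)) =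
        ∫ s in (0 : ℝ)..t, ctrlField σ₀ σ (x' (projIcc 0 T hT s)) (aug h s) := by
    intro x x' hx t
    refine intervalIntegral.integral_congr_ae_restrict ?_
    filter_upwards [Ctl.ae_Ioc (coeFn_aug h) t.2, ae_restrict_mem measurableSet_uIoc] with s hs hm
    rw [uIoc_of_le t.2.1] at hm
    have hm' : s ∈ Icc 0 T := ⟨hm.1.le, hm.2.trans t.2.2⟩
    rw [hs, ctrlField_apply, projIcc_of_mem hT hm', hx s hm']
    simp
  have hpath : ∃ x, IsControlledPath σ₀ σ h y x := by
    refine ⟨fun s => ctrlSol hT (ctrlField σ₀ σ) h y (projIcc 0 T hT s),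
      (continuous_extend hT _).continuousOn, fun t ht => ?_⟩
    simp only [projIcc_of_mem hT ht]
    rw [hsol ⟨t, ht⟩, hint (fun s => ctrlSol hT (ctrlField σ₀ σ) h y (projIcc 0 T hT s)) _
      (fun s hs => by rw [projIcc_of_mem hT hs]) ⟨t, ht⟩]
  have hspec := Classical.epsilon_spec hpath
  set x := Classical.epsilon (IsControlledPath σ₀ σ h y) with hx
  let x' : C(Icc (0 : ℝ) T, Euc d) := ⟨fun s => x s,
    continuousOn_iff_continuous_domRestrict.mp hspec.1⟩
  have hx' : IsSol hT (ctrlField σ₀ σ) (aug h) y x' := by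
    intro t
    rw [← hint x x' (fun s hs => rfl) t]
    exact hspec.2 t t.2
  have := hx'.unique (hV.of_le (by exact_mod_cast le_top)) hsol
  exact congrArg (fun f => f t) this

end ControlSystem

/-! ### The duality between variations and momenta -/

section Duality

variable {d m : ℕ}

/-- The momenta `H_i(x,p) = ⟨p, σ_i(x)⟩`. -/
def momentum (σ : Fin m → Euc d → Euc d) (z : Euc d × Euc d) : Euc m :=
  WithLp.toLp 2 fun i => inner ℝ z.2 (σ i z.1)

variable {σ₀ : Euc d → Euc d} {σ : Fin m → Euc d → Euc d}

@[simp]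
lemma momentum_apply (z : Euc d × Euc d) (i : Fin m) :
    momentum σ z i = inner ℝ z.2 (σ i z.1) := rfl

lemma contDiff_momentum (hσ : ∀ i, ContDiff ℝ ∞ (σ i)) : ContDiff ℝ ∞ (momentum σ) := by
  rw [contDiff_piLp]
  exact fun i => contDiff_snd.inner ℝ ((hσ i).comp contDiff_fst)

lemma inner_ctrlField_inr (x p : Euc d) (w : Euc m) :
    inner ℝ p (ctrlField σ₀ σ x (0, w)) = inner ℝ (momentum σ (x, p)) w := by
  rw [ctrlField_apply]
  simp [PiLp.inner_apply (x := momentum σ (x, p)), inner_sum, inner_smul_right]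

/-- The momenta along a path. -/
def momentumPath {T : ℝ} (hσ : ∀ i, ContDiff ℝ ∞ (σ i)) (z : C(Icc (0 : ℝ) T, Euc d × Euc d)) :
    C(Icc (0 : ℝ) T, Euc m) :=
  (⟨momentum σ, (contDiff_momentum hσ).continuous⟩ : C(Euc d × Euc d, Euc m)).comp z

lemma inner_toCtl_momentumPath {T : ℝ} {hT : 0 ≤ T} (hσ : ∀ i, ContDiff ℝ ∞ (σ i))
    (x p : C(Icc (0 : ℝ) T, Euc d)) (k : CameronMartin m T) :
    ∫ s in (0 : ℝ)..T, inner ℝ (p (projIcc 0 T hT s))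
        (ctrlField σ₀ σ (x (projIcc 0 T hT s)) (augL T m k s)) =
      inner ℝ (toCtl hT (Euc m) (momentumPath hσ (x.prodMk p))) k := by
  rw [inner_toCtl]
  refine intervalIntegral.integral_congr_ae_restrict ?_
  filter_upwards [Ctl.ae_Ioc (coeFn_augL k) ⟨hT, le_rfl⟩] with s hs
  rw [hs, inner_ctrlField_inr]
  rfl

end Duality

/-! ### The endpoint map and covector paths -/

section Endpoint

variable {d m : ℕ} {T : ℝ} (hT : 0 ≤ T) {σ₀ : Euc d → Euc d} {σ : Fin m → Euc d → Euc d}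

/-- The terminal time as a point of `[0,T]`. -/
def finalTime : Icc (0 : ℝ) T := ⟨T, hT, le_rfl⟩

variable (hσ₀ : SmoothBounded σ₀) (hσ : ∀ i, SmoothBounded (σ i)) (x₀ : Euc d)

include hσ₀ hσ

lemma contDiff_ctrlField' : ContDiff ℝ ∞ (ctrlField σ₀ σ) :=
  contDiff_ctrlField hσ₀.1 fun i => (hσ i).1

lemma endpoint_eq (h : CameronMartin m T) :
    endpoint σ₀ σ x₀ h = ctrlSol hT (ctrlField σ₀ σ) h x₀ (finalTime hT) :=
  controlFlow_eq hσ₀ hσ h x₀ (finalTime hT)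

lemma contDiff_ctrlSol_ctrlField : ContDiff ℝ ∞ fun q : CameronMartin m T × Euc d =>
    ctrlSol hT (ctrlField σ₀ σ) q.1 q.2 :=
  contDiff_ctrlSol (contDiff_ctrlField' hσ₀ hσ) (globalSol_ctrlField hσ₀ hσ)

lemma hasFDerivAt_ctrlSol_ctrlField (q : CameronMartin m T × Euc d) :
    HasFDerivAt (fun q : CameronMartin m T × Euc d => ctrlSol hT (ctrlField σ₀ σ) q.1 q.2)
      (fderiv ℝ (fun q : CameronMartin m T × Euc d => ctrlSol hT (ctrlField σ₀ σ) q.1 q.2) q) q :=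
  ((contDiff_ctrlSol_ctrlField hT hσ₀ hσ).differentiable (by simp) q).hasFDerivAt

include hT in
lemma contDiff_endpoint : ContDiff ℝ ∞ (endpoint (T := T) σ₀ σ x₀) := by
  have h1 : endpoint (T := T) σ₀ σ x₀ = fun h =>
      ContinuousMap.evalCLM ℝ (finalTime hT) (ctrlSol hT (ctrlField σ₀ σ) h x₀) :=
    funext fun h => endpoint_eq hT hσ₀ hσ x₀ h
  rw [h1]
  exact (ContinuousMap.evalCLM ℝ (finalTime hT)).contDiff.comp
    ((contDiff_ctrlSol_ctrlField hT hσ₀ hσ).comp (contDiff_id.prodMk contDiff_const))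

lemma hasFDerivAt_endpoint (h : CameronMartin m T) :
    HasFDerivAt (endpoint σ₀ σ x₀)
      (ContinuousMap.evalCLM ℝ (finalTime hT) ∘L
        (fderiv ℝ (fun q : CameronMartin m T × Euc d =>
          ctrlSol hT (ctrlField σ₀ σ) q.1 q.2) (h, x₀)) ∘L
        ContinuousLinearMap.inl ℝ (CameronMartin m T) (Euc d)) h := by
  have h1 : endpoint (T := T) σ₀ σ x₀ = fun h =>
      ContinuousMap.evalCLM ℝ (finalTime hT) (ctrlSol hT (ctrlField σ₀ σ) h x₀) :=
    funext fun h => endpoint_eq hT hσ₀ hσ x₀ h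
  rw [h1]
  exact (ContinuousMap.evalCLM ℝ (finalTime hT)).hasFDerivAt.comp h
    (HasFDerivAt.comp h (f := fun h => (h, x₀))
      (hasFDerivAt_ctrlSol_ctrlField hT hσ₀ hσ (h, x₀)) (hasFDerivAt_prodMk_left h x₀))

lemma fderiv_endpoint_apply (h k : CameronMartin m T) :
    fderiv ℝ (endpoint σ₀ σ x₀) h k =
      fderiv ℝ (fun q : CameronMartin m T × Euc d => ctrlSol hT (ctrlField σ₀ σ) q.1 q.2)
        (h, x₀) (k, 0) (finalTime hT) := by
  rw [(hasFDerivAt_endpoint hT hσ₀ hσ x₀ h).fderiv]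
  rfl

lemma fderiv_controlFlow (h : CameronMartin m T) :
    fderiv ℝ (controlFlow σ₀ σ h T) x₀ =
      ContinuousMap.evalCLM ℝ (finalTime hT) ∘L
        (fderiv ℝ (fun q : CameronMartin m T × Euc d =>
          ctrlSol hT (ctrlField σ₀ σ) q.1 q.2) (h, x₀)) ∘L
        ContinuousLinearMap.inr ℝ (CameronMartin m T) (Euc d) := by
  have h1 : controlFlow σ₀ σ h T = fun y =>
      ContinuousMap.evalCLM ℝ (finalTime hT) (ctrlSol hT (ctrlField σ₀ σ) h y) :=
    funext fun y => controlFlow_eq hσ₀ hσ h y (finalTime hT)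
  rw [h1]
  exact ((ContinuousMap.evalCLM ℝ (finalTime hT)).hasFDerivAt.comp x₀
    (HasFDerivAt.comp x₀ (f := fun y => (h, y))
      (hasFDerivAt_ctrlSol_ctrlField hT hσ₀ hσ (h, x₀)) (hasFDerivAt_prodMk_right h x₀))).fderiv

/-- The variation of the endpoint paired with the terminal value of an adjoint solution. -/
lemma inner_adjoint_fderiv_ctrlSol {h : CameronMartin m T} {p₀ : Euc d}
    {p : C(Icc (0 : ℝ) T, Euc d)}
    (hp : IsAdj hT (ctrlField σ₀ σ) (aug h) (ctrlSol hT (ctrlField σ₀ σ) h x₀) p₀ p)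
    (k : CameronMartin m T) (η : Euc d) :
    inner ℝ (p (finalTime hT))
      (fderiv ℝ (fun q : CameronMartin m T × Euc d => ctrlSol hT (ctrlField σ₀ σ) q.1 q.2)
        (h, x₀) (k, η) (finalTime hT)) = inner ℝ p₀ η +
      inner ℝ (toCtl hT (Euc m) (momentumPath (fun i => (hσ i).1)
        ((ctrlSol hT (ctrlField σ₀ σ) h x₀).prodMk p))) k := by
  have hV := contDiff_ctrlField' hσ₀ hσ
  have hlin := isLin_fderiv_ctrlSol hV (globalSol_ctrlField (hT := hT) hσ₀ hσ) (h, x₀) (k, η)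
  rw [inner_adjoint_linearised hV hp hlin (finalTime hT), ← inner_toCtl_momentumPath]
  rfl

/-- `Dφ_T(h)^* p_T` is the momentum along the adjoint solution `p`. -/
lemma adjoint_fderiv_endpoint_of_isAdj {h : CameronMartin m T} {p₀ : Euc d}
    {p : C(Icc (0 : ℝ) T, Euc d)}
    (hp : IsAdj hT (ctrlField σ₀ σ) (aug h) (ctrlSol hT (ctrlField σ₀ σ) h x₀) p₀ p) :
    ContinuousLinearMap.adjoint (fderiv ℝ (endpoint σ₀ σ x₀) h) (p (finalTime hT)) =
      toCtl hT (Euc m) (momentumPath (fun i => (hσ i).1)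
        ((ctrlSol hT (ctrlField σ₀ σ) h x₀).prodMk p)) := by
  refine ext_inner_right ℝ fun k => ?_
  rw [ContinuousLinearMap.adjoint_inner_left, fderiv_endpoint_apply hT hσ₀ hσ,
    inner_adjoint_fderiv_ctrlSol hT hσ₀ hσ x₀ hp]
  simp

/-- `(D_yφ_T)^*` carries the covector at time `T` back to time `0`. -/
lemma adjoint_fderiv_controlFlow_of_isAdj {h : CameronMartin m T} {p₀ : Euc d}
    {p : C(Icc (0 : ℝ) T, Euc d)}
    (hp : IsAdj hT (ctrlField σ₀ σ) (aug h) (ctrlSol hT (ctrlField σ₀ σ) h x₀) p₀ p) :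
    ContinuousLinearMap.adjoint (fderiv ℝ (controlFlow σ₀ σ h T) x₀) (p (finalTime hT)) = p₀ := by
  refine ext_inner_right ℝ fun η => ?_
  rw [ContinuousLinearMap.adjoint_inner_left, fderiv_controlFlow hT hσ₀ hσ]
  have := inner_adjoint_fderiv_ctrlSol hT hσ₀ hσ x₀ hp 0 η
  rw [inner_zero_right, add_zero] at this
  exact this

include hT in
/-- `D_yφ_T` is injective, hence bijective: a vector which it kills is orthogonal to every initial
covector, since every initial covector is transported to time `T` by the adjoint equation. -/
lemma fderiv_controlFlow_surjective (h : CameronMartin m T) :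
    Function.Surjective (fderiv ℝ (controlFlow σ₀ σ h T) x₀) := by
  have hinj : Function.Injective (fderiv ℝ (controlFlow σ₀ σ h T) x₀ : Euc d →ₗ[ℝ] Euc d) := by
    rw [← LinearMap.ker_eq_bot, LinearMap.ker_eq_bot']
    intro η hη
    refine ext_inner_left ℝ fun p₀ => ?_
    obtain ⟨p, hp⟩ := exists_adjoint_solution (hT := hT) (contDiff_ctrlField' hσ₀ hσ) (aug h)
      (ctrlSol hT (ctrlField σ₀ σ) h x₀) p₀
    have hη' : fderiv ℝ (controlFlow σ₀ σ h T) x₀ η = 0 := hη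
    rw [← adjoint_fderiv_controlFlow_of_isAdj hT hσ₀ hσ x₀ hp,
      ContinuousLinearMap.adjoint_inner_left, hη', inner_zero_right, inner_zero_right]
  exact LinearMap.surjective_of_injective hinj

lemma isAdj_finalTime {h : CameronMartin m T} {r : Euc d} {p : C(Icc (0 : ℝ) T, Euc d)}
    (hp : IsAdj hT (ctrlField σ₀ σ) (aug h) (ctrlSol hT (ctrlField σ₀ σ) h x₀)
      (ContinuousLinearMap.adjoint (fderiv ℝ (controlFlow σ₀ σ h T) x₀) r) p) :
    p (finalTime hT) = r := by
  have h1 := adjoint_fderiv_controlFlow_of_isAdj hT hσ₀ hσ x₀ hp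
  refine ext_inner_right ℝ fun v => ?_
  obtain ⟨η, rfl⟩ := fderiv_controlFlow_surjective hT hσ₀ hσ x₀ h v
  rw [← ContinuousLinearMap.adjoint_inner_left, ← ContinuousLinearMap.adjoint_inner_left, h1]

include hT in
lemma contDiff_adjoint_fderiv_controlFlow (r : Euc d) :
    ContDiff ℝ ∞ fun h : CameronMartin m T =>
      ContinuousLinearMap.adjoint (fderiv ℝ (controlFlow σ₀ σ h T) x₀) r := by
  have h1 : ContDiff ℝ ∞ fun h : CameronMartin m T =>
      fderiv ℝ (fun q : CameronMartin m T × Euc d =>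
          ctrlSol hT (ctrlField σ₀ σ) q.1 q.2) (h, x₀) :=
    ((contDiff_ctrlSol_ctrlField hT hσ₀ hσ).fderiv_right (m := ∞) (by simp)).comp
      (contDiff_id.prodMk contDiff_const)
  have h2 : ContDiff ℝ ∞ fun h : CameronMartin m T => fderiv ℝ (controlFlow σ₀ σ h T) x₀ := by
    simp only [fderiv_controlFlow hT hσ₀ hσ x₀]
    exact contDiff_const.clm_comp (h1.clm_comp contDiff_const)
  exact ((adjointCLM d).contDiff.comp h2).clm_apply contDiff_const

/-- The lift of the controlled path of `h` whose terminal covector is `r`. -/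
def covectorPath (hT : 0 ≤ T) (σ₀ : Euc d → Euc d) (σ : Fin m → Euc d → Euc d) (x₀ r : Euc d)
    (h : CameronMartin m T) : C(Icc (0 : ℝ) T, Euc d × Euc d) :=
  ctrlSol hT (lift (ctrlField σ₀ σ)) h
    (x₀, ContinuousLinearMap.adjoint (fderiv ℝ (controlFlow σ₀ σ h T) x₀) r)

lemma covectorPath_isSol (r : Euc d) (h : CameronMartin m T) :
    IsSol hT (lift (ctrlField σ₀ σ)) (aug h)
      (x₀, ContinuousLinearMap.adjoint (fderiv ℝ (controlFlow σ₀ σ h T) x₀) r)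
      (covectorPath hT σ₀ σ x₀ r h) :=
  ((globalSol_ctrlField hσ₀ hσ).lift (contDiff_ctrlField' hσ₀ hσ)).isSol_ctrlSol h _

lemma exists_covectorPath_eq (r : Euc d) (h : CameronMartin m T) :
    ∃ p, IsAdj hT (ctrlField σ₀ σ) (aug h) (ctrlSol hT (ctrlField σ₀ σ) h x₀)
        (ContinuousLinearMap.adjoint (fderiv ℝ (controlFlow σ₀ σ h T) x₀) r) p ∧
      covectorPath hT σ₀ σ x₀ r h = (ctrlSol hT (ctrlField σ₀ σ) h x₀).prodMk p := by
  have hV := contDiff_ctrlField' hσ₀ hσ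
  obtain ⟨p, hp⟩ := exists_adjoint_solution (hT := hT) hV (aug h)
    (ctrlSol hT (ctrlField σ₀ σ) h x₀)
    (ContinuousLinearMap.adjoint (fderiv ℝ (controlFlow σ₀ σ h T) x₀) r)
  refine ⟨p, hp, ?_⟩
  have h1 := (isSol_lift_iff hV).mpr ⟨(globalSol_ctrlField hσ₀ hσ).isSol_ctrlSol h x₀, hp⟩
  exact (covectorPath_isSol hT hσ₀ hσ x₀ r h).unique
    ((contDiff_lift hV).of_le (by exact_mod_cast le_top)) h1

lemma fst_covectorPath (r : Euc d) (h : CameronMartin m T) (t : Icc (0 : ℝ) T) :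
    (covectorPath hT σ₀ σ x₀ r h t).1 = ctrlSol hT (ctrlField σ₀ σ) h x₀ t := by
  obtain ⟨p, -, hp⟩ := exists_covectorPath_eq hT hσ₀ hσ x₀ r h
  rw [hp]; rfl

lemma covectorPath_finalTime (r : Euc d) (h : CameronMartin m T) :
    covectorPath hT σ₀ σ x₀ r h (finalTime hT) = (endpoint σ₀ σ x₀ h, r) := by
  obtain ⟨p, hp, hz⟩ := exists_covectorPath_eq hT hσ₀ hσ x₀ r h
  rw [hz, ← isAdj_finalTime hT hσ₀ hσ x₀ hp, endpoint_eq hT hσ₀ hσ]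
  rfl

/-- The gradient of `h ↦ ⟨r, φ_T(h)⟩` is the momentum along the lift with terminal covector `r`. -/
lemma adjoint_fderiv_endpoint (r : Euc d) (h : CameronMartin m T) :
    ContinuousLinearMap.adjoint (fderiv ℝ (endpoint σ₀ σ x₀) h) r =
      toCtl hT (Euc m) (momentumPath (fun i => (hσ i).1) (covectorPath hT σ₀ σ x₀ r h)) := by
  obtain ⟨p, hp, hz⟩ := exists_covectorPath_eq hT hσ₀ hσ x₀ r h
  rw [hz, ← adjoint_fderiv_endpoint_of_isAdj hT hσ₀ hσ x₀ hp, isAdj_finalTime hT hσ₀ hσ x₀ hp]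

lemma contDiff_covectorPath (r : Euc d) :
    ContDiff ℝ ∞ (covectorPath (T := T) hT σ₀ σ x₀ r) := by
  have hV := contDiff_ctrlField' hσ₀ hσ
  exact (contDiff_ctrlSol (contDiff_lift hV) ((globalSol_ctrlField hσ₀ hσ).lift hV)).comp
    (contDiff_id.prodMk (contDiff_const.prodMk
      (contDiff_adjoint_fderiv_controlFlow hT hσ₀ hσ x₀ r)))

/-- The derivative of `covectorPath` in the direction `k` solves the linearised lifted equation; the
initial covector varies by some `δ`, because it depends on the control. -/
lemma isLin_fderiv_covectorPath (r : Euc d) (h k : CameronMartin m T) :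
    ∃ δ : Euc d, IsLin hT (lift (ctrlField σ₀ σ)) (aug h) (covectorPath hT σ₀ σ x₀ r h)
      (augL T m k) (0, δ) (fderiv ℝ (covectorPath hT σ₀ σ x₀ r) h k) := by
  have hV := contDiff_ctrlField' hσ₀ hσ
  have hex := (globalSol_ctrlField (hT := hT) hσ₀ hσ).lift hV
  have hJ := ((contDiff_adjoint_fderiv_controlFlow (T := T) hT hσ₀ hσ x₀ r).differentiable
    (by simp) h).hasFDerivAt
  refine ⟨fderiv ℝ (fun h : CameronMartin m T =>
      ContinuousLinearMap.adjoint (fderiv ℝ (controlFlow σ₀ σ h T) x₀) r) h k, ?_⟩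
  have hS := ((contDiff_ctrlSol (m := m) (contDiff_lift hV) hex).differentiable (by simp) (h,
    (x₀, ContinuousLinearMap.adjoint (fderiv ℝ (controlFlow σ₀ σ h T) x₀) r))).hasFDerivAt
  have hcomp := HasFDerivAt.comp h (f := fun h : CameronMartin m T => (h,
    (x₀, ContinuousLinearMap.adjoint (fderiv ℝ (controlFlow σ₀ σ h T) x₀) r))) hS
    ((hasFDerivAt_id h).prodMk ((hasFDerivAt_const x₀ h).prodMk hJ))
  have heq : fderiv ℝ (covectorPath hT σ₀ σ x₀ r) h = _ := HasFDerivAt.fderiv hcomp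
  rw [heq]
  exact isLin_fderiv_ctrlSol (contDiff_lift hV) hex _
    (k, (0, fderiv ℝ (fun h : CameronMartin m T =>
      ContinuousLinearMap.adjoint (fderiv ℝ (controlFlow σ₀ σ h T) x₀) r) h k))

/-- The terminal covector of `covectorPath` does not vary with the control. -/
lemma snd_fderiv_covectorPath_finalTime (r : Euc d) (h k : CameronMartin m T) :
    (fderiv ℝ (covectorPath hT σ₀ σ x₀ r) h k (finalTime hT)).2 = 0 := by
  have h1 := ((contDiff_covectorPath (T := T) hT hσ₀ hσ x₀ r).differentiable
    (by simp) h).hasFDerivAt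
  have h2 := (((ContinuousLinearMap.snd ℝ (Euc d) (Euc d)) ∘L
    (ContinuousMap.evalCLM ℝ (finalTime hT))).hasFDerivAt (x := covectorPath hT σ₀ σ x₀ r h)).comp
      h h1
  have h3 : HasFDerivAt (((ContinuousLinearMap.snd ℝ (Euc d) (Euc d)) ∘L
    (ContinuousMap.evalCLM ℝ (finalTime hT))) ∘ covectorPath hT σ₀ σ x₀ r)
      (0 : CameronMartin m T →L[ℝ] Euc d) h := by
    refine (hasFDerivAt_const r h).congr_of_eventuallyEq (Eventually.of_forall fun h' => ?_)
    exact congrArg Prod.snd (covectorPath_finalTime hT hσ₀ hσ x₀ r h')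
  exact congrArg (fun A => A k) (h2.unique h3)

omit hσ₀ in
/-- The derivative of the momenta along a variation `Ξ` of the path `z`. -/
def dMomentumPath (z Ξ : C(Icc (0 : ℝ) T, Euc d × Euc d)) : C(Icc (0 : ℝ) T, Euc m) :=
  pointwiseApply (Icc (0 : ℝ) T) (Euc d × Euc d) (Euc m)
    ((⟨fderiv ℝ (momentum σ), (contDiff_momentum fun i => (hσ i).1).continuous_fderiv (by simp)⟩ :
      C(Euc d × Euc d, Euc d × Euc d →L[ℝ] Euc m)).comp z) Ξ

lemma hasFDerivAt_adjoint_fderiv_endpoint (r : Euc d) (h : CameronMartin m T) :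
    DifferentiableAt ℝ (fun h : CameronMartin m T =>
      ContinuousLinearMap.adjoint (fderiv ℝ (endpoint σ₀ σ x₀) h) r) h ∧
    ∀ k, fderiv ℝ (fun h : CameronMartin m T =>
      ContinuousLinearMap.adjoint (fderiv ℝ (endpoint σ₀ σ x₀) h) r) h k =
        toCtl hT (Euc m) (dMomentumPath hσ (covectorPath hT σ₀ σ x₀ r h)
          (fderiv ℝ (covectorPath hT σ₀ σ x₀ r) h k)) := by
  have hm := contDiff_momentum fun i => (hσ i).1
  have h1 := ((contDiff_covectorPath (T := T) hT hσ₀ hσ x₀ r).differentiable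
    (by simp) h).hasFDerivAt
  have h2 := hasFDerivAt_comp_left (K := Icc (0 : ℝ) T) (hm.of_le (by exact_mod_cast le_top))
    (covectorPath hT σ₀ σ x₀ r h)
  have h3 := ((toCtl hT (Euc m)).hasFDerivAt).comp h (h2.comp h h1)
  have h4 := h3.congr_of_eventuallyEq (Eventually.of_forall
    (adjoint_fderiv_endpoint hT hσ₀ hσ x₀ r))
  exact ⟨h4.differentiableAt, fun k => by rw [h4.fderiv]; rfl⟩

omit hσ₀ in
/-- The momenta are linear in the covector. -/
lemma dMomentumPath_inr (x p r : C(Icc (0 : ℝ) T, Euc d)) :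
    dMomentumPath hσ (x.prodMk p) ((0 : C(Icc (0 : ℝ) T, Euc d)).prodMk r) =
      momentumPath (fun i => (hσ i).1) (x.prodMk r) := by
  ext t i
  have hm := (contDiff_momentum fun i => (hσ i).1).differentiable (by simp) (x t, p t)
  have h1 : HasFDerivAt (fun q => momentum σ (x t, q))
      ((fderiv ℝ (momentum σ) (x t, p t)) ∘L ContinuousLinearMap.inr ℝ (Euc d) (Euc d)) (p t) :=
    HasFDerivAt.comp (p t) (f := fun q => (x t, q)) hm.hasFDerivAt
      (hasFDerivAt_prodMk_right (x t) (p t))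
  have h2 : HasFDerivAt (fun q => momentum σ (x t, q) i) (innerSL ℝ (σ i (x t))) (p t) := by
    have : (fun q => momentum σ (x t, q) i) = innerSL ℝ (σ i (x t)) := by
      ext q
      simp [real_inner_comm]
    rw [this]
    exact ContinuousLinearMap.hasFDerivAt _
  have h3 := (EuclideanSpace.proj (𝕜 := ℝ) i).hasFDerivAt.comp (p t) h1
  have h4 := congrArg (fun A => A (r t)) (h3.unique h2)
  refine Eq.trans ?_ (h4.trans ?_)
  · rfl
  · simp [momentumPath, real_inner_comm]

/-- Derivative of the gradient `h ↦ Dφ_T(h)^* r` combined with a change of the terminal covector,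
read off from any solution of the linearised lifted equation with the right boundary values. -/
lemma fderiv_gradient_add_adjoint (r δq : Euc d) (h k : CameronMartin m T) {δ : Euc d}
    {Ξ : C(Icc (0 : ℝ) T, Euc d × Euc d)}
    (hΞ : IsLin hT (lift (ctrlField σ₀ σ)) (aug h) (covectorPath hT σ₀ σ x₀ r h)
      (augL T m k) (0, δ) Ξ) (hΞT : (Ξ (finalTime hT)).2 = δq) :
    fderiv ℝ (fun h : CameronMartin m T =>
      ContinuousLinearMap.adjoint (fderiv ℝ (endpoint σ₀ σ x₀) h) r) h k +
      ContinuousLinearMap.adjoint (fderiv ℝ (endpoint σ₀ σ x₀) h) δq =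
        toCtl hT (Euc m) (dMomentumPath hσ (covectorPath hT σ₀ σ x₀ r h) Ξ) := by
  have hV := contDiff_ctrlField' hσ₀ hσ
  obtain ⟨δ', hΞ'⟩ := isLin_fderiv_covectorPath hT hσ₀ hσ x₀ r h k
  set Ξ' := fderiv ℝ (covectorPath hT σ₀ σ x₀ r) h k with hΞ'def
  obtain ⟨p, -, hz⟩ := exists_covectorPath_eq hT hσ₀ hσ x₀ r h
  -- the difference of the two variations is vertical, hence an adjoint solution
  obtain ⟨q, hq⟩ := exists_adjoint_solution (hT := hT) hV (aug h)
    (ctrlSol hT (ctrlField σ₀ σ) h x₀) (δ - δ')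
  have hvert := IsAdj.isLin_lift hV (p := p) hq
  have hdiff := hΞ.sub (contDiff_lift hV) hΞ'
  rw [hz, sub_self, Prod.mk_sub_mk, sub_zero] at hdiff
  have heq := hdiff.unique (contDiff_lift hV) hvert
  have hqT : q (finalTime hT) = δq := by
    have h1 := congrArg (fun f => (f (finalTime hT)).2) heq
    have h2 := snd_fderiv_covectorPath_finalTime hT hσ₀ hσ x₀ r h k
    simp only [ContinuousMap.sub_apply, Prod.snd_sub, hΞT, hΞ'def, h2, sub_zero] at h1
    exact h1.symm
  rw [(hasFDerivAt_adjoint_fderiv_endpoint hT hσ₀ hσ x₀ r h).2, ← hqT,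
    adjoint_fderiv_endpoint_of_isAdj hT hσ₀ hσ x₀ hq, ← map_add,
    ← dMomentumPath_inr hσ (ctrlSol hT (ctrlField σ₀ σ) h x₀) p q, ← heq, ← hz]
  congr 1
  rw [← hΞ'def, dMomentumPath, dMomentumPath, ← map_add, add_sub_cancel]
  rfl

end Endpoint

/-! ### Constrained second-order calculus on level sets -/

section LevelSet

/-- The Hessian is determined by its diagonal, by polarisation. -/
lemma IsHessianAt.unique {E : Type*} [NormedAddCommGroup E] [NormedSpace ℝ E] {K : Set E}
    {f : E → ℝ} {x : E} {V : Submodule ℝ E} (hV : IsTangentSpaceAt K x V)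
    {B B' : LinearMap.BilinForm ℝ V} (hB : IsHessianAt K f x V B) (hB' : IsHessianAt K f x V B') :
    B = B' := by
  have h1 : ∀ v, B v v = B' v v := fun v => by
    obtain ⟨c, hc⟩ := (hV v).1 v.2
    rw [← hB.2 v c hc, ← hB'.2 v c hc]
  ext v w
  have h2 := h1 (v + w)
  simp only [map_add, LinearMap.add_apply] at h2
  linarith [h1 v, h1 w, hB.1.eq v w, hB'.1.eq v w]

/-- At a critical point of `f`, the second derivative of `f` along a curve depends only on the
velocity of the curve. -/
lemma iteratedDeriv_two_comp_of_fderiv_eq_zero {E : Type*} [NormedAddCommGroup E]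
    [NormedSpace ℝ E] {f : E → ℝ} {c : ℝ → E} (hf : ContDiff ℝ 2 f) (hc : ContDiffAt ℝ 2 c 0)
    (h0 : fderiv ℝ f (c 0) = 0) :
    iteratedDeriv 2 (fun t => f (c t)) 0 =
      fderiv ℝ (fderiv ℝ f) (c 0) (deriv c 0) (deriv c 0) := by
  have hc1 : ∀ᶠ t in 𝓝 (0 : ℝ), DifferentiableAt ℝ c t := by
    filter_upwards [hc.eventually (by simp)] with t ht using ht.differentiableAt (by simp)
  have h1 : deriv (fun t => f (c t)) =ᶠ[𝓝 0] fun t => fderiv ℝ f (c t) (deriv c t) := by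
    filter_upwards [hc1] with t ht
    exact fderiv_comp_deriv t (hf.differentiable (by simp) _) ht
  have h2 : DifferentiableAt ℝ (deriv c) 0 := by
    have : ContDiffAt ℝ 1 (deriv c) 0 := by
      have h3 : ContDiffAt ℝ 1 (fderiv ℝ c) 0 := hc.fderiv_right (by norm_num)
      exact h3.clm_apply contDiffAt_const
    exact this.differentiableAt (by simp)
  have h3 : HasFDerivAt (fderiv ℝ f) (fderiv ℝ (fderiv ℝ f) (c 0)) (c 0) :=
    ((hf.fderiv_right (m := 1) (by norm_num)).differentiable (by simp) _).hasFDerivAt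
  have h4 := (h3.comp_hasDerivAt 0 hc1.self_of_nhds.hasDerivAt).clm_apply h2.hasDerivAt
  rw [iteratedDeriv_succ, iteratedDeriv_one, h1.deriv_eq]
  refine h4.deriv.trans ?_
  simp [h0]

/-- The tangent space of a regular level set is the kernel of the derivative. -/
lemma isTangentSpaceAt_levelSet {E F : Type*} [NormedAddCommGroup E] [NormedSpace ℝ E]
    [NormedAddCommGroup F] [NormedSpace ℝ F] [FiniteDimensional ℝ F]
    {ψ : E → F} {x : E} (hψ : ContDiff ℝ 2 ψ) (hs : Function.Surjective (fderiv ℝ ψ x)) :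
    IsTangentSpaceAt {y | ψ y = ψ x} x (LinearMap.ker (fderiv ℝ ψ x).toLinearMap) := by
  have hD : HasFDerivAt ψ (fderiv ℝ ψ x) x := (hψ.differentiable (by simp) x).hasFDerivAt
  intro v
  rw [LinearMap.mem_ker]
  constructor
  · intro hv
    replace hv : fderiv ℝ ψ x v = 0 := hv
    have : CompleteSpace F := FiniteDimensional.complete ℝ F
    obtain ⟨R, hR⟩ := (fderiv ℝ ψ x).exists_rightInverse_of_surjective
      (LinearMap.range_eq_top.2 hs)
    -- solve `ψ (x + t v + R r) = ψ x` for `r = r t`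
    set A : ℝ × F →L[ℝ] E :=
      (ContinuousLinearMap.toSpanSingleton ℝ v).coprod R with hA
    set f : ℝ × F → F := fun q => ψ (x + A q) with hf
    have hfc : ContDiff ℝ 2 f := hψ.comp (contDiff_const.add A.contDiff)
    have hfD : HasFDerivAt f (fderiv ℝ ψ x ∘L A) 0 := by
      have h1 : HasFDerivAt (fun q => x + A q) A 0 := A.hasFDerivAt.const_add x
      have h2 : HasFDerivAt ψ (fderiv ℝ ψ x) (x + A 0) := by simpa using hD
      exact h2.comp 0 h1
    have hinr : fderiv ℝ f 0 ∘L ContinuousLinearMap.inr ℝ ℝ F = ContinuousLinearMap.id ℝ F := by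
      rw [hfD.fderiv]
      ext1 r
      have := DFunLike.congr_fun hR r
      simpa [hA] using this
    have hinl : fderiv ℝ f 0 ∘L ContinuousLinearMap.inl ℝ ℝ F = 0 := by
      rw [hfD.fderiv]
      ext1
      simp [hA, hv]
    have hinv : (fderiv ℝ f 0 ∘L ContinuousLinearMap.inr ℝ ℝ F).IsInvertible := by
      rw [hinr]; exact ⟨.refl ℝ F, rfl⟩
    have hfa : ContDiffAt ℝ 2 f 0 := hfc.contDiffAt
    have h2 : (2 : WithTop ℕ∞) ≠ 0 := by simp
    set r := hfa.implicitFunction h2 hinv with hr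
    have hr0 : r 0 = 0 := hfa.implicitFunction_apply_self h2 hinv
    have hrD : HasDerivAt r 0 0 := by
      have h3 := (hfa.hasStrictFDerivAt_implicitFunction h2 hinv).hasFDerivAt
      rw [hinl] at h3
      simpa using h3.hasDerivAt
    have hrc : ContDiffAt ℝ 2 r 0 := hfa.contDiffAt_implicitFunction h2 hinv
    refine ⟨fun t => x + A (t, r t), ?_, ?_, ?_, ?_⟩
    · exact contDiffAt_const.add (A.contDiff.contDiffAt.comp 0 (contDiffAt_id.prodMk hrc))
    · have h3 := hfa.eventually_apply_implicitFunction h2 hinv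
      filter_upwards [h3] with t ht
      simpa [hf] using ht
    · simp only [hr0]
      exact (congrArg (x + ·) (map_zero A)).trans (add_zero x)
    · have h3 : HasDerivAt (fun t => x + A (t, r t)) (A (1, 0)) 0 :=
        ((A.hasFDerivAt.comp_hasDerivAt 0 ((hasDerivAt_id 0).prodMk hrD))).const_add x
      rw [h3.deriv]
      simp [hA]
  · rintro ⟨c, hc, hK, h0, hv⟩
    have h1 : HasDerivAt c v 0 := hv ▸ (hc.differentiableAt (by simp)).hasDerivAt
    have h2 : HasDerivAt (fun t => ψ (c t)) (fderiv ℝ ψ x v) 0 := by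
      rw [← h0] at hD
      have h3 := HasFDerivAt.comp_hasDerivAt (l := ψ) 0 hD h1
      rwa [h0] at h3
    have h3 : (fun t => ψ (c t)) =ᶠ[𝓝 0] fun _ => ψ x := hK
    have h4 := h2.congr_of_eventuallyEq h3.symm
    exact h4.unique (hasDerivAt_const 0 (ψ x))

variable {H F : Type*} [NormedAddCommGroup H] [InnerProductSpace ℝ H] [CompleteSpace H]
  [NormedAddCommGroup F] [InnerProductSpace ℝ F] [FiniteDimensional ℝ F] [CompleteSpace F]

lemma exists_adjoint_eq_of_orthogonal_ker (A : H →L[ℝ] F) {x : H}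
    (hx : ∀ k, A k = 0 → inner ℝ x k = 0) : ∃ q, x = ContinuousLinearMap.adjoint A q := by
  have h1 : x ∈ A.kerᗮ :=
    (Submodule.mem_orthogonal _ _).2 fun k hk => by rw [real_inner_comm]; exact hx k hk
  rw [ContinuousLinearMap.orthogonal_ker,
    (Submodule.closed_of_finiteDimensional _).submodule_topologicalClosure_eq] at h1
  obtain ⟨q, hq⟩ := h1
  exact ⟨q, hq.symm⟩

/-- Lagrange multipliers: a point of least norm of a regular level set of `ψ` lies in the range of
the adjoint of the derivative of `ψ`. -/
lemma exists_multiplier_of_isMin_norm {ψ : H → F} {x : H} (hψ : ContDiff ℝ 2 ψ)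
    (hs : Function.Surjective (fderiv ℝ ψ x)) (hmin : ∀ y, ψ y = ψ x → ‖x‖ ≤ ‖y‖) :
    ∃ q, x = ContinuousLinearMap.adjoint (fderiv ℝ ψ x) q := by
  refine exists_adjoint_eq_of_orthogonal_ker _ fun v hv => ?_
  obtain ⟨c, hc, hK, h0, hcv⟩ := (isTangentSpaceAt_levelSet hψ hs v).1 hv
  have h2 : HasDerivAt c v 0 := hcv ▸ (hc.differentiableAt (by simp)).hasDerivAt
  have h4 : IsLocalMin (fun t => ‖c t‖ ^ 2) 0 := by
    filter_upwards [hK] with t ht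
    have := hmin _ ht
    rw [h0]
    gcongr
  have h5 := h4.hasDerivAt_eq_zero h2.norm_sq
  rw [h0] at h5
  linarith

lemma iteratedDeriv_two_nonneg_of_isLocalMin {e : ℝ → ℝ} (he : ContDiffAt ℝ 2 e 0)
    (hmin : IsLocalMin e 0) : 0 ≤ iteratedDeriv 2 e 0 := by
  rw [iteratedDeriv_succ, iteratedDeriv_one]
  by_contra! hneg
  have h1 := isLocalMax_of_deriv_deriv_neg hneg hmin.deriv_eq_zero he.continuousAt
  have h2 : e =ᶠ[𝓝 0] fun _ => e 0 := by
    filter_upwards [h1, hmin] with t ht ht' using le_antisymm ht ht'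
  rw [h2.deriv.deriv_eq] at hneg
  simp at hneg

/-- The Hessian of the energy on a regular level set, at a point of least norm with multiplier `q`:
it is the second derivative of `½ ‖·‖² - ⟨q, ψ ·⟩`, whose gradient is `y - (Dψ y)^* q`. -/
lemma exists_isHessianAt_levelSet {ψ : H → F} {x : H} (hψ : ContDiff ℝ 2 ψ)
    (hs : Function.Surjective (fderiv ℝ ψ x)) (hmin : ∀ y, ψ y = ψ x → ‖x‖ ≤ ‖y‖) {q : F}
    (hq : x = ContinuousLinearMap.adjoint (fderiv ℝ ψ x) q) :
    ∃ B, IsHessianAt {y | ψ y = ψ x} (fun y => (1 / 2) * ‖y‖ ^ 2) x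
        (LinearMap.ker (fderiv ℝ ψ x).toLinearMap) B ∧
      (∀ k k', B k k' = inner ℝ
        ((k : H) - fderiv ℝ (fun y => ContinuousLinearMap.adjoint (fderiv ℝ ψ y) q) x k) k') ∧
      ∀ k, 0 ≤ B k k := by
  set f : H → ℝ := fun y => (1 / 2) * ‖y‖ ^ 2 - inner ℝ q (ψ y) with hf
  set g : H → H := fun y => ContinuousLinearMap.adjoint (fderiv ℝ ψ y) q with hg
  have hfc : ContDiff ℝ 2 f := (contDiff_const.mul (contDiff_norm_sq ℝ)).sub
    (contDiff_const.inner ℝ hψ)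
  have hfD : fderiv ℝ f = fun y => innerSL ℝ (y - g y) := by
    ext1 y
    refine HasFDerivAt.fderiv ?_
    have h1 := ((hasStrictFDerivAt_norm_sq y).hasFDerivAt).const_mul (1 / 2 : ℝ)
    have h2 := ((innerSL ℝ q).hasFDerivAt (x := ψ y)).comp y
      (hψ.differentiable (by simp) y).hasFDerivAt
    refine (h1.sub h2).congr_fderiv ?_
    ext1 k
    simp [hg, ContinuousLinearMap.adjoint_inner_left]
  have hgd : Differentiable ℝ g := by
    have h1 : ContDiff ℝ 1 (fderiv ℝ ψ) := hψ.fderiv_right (by norm_num)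
    have h2 : Differentiable ℝ fun y => ContinuousLinearMap.adjoint (fderiv ℝ ψ y) :=
      ContinuousLinearEquiv.differentiable
        (ContinuousLinearMap.adjoint (𝕜 := ℝ) (E := H) (F := F)).toContinuousLinearEquiv |>.comp
        (h1.differentiable (by simp))
    intro y
    exact (h2 y).clm_apply (differentiableAt_const q)
  have hfD2 : ∀ k k', fderiv ℝ (fderiv ℝ f) x k k' = inner ℝ (k - fderiv ℝ g x k) k' := by
    intro k k'
    have h1 : HasFDerivAt (fun y => y - g y) (ContinuousLinearMap.id ℝ H - fderiv ℝ g x) x :=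
      (hasFDerivAt_id x).sub (hgd x).hasFDerivAt
    have h2 : HasFDerivAt (fderiv ℝ f) ((innerSL ℝ : H →L[ℝ] H →L[ℝ] ℝ) ∘L
        (ContinuousLinearMap.id ℝ H - fderiv ℝ g x)) x := by
      rw [hfD]
      exact (innerSL ℝ : H →L[ℝ] H →L[ℝ] ℝ).hasFDerivAt.comp x h1
    rw [h2.fderiv]
    rfl
  have hf0 : fderiv ℝ f x = 0 := by
    rw [hfD]
    simp only [hg]
    rw [← hq]
    simp
  have hcurve : ∀ (v : H) (c : ℝ → H), IsCurveThrough {y | ψ y = ψ x} x v c →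
      iteratedDeriv 2 (fun t => (1 / 2) * ‖c t‖ ^ 2) 0 = fderiv ℝ (fderiv ℝ f) x v v := by
    rintro v c ⟨hc, hK, h0, hv⟩
    have h1 := iteratedDeriv_two_comp_of_fderiv_eq_zero hfc hc (by rw [h0]; exact hf0)
    rw [h0, hv] at h1
    rw [← h1]
    have h2 : (fun t => f (c t)) =ᶠ[𝓝 0] fun t => (1 / 2) * ‖c t‖ ^ 2 - inner ℝ q (ψ x) := by
      filter_upwards [hK] with t ht
      simp only [hf]
      rw [show ψ (c t) = ψ x from ht]
    rw [iteratedDeriv_succ, iteratedDeriv_one, iteratedDeriv_succ, iteratedDeriv_one,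
      h2.deriv.deriv_eq]
    simp
  have hsymm : IsSymmSndFDerivAt ℝ f x := hfc.contDiffAt.isSymmSndFDerivAt (by simp)
  refine ⟨LinearMap.mk₂ ℝ (fun k k' => fderiv ℝ (fderiv ℝ f) x (k : H) (k' : H))
    (by simp) (by simp) (by simp) (by simp), ⟨⟨?_⟩, ?_⟩, ?_, ?_⟩
  · intro k k'
    exact hsymm k k'
  · intro v c hc
    exact hcurve v c hc
  · intro k k'
    exact hfD2 k k'
  · intro k
    obtain ⟨c, hc⟩ := (isTangentSpaceAt_levelSet hψ hs k).1 k.2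
    refine (iteratedDeriv_two_nonneg_of_isLocalMin
      (contDiffAt_const.mul (hc.1.norm_sq ℝ)) ?_).trans_eq (hcurve k c hc)
    filter_upwards [hc.2.1] with t ht
    have := hmin _ ht
    rw [hc.2.2.1]
    gcongr

end LevelSet

/-! ### The projected endpoint map -/

section ProjEndpoint

variable {l n m : ℕ} {T : ℝ}

/-- The projection `Π_l` as a continuous linear map. -/
def projCLM (l n : ℕ) : Euc (l + n) →L[ℝ] Euc l :=
  LinearMap.toContinuousLinearMap
    { toFun := proj l n
      map_add' := fun _ _ => by ext; simp [proj]
      map_smul' := fun _ _ => by ext; simp [proj] }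

@[simp] lemma projCLM_apply (x : Euc (l + n)) : projCLM l n x = proj l n x := rfl

/-- `q ↦ (q, 0)` as a continuous linear map. -/
def padRightCLM (l n : ℕ) : Euc l →L[ℝ] Euc (l + n) :=
  LinearMap.toContinuousLinearMap
    { toFun := padRight
      map_add' := fun x y => by
        ext i; refine Fin.addCases (fun i => ?_) (fun i => ?_) i <;> simp [padRight]
      map_smul' := fun c x => by
        ext i; refine Fin.addCases (fun i => ?_) (fun i => ?_) i <;> simp [padRight] }

@[simp] lemma padRightCLM_apply (q : Euc l) : padRightCLM l n q = padRight q := rfl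

/-- `z ↦ (0, z)` as a continuous linear map. -/
def padLeftCLM (l n : ℕ) : Euc n →L[ℝ] Euc (l + n) :=
  LinearMap.toContinuousLinearMap
    { toFun := padLeft
      map_add' := fun x y => by
        ext i; refine Fin.addCases (fun i => ?_) (fun i => ?_) i <;> simp [padLeft]
      map_smul' := fun c x => by
        ext i; refine Fin.addCases (fun i => ?_) (fun i => ?_) i <;> simp [padLeft] }

@[simp] lemma padLeftCLM_apply (z : Euc n) : padLeftCLM l n z = padLeft z := rfl

lemma adjoint_projCLM (q : Euc l) :
    ContinuousLinearMap.adjoint (projCLM l n) q = padRight q := by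
  refine ext_inner_right ℝ fun v => ?_
  rw [ContinuousLinearMap.adjoint_inner_left]
  simp [PiLp.inner_apply, Fin.sum_univ_add, padRight, proj]

@[simp] lemma proj_padRight (q : Euc l) : proj l n (padRight q) = q := by
  ext i; simp [proj, padRight]

@[simp] lemma proj_padLeft (z : Euc n) : proj l n (padLeft z) = 0 := by
  ext i; simp [proj, padLeft]

lemma exists_padLeft_eq {x : Euc (l + n)} (hx : proj l n x = 0) : ∃ z : Euc n, x = padLeft z := by
  refine ⟨WithLp.toLp 2 fun i => x (Fin.natAdd l i), ?_⟩
  ext i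
  refine Fin.addCases (fun i => ?_) (fun i => ?_) i
  · have := congrArg (fun y : Euc l => y i) hx
    simpa [padLeft, proj] using this
  · simp [padLeft]

lemma padLeft_injective : Function.Injective (padLeft : Euc n → Euc (l + n)) := fun z z' h => by
  ext i
  have := congrArg (fun y : Euc (l + n) => y (Fin.natAdd l i)) h
  simpa [padLeft] using this

variable {σ₀ : Euc (l + n) → Euc (l + n)} {σ : Fin m → Euc (l + n) → Euc (l + n)}
  {x₀ : Euc (l + n)} {h₀ : CameronMartin m T}

lemma contDiff_projEndpoint (hT : 0 ≤ T) (hσ₀ : SmoothBounded σ₀) (hσ : ∀ i, SmoothBounded (σ i)) :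
    ContDiff ℝ ∞ (projEndpoint (T := T) σ₀ σ x₀) :=
  (projCLM l n).contDiff.comp (contDiff_endpoint hT hσ₀ hσ x₀)

lemma fderiv_projEndpoint (hT : 0 ≤ T) (hσ₀ : SmoothBounded σ₀) (hσ : ∀ i, SmoothBounded (σ i))
    (h : CameronMartin m T) :
    fderiv ℝ (projEndpoint σ₀ σ x₀) h = projCLM l n ∘L fderiv ℝ (endpoint σ₀ σ x₀) h :=
  ((projCLM l n).hasFDerivAt.comp h
    ((contDiff_endpoint hT hσ₀ hσ x₀).differentiable (by simp) h).hasFDerivAt).fderiv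

lemma adjoint_fderiv_projEndpoint (hT : 0 ≤ T) (hσ₀ : SmoothBounded σ₀)
    (hσ : ∀ i, SmoothBounded (σ i)) (h : CameronMartin m T) (q : Euc l) :
    ContinuousLinearMap.adjoint (fderiv ℝ (projEndpoint σ₀ σ x₀) h) q =
      ContinuousLinearMap.adjoint (fderiv ℝ (endpoint σ₀ σ x₀) h) (padRight q) := by
  rw [fderiv_projEndpoint hT hσ₀ hσ, ContinuousLinearMap.adjoint_comp, ← adjoint_projCLM]
  rfl

lemma surjective_of_isUnit_malliavin {d : ℕ} {σ₀ : Euc d → Euc d} {σ : Fin m → Euc d → Euc d}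
    {x₀ : Euc d} (hC : IsUnit (malliavin σ₀ σ x₀ h₀)) :
    Function.Surjective (fderiv ℝ (endpoint σ₀ σ x₀) h₀) := by
  intro y
  obtain ⟨u, hu⟩ := hC
  have h1 : malliavin σ₀ σ x₀ h₀ * ↑u⁻¹ = 1 := by rw [← hu]; exact u.mul_inv
  exact ⟨_, DFunLike.congr_fun h1 y⟩

lemma surjective_fderiv_projEndpoint (hT : 0 ≤ T) (hσ₀ : SmoothBounded σ₀)
    (hσ : ∀ i, SmoothBounded (σ i)) (hC : IsUnit (malliavin σ₀ σ x₀ h₀)) :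
    Function.Surjective (fderiv ℝ (projEndpoint σ₀ σ x₀) h₀) := by
  rw [fderiv_projEndpoint hT hσ₀ hσ]
  exact Function.Surjective.comp (g := projCLM l n) (fun q => ⟨padRight q, by simp⟩)
    (surjective_of_isUnit_malliavin hC)

lemma admissible_eq {a : Euc l} (h : h₀ ∈ minimizers T σ₀ σ x₀ a) :
    admissible T σ₀ σ x₀ a = {y | projEndpoint σ₀ σ x₀ y = projEndpoint σ₀ σ x₀ h₀} := by
  ext y
  have h1 : projEndpoint σ₀ σ x₀ h₀ = a := h.1
  simp [admissible, h1]

lemma norm_le_of_mem_minimizers {a : Euc l} (h : h₀ ∈ minimizers T σ₀ σ x₀ a)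
    (y : CameronMartin m T) (hy : projEndpoint σ₀ σ x₀ y = projEndpoint σ₀ σ x₀ h₀) :
    ‖h₀‖ ≤ ‖y‖ := by
  have h1 : y ∈ admissible T σ₀ σ x₀ a := by rw [admissible_eq h]; exact hy
  have h2 : energy h₀ ≤ energy y := by
    rw [h.2]
    exact csInf_le ⟨0, by rintro _ ⟨z, -, rfl⟩; unfold energy; positivity⟩ ⟨y, h1, rfl⟩
  simp only [energy] at h2
  exact (pow_le_pow_iff_left₀ (norm_nonneg _) (norm_nonneg _) two_ne_zero).1 (by linarith)

end ProjEndpoint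

/-! ### The Hamiltonian vector field -/

section HamField

variable {d m : ℕ} {σ₀ : Euc d → Euc d} {σ : Fin m → Euc d → Euc d}

/-- The Hamiltonian vector field is the lift of the control fields, driven by the momenta and by the
control `1` for the drift. -/
lemma hamField_eq_lift (hσ₀ : ContDiff ℝ ∞ σ₀) (hσ : ∀ i, ContDiff ℝ ∞ (σ i))
    (z : Euc d × Euc d) : hamField σ₀ σ z = lift (ctrlField σ₀ σ) z (1, momentum σ z) := by
  obtain ⟨x, p⟩ := z
  have hV := contDiff_ctrlField hσ₀ hσ
  have hp : HasGradientAt (fun p => hamiltonian σ₀ σ x p)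
      (ctrlField σ₀ σ x (1, momentum σ (x, p))) p := by
    rw [hasGradientAt_iff_hasFDerivAt]
    have h1 : ∀ v : Euc d, HasFDerivAt (fun p : Euc d => inner ℝ p v) (innerSL ℝ v) p := fun v => by
      have : (fun p : Euc d => inner ℝ p v) = innerSL ℝ v := by
        ext q; simp [real_inner_comm]
      rw [this]
      exact ContinuousLinearMap.hasFDerivAt _
    have h2 := (h1 (σ₀ x)).add ((HasFDerivAt.fun_sum (u := Finset.univ) fun i _ =>
      (h1 (σ i x)).pow 2).const_mul (1 / 2 : ℝ))
    refine h2.congr_fderiv ?_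
    ext v
    simp only [ctrlField_apply, one_smul, InnerProductSpace.toDual_apply_apply, inner_add_left,
      sum_inner, inner_smul_left]
    simp [Finset.mul_sum, ← mul_assoc]
  have hx : HasGradientAt (fun x => hamiltonian σ₀ σ x p)
      (-adjCoeff (ctrlField σ₀ σ) x p (1, momentum σ (x, p))) x := by
    rw [hasGradientAt_iff_hasFDerivAt]
    have h1 : ∀ {f : Euc d → Euc d}, ContDiff ℝ ∞ f →
        HasFDerivAt (fun x => inner ℝ p (f x)) (innerSL ℝ p ∘L fderiv ℝ f x) x := fun hf =>
      (innerSL ℝ p).hasFDerivAt.comp x (hf.differentiable (by simp) x).hasFDerivAt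
    have h2 := (h1 hσ₀).add ((HasFDerivAt.fun_sum (u := Finset.univ) fun i _ =>
      (h1 (hσ i)).pow 2).const_mul (1 / 2 : ℝ))
    refine h2.congr_fderiv ?_
    ext v
    have h3 : fderiv ℝ (ctrlField σ₀ σ) x v (1, momentum σ (x, p)) =
        fderiv ℝ σ₀ x v + ∑ i, momentum σ (x, p) i • fderiv ℝ (σ i) x v := by
      have h4 := (hV.differentiable (by simp) x).hasFDerivAt
      have h5 := h4.clm_apply (hasFDerivAt_const (1, momentum σ (x, p)) x)
      have h6 : HasFDerivAt (fun y => ctrlField σ₀ σ y (1, momentum σ (x, p)))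
          (fderiv ℝ σ₀ x + ∑ i, momentum σ (x, p) i • fderiv ℝ (σ i) x) x := by
        simp only [ctrlField_apply, one_smul]
        exact (hσ₀.differentiable (by simp) x).hasFDerivAt.add
          (HasFDerivAt.fun_sum fun i _ =>
            ((hσ i).differentiable (by simp) x).hasFDerivAt.fun_const_smul _)
      have := congrArg (fun A => A v) (h5.unique h6)
      simpa using this
    rw [InnerProductSpace.toDual_apply_apply, inner_neg_left, inner_adjCoeff, h3]
    simp [inner_add_right, inner_sum, inner_smul_right, Finset.mul_sum, ← mul_assoc]
  rw [hamField, hp.gradient, hx.gradient, neg_neg, lift_apply]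

lemma contDiff_hamField (hσ₀ : ContDiff ℝ ∞ σ₀) (hσ : ∀ i, ContDiff ℝ ∞ (σ i)) :
    ContDiff ℝ ∞ (hamField σ₀ σ) := by
  have h1 : hamField σ₀ σ = fun z => lift (ctrlField σ₀ σ) z (1, momentum σ z) :=
    funext (hamField_eq_lift hσ₀ hσ)
  rw [h1]
  exact (contDiff_lift (contDiff_ctrlField hσ₀ hσ)).clm_apply
    (contDiff_const.prodMk (contDiff_momentum hσ))

lemma fderiv_hamField (hσ₀ : ContDiff ℝ ∞ σ₀) (hσ : ∀ i, ContDiff ℝ ∞ (σ i))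
    (z Ξ : Euc d × Euc d) : fderiv ℝ (hamField σ₀ σ) z Ξ =
      fderiv ℝ (lift (ctrlField σ₀ σ)) z Ξ (1, momentum σ z) +
        lift (ctrlField σ₀ σ) z (0, fderiv ℝ (momentum σ) z Ξ) := by
  have h1 : hamField σ₀ σ = fun z => lift (ctrlField σ₀ σ) z (1, momentum σ z) :=
    funext (hamField_eq_lift hσ₀ hσ)
  have h2 := ((contDiff_lift (contDiff_ctrlField hσ₀ hσ)).differentiable (by simp) z).hasFDerivAt
  have h3 := ((contDiff_momentum hσ).differentiable (by simp) z).hasFDerivAt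
  have h4 := h2.clm_apply ((hasFDerivAt_const (1 : ℝ) z).prodMk h3)
  rw [h1, h4.fderiv]
  simp [add_comm]

end HamField

/-! ### Autonomous equations -/

section Autonomous

variable {E : Type} [NormedAddCommGroup E] [NormedSpace ℝ E]

/-- The vector field `X` driven by a scalar control. -/
def autField (X : E → E) (x : E) : ℝ →L[ℝ] E := (ContinuousLinearMap.id ℝ ℝ).smulRight (X x)

@[simp] lemma autField_apply (X : E → E) (x : E) (c : ℝ) : autField X x c = c • X x := rfl

lemma contDiff_autField {X : E → E} {n : WithTop ℕ∞} (hX : ContDiff ℝ n X) :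
    ContDiff ℝ n (autField X) :=
  (ContinuousLinearMap.smulRightL ℝ ℝ E (ContinuousLinearMap.id ℝ ℝ)).contDiff.comp hX

lemma fderiv_autField {X : E → E} (hX : ContDiff ℝ 1 X) (x v : E) (c : ℝ) :
    fderiv ℝ (autField X) x v c = c • fderiv ℝ X x v := by
  have h1 := ((contDiff_autField hX).differentiable (by simp) x).hasFDerivAt.clm_apply
    (hasFDerivAt_const c x)
  have h2 : HasFDerivAt (fun y => autField X y c) (c • fderiv ℝ X x) x :=
    (hX.differentiable (by simp) x).hasFDerivAt.const_smul c
  simpa using congrArg (fun A => A v) (h1.unique h2)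

/-- The constant scalar control `c`. -/
def constCtl (T c : ℝ) : Ctl T ℝ := (memLp_const c).toLp _

lemma coeFn_constCtl (T c : ℝ) :
    constCtl T c =ᵐ[volume.restrict (Icc (0 : ℝ) T)] fun _ => c := MemLp.coeFn_toLp _

variable {T : ℝ} {hT : 0 ≤ T} {X : E → E}

lemma isSol_autField_iff {c : ℝ} {y : E} {x : C(Icc (0 : ℝ) T, E)} :
    IsSol hT (autField X) (constCtl T c) y x ↔
      ∀ t : Icc (0 : ℝ) T, x t = y + ∫ s in (0 : ℝ)..t, c • X (x (projIcc 0 T hT s)) := by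
  refine forall_congr' fun t => ?_
  rw [intervalIntegral.integral_congr_ae_restrict
    (g := fun s => c • X (x (projIcc 0 T hT s))) ?_]
  filter_upwards [Ctl.ae_Ioc (coeFn_constCtl T c) t.2] with s hs
  rw [hs, autField_apply]

lemma isLin_autField_iff (hX : ContDiff ℝ 1 X) {c : ℝ} {η : E} {x ξ : C(Icc (0 : ℝ) T, E)} :
    IsLin hT (autField X) (constCtl T c) x 0 η ξ ↔
      ∀ t : Icc (0 : ℝ) T, ξ t = η + ∫ s in (0 : ℝ)..t,
        c • fderiv ℝ X (x (projIcc 0 T hT s)) (ξ (projIcc 0 T hT s)) := by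
  refine forall_congr' fun t => ?_
  rw [intervalIntegral.integral_congr_ae_restrict
    (g := fun s => c • fderiv ℝ X (x (projIcc 0 T hT s)) (ξ (projIcc 0 T hT s))) ?_]
  filter_upwards [Ctl.ae_Ioc (coeFn_constCtl T c) t.2,
    Ctl.ae_Ioc (Lp.coeFn_zero ℝ 2 (volume.restrict (Icc (0 : ℝ) T))) t.2] with s hs h0
  rw [hs, h0, Pi.zero_apply, map_zero, add_zero, fderiv_autField hX]

/-- The path run backwards. -/
def reversePath (T : ℝ) {F : Type*} [TopologicalSpace F] (x : C(Icc (0 : ℝ) T, F)) :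
    C(Icc (0 : ℝ) T, F) :=
  x.comp ⟨fun t => ⟨T - t, sub_nonneg.2 t.2.2, sub_le_self _ t.2.1⟩, by fun_prop⟩

lemma reversePath_apply {F : Type*} [TopologicalSpace F] (x : C(Icc (0 : ℝ) T, F))
    (t : Icc (0 : ℝ) T) :
    reversePath T x t = x ⟨T - t, sub_nonneg.2 t.2.2, sub_le_self _ t.2.1⟩ := rfl

lemma reversePath_reversePath {F : Type*} [TopologicalSpace F] (x : C(Icc (0 : ℝ) T, F)) :
    reversePath T (reversePath T x) = x := by
  ext t
  rw [reversePath_apply, reversePath_apply]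
  congr 1
  ext
  simp

lemma reversePath_finalTime {F : Type*} [TopologicalSpace F] (x : C(Icc (0 : ℝ) T, F)) :
    reversePath T x (finalTime hT) = x ⟨0, le_rfl, hT⟩ := by
  rw [reversePath_apply]
  congr 1
  ext
  simp [finalTime]

/-- Time reversal of an integral equation. -/
lemma reversePath_eq_add_integral {F : Type*} [NormedAddCommGroup F] [NormedSpace ℝ F]
    {x : C(Icc (0 : ℝ) T, F)} {G : C(Icc (0 : ℝ) T, F)}
    {y : F} (hx : ∀ t : Icc (0 : ℝ) T, x t = y + ∫ s in (0 : ℝ)..t, G (projIcc 0 T hT s))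
    (t : Icc (0 : ℝ) T) :
    reversePath T x t = x (finalTime hT) +
      ∫ s in (0 : ℝ)..t, -reversePath T G (projIcc 0 T hT s) := by
  have hG := continuous_extend hT G
  have h1 : ∫ s in (0 : ℝ)..t, -reversePath T G (projIcc 0 T hT s) =
      -∫ s in (0 : ℝ)..t, G (projIcc 0 T hT (T - s)) := by
    rw [← intervalIntegral.integral_neg]
    refine intervalIntegral.integral_congr fun s hs => ?_
    rw [uIcc_of_le t.2.1] at hs
    have hs' : s ∈ Icc 0 T := ⟨hs.1, hs.2.trans t.2.2⟩
    have hs'' : T - s ∈ Icc 0 T := ⟨sub_nonneg.2 hs'.2, sub_le_self _ hs'.1⟩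
    simp only [projIcc_of_mem hT hs', projIcc_of_mem hT hs'', reversePath_apply]
  rw [h1, intervalIntegral.integral_comp_sub_left (fun s => G (projIcc 0 T hT s)), sub_zero,
    reversePath_apply, hx, hx]
  have h2 := intervalIntegral.integral_add_adjacent_intervals
    (hG.intervalIntegrable (μ := volume) 0 (T - t)) (hG.intervalIntegrable (T - t) T)
  simp only [finalTime]
  rw [← h2]
  abel

lemma IsSol.reverse (hX : Continuous X) {c : ℝ} {y : E} {x : C(Icc (0 : ℝ) T, E)}
    (h : IsSol hT (autField X) (constCtl T c) y x) :
    IsSol hT (autField X) (constCtl T (-c)) (x (finalTime hT)) (reversePath T x) := by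
  rw [isSol_autField_iff] at h ⊢
  intro t
  rw [reversePath_eq_add_integral
    (G := ⟨fun t => c • X (x t), (hX.comp x.continuous).const_smul c⟩) h t]
  simp [reversePath]

lemma IsLin.reverse (hX : ContDiff ℝ 1 X) {c : ℝ} {η : E} {x ξ : C(Icc (0 : ℝ) T, E)}
    (h : IsLin hT (autField X) (constCtl T c) x 0 η ξ) :
    IsLin hT (autField X) (constCtl T (-c)) (reversePath T x) 0 (ξ (finalTime hT))
      (reversePath T ξ) := by
  rw [isLin_autField_iff hX] at h ⊢
  intro t
  rw [reversePath_eq_add_integral (G := ⟨fun t => c • fderiv ℝ X (x t) (ξ t),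
    (((hX.continuous_fderiv (by simp)).comp x.continuous).clm_apply ξ.continuous).const_smul c⟩)
    h t]
  simp [reversePath]

/-- Solutions of the linearised autonomous equation are determined by their terminal value. -/
lemma IsLin.eq_of_finalTime (hX : ContDiff ℝ ∞ X) {c : ℝ} {η η' : E} {x ξ ξ' : C(Icc (0 : ℝ) T, E)}
    (h : IsLin hT (autField X) (constCtl T c) x 0 η ξ)
    (h' : IsLin hT (autField X) (constCtl T c) x 0 η' ξ')
    (hT' : ξ (finalTime hT) = ξ' (finalTime hT)) : ξ = ξ' := by
  have hX1 : ContDiff ℝ 1 X := hX.of_le (by exact_mod_cast le_top)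
  have h1 := h.reverse hX1
  rw [hT'] at h1
  rw [← reversePath_reversePath ξ, h1.unique (contDiff_autField hX) (h'.reverse hX1),
    reversePath_reversePath]

end Autonomous

/-! ### Hamiltonian curves as solutions of an integral equation -/

section HamCurve

variable {d m : ℕ} {σ₀ : Euc d → Euc d} {σ : Fin m → Euc d → Euc d}

/-- The affine time change `τ ↦ s + c τ` turns Hamiltonian curves, run in either direction, into
solutions driven by the constant control `c`. -/
lemma exists_isSol_of_isHamCurve (hσ₀ : ContDiff ℝ ∞ σ₀) (hσ : ∀ i, ContDiff ℝ ∞ (σ i))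
    {s c L : ℝ} (hL : 0 ≤ L) {z : Euc d × Euc d} {γ : ℝ → Euc d × Euc d}
    (h : IsHamCurve σ₀ σ s (s + c * L) z γ) :
    ∃ x : C(Icc (0 : ℝ) L, Euc d × Euc d),
      IsSol hL (autField (hamField σ₀ σ)) (constCtl L c) z x ∧ ∀ τ, x τ = γ (s + c * τ) := by
  have hX := (contDiff_hamField hσ₀ hσ).continuous
  have hmaps : MapsTo (fun τ => s + c * τ) (Icc 0 L) (uIcc s (s + c * L)) := by
    intro τ hτ
    rcases le_total 0 c with hc | hc
    · rw [uIcc_of_le (by nlinarith)]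
      constructor <;> nlinarith [hτ.1, hτ.2]
    · rw [uIcc_of_ge (by nlinarith)]
      constructor <;> nlinarith [hτ.1, hτ.2]
  have haff : ∀ τ : ℝ, HasDerivAt (fun τ => s + c * τ) c τ := fun τ => by
    simpa using ((hasDerivAt_id τ).const_mul c).const_add s
  have hd : ∀ τ ∈ Icc 0 L, HasDerivWithinAt (fun τ => γ (s + c * τ))
      (c • hamField σ₀ σ (γ (s + c * τ))) (Icc 0 L) τ := fun τ hτ =>
    HasDerivWithinAt.scomp τ (h.2 _ (hmaps hτ)) (haff τ).hasDerivWithinAt hmaps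
  have hcont : ContinuousOn (fun τ => γ (s + c * τ)) (Icc 0 L) := fun τ hτ =>
    (hd τ hτ).continuousWithinAt
  have hcont' : Continuous fun τ : Icc (0 : ℝ) L => γ (s + c * τ) :=
    continuousOn_iff_continuous_domRestrict.mp hcont
  refine ⟨⟨fun τ => γ (s + c * τ), hcont'⟩,
    isSol_autField_iff.2 fun t => ?_, fun τ => rfl⟩
  have hsub : Icc 0 (t : ℝ) ⊆ Icc 0 L := Icc_subset_Icc_right t.2.2
  have h1 := intervalIntegral.integral_eq_sub_of_hasDerivAt_of_le t.2.1 (hcont.mono hsub)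
    (f' := fun τ => c • hamField σ₀ σ (γ (s + c * τ)))
    (fun τ hτ => (hd τ (hsub (Ioo_subset_Icc_self hτ))).hasDerivAt
      (Icc_mem_nhds hτ.1 (hτ.2.trans_le t.2.2)))
    (ContinuousOn.intervalIntegrable (by
      rw [uIcc_of_le t.2.1]
      exact (hX.comp_continuousOn (hcont.mono hsub)).const_smul c))
  have h2 : ∀ τ ∈ uIcc 0 (t : ℝ), c • hamField σ₀ σ (γ (s + c * τ)) = c • hamField σ₀ σ
      (γ (s + c * (projIcc 0 L hL τ : ℝ))) := fun τ hτ => by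
    rw [uIcc_of_le t.2.1] at hτ
    rw [projIcc_of_mem hL (hsub hτ)]
  rw [intervalIntegral.integral_congr h2] at h1
  simp only [ContinuousMap.coe_mk]
  rw [h1, mul_zero, add_zero, h.1]
  abel

/-- The converse time change; `c = 0` is excluded since the time of the curve is recovered as
`(r - s) / c`. -/
lemma isHamCurve_of_isSol (hσ₀ : ContDiff ℝ ∞ σ₀) (hσ : ∀ i, ContDiff ℝ ∞ (σ i))
    {s c L : ℝ} (hc : c ≠ 0) (hL : 0 ≤ L) {z : Euc d × Euc d}
    {x : C(Icc (0 : ℝ) L, Euc d × Euc d)}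
    (h : IsSol hL (autField (hamField σ₀ σ)) (constCtl L c) z x) :
    IsHamCurve σ₀ σ s (s + c * L) z fun r => x (projIcc 0 L hL ((r - s) / c)) := by
  have hX := (contDiff_hamField hσ₀ hσ).continuous
  have hx := continuous_extend hL x
  refine ⟨?_, fun r hr => ?_⟩
  · simpa using h.apply_zero
  have hmem : ∀ r ∈ uIcc s (s + c * L), (r - s) / c ∈ Icc 0 L := by
    intro r hr
    rcases hc.lt_or_gt with hc | hc
    · rw [uIcc_of_ge (by nlinarith)] at hr
      exact ⟨div_nonneg_of_nonpos (by linarith [hr.2]) hc.le,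
        (div_le_iff_of_neg hc).2 (by nlinarith [hr.1])⟩
    · rw [uIcc_of_le (by nlinarith)] at hr
      exact ⟨div_nonneg (by linarith [hr.1]) hc.le, (div_le_iff₀ hc).2 (by nlinarith [hr.2])⟩
  have hG : Continuous fun τ => c • hamField σ₀ σ (x (projIcc 0 L hL τ)) :=
    (hX.comp hx).const_smul c
  have h1 : HasDerivAt (fun τ => z + ∫ s in (0 : ℝ)..τ, c • hamField σ₀ σ (x (projIcc 0 L hL s)))
      (c • hamField σ₀ σ (x (projIcc 0 L hL ((r - s) / c)))) ((r - s) / c) :=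
    (intervalIntegral.integral_hasDerivAt_right (hG.intervalIntegrable _ _)
      hG.stronglyMeasurable.stronglyMeasurableAtFilter hG.continuousAt).const_add z
  have h2 : HasDerivAt (fun r => (r - s) / c) (1 / c) r :=
    ((hasDerivAt_id r).sub_const s).div_const c
  have h3 := h1.scomp r h2
  rw [smul_smul, one_div_mul_cancel hc, one_smul] at h3
  have hcongr : ∀ r ∈ uIcc s (s + c * L), x (projIcc 0 L hL ((r - s) / c)) =
      ((fun τ => z + ∫ s in (0 : ℝ)..τ, c • hamField σ₀ σ (x (projIcc 0 L hL s))) ∘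
        fun r => (r - s) / c) r := fun r hr => by
    rw [projIcc_of_mem hL (hmem r hr)]
    exact isSol_autField_iff.1 h ⟨_, hmem r hr⟩
  exact h3.hasDerivWithinAt.congr hcongr (hcongr r hr)

/-- The flow map is evaluated along any Hamiltonian curve. -/
lemma hamFlow_eq (hσ₀ : ContDiff ℝ ∞ σ₀) (hσ : ∀ i, ContDiff ℝ ∞ (σ i))
    {s t : ℝ} {z : Euc d × Euc d} {γ : ℝ → Euc d × Euc d} (h : IsHamCurve σ₀ σ s t z γ) :
    hamFlow σ₀ σ s t z = γ t := by
  have h' : IsHamCurve σ₀ σ s t z (Classical.epsilon (IsHamCurve σ₀ σ s t z)) :=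
    Classical.epsilon_spec ⟨γ, h⟩
  have ht : t = s + (t - s) * 1 := by ring
  rw [hamFlow]
  rw [ht] at h h'
  obtain ⟨x, hx, hxγ⟩ := exists_isSol_of_isHamCurve hσ₀ hσ zero_le_one h
  obtain ⟨x', hx', hxγ'⟩ := exists_isSol_of_isHamCurve hσ₀ hσ zero_le_one h'
  have hxx := hx.unique (contDiff_autField
    ((contDiff_hamField hσ₀ hσ).of_le (by exact_mod_cast le_top))) hx'
  have h1 := hxγ ⟨1, zero_le_one, le_rfl⟩
  have h2 := hxγ' ⟨1, zero_le_one, le_rfl⟩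
  rw [← hxx, h1] at h2
  simpa using h2.symm

/-- Near the endpoint of a Hamiltonian path the backward flow is defined and differentiable, and its
derivative takes the terminal values of solutions of the linearised equation to their initial
values. -/
lemma exists_hasFDerivAt_hamFlow_backward (hσ₀ : ContDiff ℝ ∞ σ₀) (hσ : ∀ i, ContDiff ℝ ∞ (σ i))
    {T : ℝ} {hT : 0 ≤ T} {ζ : Euc d × Euc d} {z : C(Icc (0 : ℝ) T, Euc d × Euc d)}
    (hz : IsSol hT (autField (hamField σ₀ σ)) (constCtl T 1) ζ z) :
    (∀ᶠ Y in 𝓝 (z (finalTime hT)), Y ∈ hamDomain σ₀ σ T 0) ∧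
    ∃ D : Euc d × Euc d →L[ℝ] Euc d × Euc d,
      HasFDerivAt (hamFlow σ₀ σ T 0) D (z (finalTime hT)) ∧
      (∀ δ Ξ, IsLin hT (autField (hamField σ₀ σ)) (constCtl T 1) z 0 δ Ξ →
        D (Ξ (finalTime hT)) = δ) ∧
      ∀ η, ∃ δ Ξ, IsLin hT (autField (hamField σ₀ σ)) (constCtl T 1) z 0 δ Ξ ∧
        Ξ (finalTime hT) = η := by
  have hX := contDiff_hamField hσ₀ hσ
  have hX1 : ContDiff ℝ 1 (hamField σ₀ σ) := hX.of_le (by exact_mod_cast le_top)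
  have hA := contDiff_autField hX
  have hr := hz.reverse hX.continuous
  obtain ⟨hev, hcd⟩ := hr.eventually_and_contDiffAt hA
  have hcurve : ∀ Y, IsSol hT (autField (hamField σ₀ σ)) (constCtl T (-1)) Y
      (sol hT (autField (hamField σ₀ σ)) (constCtl T (-1)) Y) →
      IsHamCurve σ₀ σ T 0 Y fun r => sol hT (autField (hamField σ₀ σ)) (constCtl T (-1)) Y
        (projIcc 0 T hT ((r - T) / (-1))) := fun Y hY => by
    have h1 := isHamCurve_of_isSol hσ₀ hσ (s := T) (c := -1) (by norm_num) hT hY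
    rwa [show T + -1 * T = 0 by ring] at h1
  have hin : Continuous fun Y : Euc d × Euc d => (constCtl T (-1), Y) := by fun_prop
  have hev' : ∀ᶠ Y in 𝓝 (z (finalTime hT)),
      IsSol hT (autField (hamField σ₀ σ)) (constCtl T (-1)) Y
        (sol hT (autField (hamField σ₀ σ)) (constCtl T (-1)) Y) :=
    hin.continuousAt.eventually hev
  refine ⟨hev'.mono fun Y hY => ⟨_, hcurve Y hY⟩, ?_⟩
  set D' := fderiv ℝ (fun q : Ctl T ℝ × (Euc d × Euc d) =>
    sol hT (autField (hamField σ₀ σ)) q.1 q.2) (constCtl T (-1), z (finalTime hT)) with hD'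
  have hlin : ∀ η, IsLin hT (autField (hamField σ₀ σ)) (constCtl T (-1)) (reversePath T z) 0 η
      (D' (0, η)) := fun η => by
    rw [isLin_iff_eq hA]
    exact hr.fderiv_sol hA 0 η
  refine ⟨ContinuousMap.evalCLM ℝ (finalTime hT) ∘L D' ∘L
    ContinuousLinearMap.inr ℝ (Ctl T ℝ) (Euc d × Euc d), ?_, fun δ Ξ hΞ => ?_, fun η => ?_⟩
  · have h1 := (ContinuousMap.evalCLM ℝ (finalTime hT)).hasFDerivAt.comp (z (finalTime hT))
      (HasFDerivAt.comp (z (finalTime hT)) (f := fun Y : Euc d × Euc d => (constCtl T (-1), Y))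
        (hcd.differentiableAt (by simp)).hasFDerivAt
        (hasFDerivAt_prodMk_right (constCtl T (-1)) (z (finalTime hT))))
    refine h1.congr_of_eventuallyEq (hev'.mono fun Y hY => ?_)
    rw [hamFlow_eq hσ₀ hσ (hcurve Y hY)]
    have h2 : projIcc 0 T hT ((0 - T) / (-1)) = finalTime hT := by
      rw [show (0 - T) / (-1) = T by ring]
      exact projIcc_right hT
    rw [h2]
    rfl
  · have h1 := hΞ.reverse hX1
    have h2 := (hlin _).unique hA h1
    have h3 : D' (0, Ξ (finalTime hT)) (finalTime hT) = δ := by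
      rw [h2, reversePath_finalTime, hΞ.apply_zero]
    exact h3
  · have h1 := (hlin η).reverse hX1
    rw [neg_neg, reversePath_reversePath] at h1
    refine ⟨_, _, h1, ?_⟩
    rw [reversePath_finalTime, (hlin η).apply_zero]

end HamCurve

/-! ### Lifted paths driven by their own momenta -/

section SelfDriven

variable {d m : ℕ} {T : ℝ} {hT : 0 ≤ T} {σ₀ : Euc d → Euc d} {σ : Fin m → Euc d → Euc d}

lemma coeFn_aug_of_eq (hσ : ∀ i, ContDiff ℝ ∞ (σ i)) {z : C(Icc (0 : ℝ) T, Euc d × Euc d)}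
    {h : CameronMartin m T} (hh : h = toCtl hT (Euc m) (momentumPath hσ z)) :
    aug h =ᵐ[volume.restrict (Icc (0 : ℝ) T)] fun s => (1, momentum σ (z (projIcc 0 T hT s))) := by
  filter_upwards [coeFn_aug h, coeFn_toCtl hT (momentumPath hσ z)] with s h1 h2
  rw [h1, hh, h2]
  rfl

/-- A lifted path whose control is its own momentum is a Hamiltonian path, and conversely. -/
lemma isSol_hamField_iff (hσ₀ : ContDiff ℝ ∞ σ₀) (hσ : ∀ i, ContDiff ℝ ∞ (σ i))
    {z : C(Icc (0 : ℝ) T, Euc d × Euc d)} {h : CameronMartin m T}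
    (hh : h = toCtl hT (Euc m) (momentumPath hσ z)) {ζ : Euc d × Euc d} :
    IsSol hT (autField (hamField σ₀ σ)) (constCtl T 1) ζ z ↔
      IsSol hT (lift (ctrlField σ₀ σ)) (aug h) ζ z := by
  rw [isSol_autField_iff]
  refine forall_congr' fun t => ?_
  rw [intervalIntegral.integral_congr_ae_restrict
    (g := fun s => lift (ctrlField σ₀ σ) (z (projIcc 0 T hT s)) (aug h s)) ?_]
  filter_upwards [Ctl.ae_Ioc (coeFn_aug_of_eq hσ hh) t.2] with s hs
  rw [hs, one_smul, hamField_eq_lift hσ₀ hσ]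

/-- Along a self-driven path, a solution of the linearised Hamiltonian equation is a solution of
the linearised lifted equation for the variation of the control by the variation of the momenta,
and conversely. -/
lemma isLin_hamField_iff (hσ₀ : SmoothBounded σ₀) (hσ : ∀ i, SmoothBounded (σ i))
    {z Ξ : C(Icc (0 : ℝ) T, Euc d × Euc d)} {h k : CameronMartin m T}
    (hh : h = toCtl hT (Euc m) (momentumPath (fun i => (hσ i).1) z))
    (hk : k = toCtl hT (Euc m) (dMomentumPath hσ z Ξ)) {ζ : Euc d × Euc d} :
    IsLin hT (autField (hamField σ₀ σ)) (constCtl T 1) z 0 ζ Ξ ↔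
      IsLin hT (lift (ctrlField σ₀ σ)) (aug h) z (augL T m k) ζ Ξ := by
  have hσ' := fun i => (hσ i).1
  rw [isLin_autField_iff ((contDiff_hamField hσ₀.1 hσ').of_le (by exact_mod_cast le_top))]
  refine forall_congr' fun t => ?_
  rw [intervalIntegral.integral_congr_ae_restrict
    (g := fun s => fderiv ℝ (lift (ctrlField σ₀ σ)) (z (projIcc 0 T hT s))
      (Ξ (projIcc 0 T hT s)) (aug h s) +
        lift (ctrlField σ₀ σ) (z (projIcc 0 T hT s)) (augL T m k s)) ?_]
  filter_upwards [Ctl.ae_Ioc (coeFn_aug_of_eq hσ' hh) t.2, Ctl.ae_Ioc (coeFn_augL k) t.2,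
    Ctl.ae_Ioc (coeFn_toCtl hT (dMomentumPath hσ z Ξ)) t.2] with s h1 h2 h3
  rw [h1, h2, hk, h3, one_smul, fderiv_hamField hσ₀.1 hσ']
  rfl

end SelfDriven

/-! ### The initial covector -/

section InitialCovector

variable {d m : ℕ} {T : ℝ} {hT : 0 ≤ T} {σ₀ : Euc d → Euc d} {σ : Fin m → Euc d → Euc d}

lemma isInitialCovector_iff (hσ₀ : SmoothBounded σ₀) (hσ : ∀ i, SmoothBounded (σ i))
    {x₀ p₀ : Euc d} {h : CameronMartin m T} :
    IsInitialCovector σ₀ σ x₀ h p₀ ↔ ∃ z : C(Icc (0 : ℝ) T, Euc d × Euc d),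
      IsSol hT (autField (hamField σ₀ σ)) (constCtl T 1) (x₀, p₀) z ∧
        ∀ t, (z t).1 = ctrlSol hT (ctrlField σ₀ σ) h x₀ t := by
  have hσ₀' := hσ₀.1
  have hσ' := fun i => (hσ i).1
  constructor
  · rintro ⟨⟨γ, hγ⟩, hflow⟩
    have hγ' : IsHamCurve σ₀ σ 0 (0 + 1 * T) (x₀, p₀) γ := by simpa using hγ
    obtain ⟨z, hz, hzγ⟩ := exists_isSol_of_isHamCurve hσ₀' hσ' hT hγ'
    refine ⟨z, hz, fun t => ?_⟩
    have hsub : uIcc 0 (t : ℝ) ⊆ uIcc 0 T := by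
      rw [uIcc_of_le hT, uIcc_of_le t.2.1]
      exact Icc_subset_Icc_right t.2.2
    have ht : IsHamCurve σ₀ σ 0 t (x₀, p₀) γ :=
      ⟨hγ.1, fun s hs => (hγ.2 s (hsub hs)).mono hsub⟩
    have h1 := hzγ t
    rw [zero_add, one_mul] at h1
    rw [h1, ← hamFlow_eq hσ₀' hσ' ht, ← hflow t t.2, controlFlow_eq (hT := hT) hσ₀ hσ]
  · rintro ⟨z, hz, hzx⟩
    have h1 : IsHamCurve σ₀ σ 0 T (x₀, p₀) fun r => z (projIcc 0 T hT r) := by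
      simpa using isHamCurve_of_isSol hσ₀' hσ' (s := 0) one_ne_zero hT hz
    refine ⟨⟨_, h1⟩, fun t ht => ?_⟩
    have hsub : uIcc 0 t ⊆ uIcc 0 T := by
      rw [uIcc_of_le hT, uIcc_of_le ht.1]
      exact Icc_subset_Icc_right ht.2
    have h2 : IsHamCurve σ₀ σ 0 t (x₀, p₀) fun r => z (projIcc 0 T hT r) :=
      ⟨h1.1, fun s hs => (h1.2 s (hsub hs)).mono hsub⟩
    rw [hamFlow_eq hσ₀' hσ' h2, projIcc_of_mem hT ht, hzx,
      ← controlFlow_eq (hT := hT) hσ₀ hσ h x₀ ⟨t, ht⟩]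

/-- If the control is the gradient `Dφ_T(h)^* r`, the lift with terminal covector `r` is a
Hamiltonian path. -/
lemma isSol_hamField_covectorPath (hσ₀ : SmoothBounded σ₀) (hσ : ∀ i, SmoothBounded (σ i))
    {x₀ r : Euc d} {h : CameronMartin m T}
    (hh : h = ContinuousLinearMap.adjoint (fderiv ℝ (endpoint σ₀ σ x₀) h) r) :
    IsSol hT (autField (hamField σ₀ σ)) (constCtl T 1)
      (x₀, ContinuousLinearMap.adjoint (fderiv ℝ (controlFlow σ₀ σ h T) x₀) r)
      (covectorPath hT σ₀ σ x₀ r h) := by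
  have h1 := hh.trans (adjoint_fderiv_endpoint hT hσ₀ hσ x₀ r h)
  exact (isSol_hamField_iff hσ₀.1 (fun i => (hσ i).1) h1).2 (covectorPath_isSol hT hσ₀ hσ x₀ r h)

lemma isInitialCovector_of_eq (hT : 0 ≤ T) (hσ₀ : SmoothBounded σ₀) (hσ : ∀ i, SmoothBounded (σ i))
    {x₀ r : Euc d} {h : CameronMartin m T}
    (hh : h = ContinuousLinearMap.adjoint (fderiv ℝ (endpoint σ₀ σ x₀) h) r) :
    IsInitialCovector σ₀ σ x₀ h
      (ContinuousLinearMap.adjoint (fderiv ℝ (controlFlow σ₀ σ h T) x₀) r) :=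
  (isInitialCovector_iff (hT := hT) hσ₀ hσ).2 ⟨_, isSol_hamField_covectorPath hσ₀ hσ hh,
    fst_covectorPath hT hσ₀ hσ x₀ r h⟩

/-- Two controls with the same path: their difference is orthogonal to the momenta of every lift of
that path, because the momenta pair with variations of the control through variations of the
path. -/
lemma inner_sub_eq_zero_of_isSol (hσ₀ : SmoothBounded σ₀) (hσ : ∀ i, SmoothBounded (σ i))
    {h u : CameronMartin m T} {y p₀ : Euc d} {x p : C(Icc (0 : ℝ) T, Euc d)}
    (hh : IsSol hT (ctrlField σ₀ σ) (aug h) y x) (hu : IsSol hT (ctrlField σ₀ σ) (aug u) y x)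
    (hp : IsAdj hT (ctrlField σ₀ σ) (aug u) x p₀ p) :
    inner ℝ (toCtl hT (Euc m) (momentumPath (fun i => (hσ i).1) (x.prodMk p))) (h - u) = 0 := by
  have hV := contDiff_ctrlField' hσ₀ hσ
  have hx := continuous_extend hT x
  have hlin : IsLin hT (ctrlField σ₀ σ) (aug u) x (augL T m (h - u)) 0 0 := by
    intro t
    have h1 : aug h - aug u = augL T m (h - u) := by simp [aug]
    have hi : ∀ v : Ctl T (ℝ × Euc m), IntervalIntegrable
        (fun s => ctrlField σ₀ σ (x (projIcc 0 T hT s)) (v s)) volume 0 t := fun v =>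
      Ctl.intervalIntegrable_of_integrable (Ctl.integrable_apply (hV.continuous.comp hx) v) t.2
    have h2 : ∫ s in (0 : ℝ)..t, (fderiv ℝ (ctrlField σ₀ σ) (x (projIcc 0 T hT s))
        ((0 : C(Icc (0 : ℝ) T, Euc d)) (projIcc 0 T hT s)) (aug u s) +
          ctrlField σ₀ σ (x (projIcc 0 T hT s)) (augL T m (h - u) s)) =
        ∫ s in (0 : ℝ)..t, (ctrlField σ₀ σ (x (projIcc 0 T hT s)) (aug h s) -
          ctrlField σ₀ σ (x (projIcc 0 T hT s)) (aug u s)) := by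
      refine intervalIntegral.integral_congr_ae_restrict ?_
      rw [← h1]
      filter_upwards [Ctl.ae_Ioc (Lp.coeFn_sub (aug h) (aug u)) t.2] with s hs
      rw [hs, Pi.sub_apply, map_sub]
      simp
    rw [h2, intervalIntegral.integral_sub (hi _) (hi _)]
    have h3 := hh t
    rw [hu t] at h3
    rw [add_left_cancel h3]
    simp
  have h4 := inner_adjoint_linearised hV hp hlin (finalTime hT)
  rw [← inner_toCtl_momentumPath]
  simpa [finalTime] using h4.symm

variable {x₀ : Euc d} {h₀ : CameronMartin m T}

/-- For a control of least energy with the given endpoint and surjective `Dφ_T`, the initial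
covector is determined: the momenta of a Hamiltonian lift define a control with the same path and
no larger energy, hence the control itself, and the terminal covector can be recovered from it. -/
lemma IsInitialCovector.eq_of_isMin (hT : 0 ≤ T) (hσ₀ : SmoothBounded σ₀)
    (hσ : ∀ i, SmoothBounded (σ i))
    (hs : Function.Surjective (fderiv ℝ (endpoint σ₀ σ x₀) h₀))
    (hmin : ∀ u : CameronMartin m T, endpoint σ₀ σ x₀ u = endpoint σ₀ σ x₀ h₀ → ‖h₀‖ ≤ ‖u‖)
    {p₀ r : Euc d} (hr : h₀ = ContinuousLinearMap.adjoint (fderiv ℝ (endpoint σ₀ σ x₀) h₀) r)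
    (hp₀ : IsInitialCovector σ₀ σ x₀ h₀ p₀) :
    p₀ = ContinuousLinearMap.adjoint (fderiv ℝ (controlFlow σ₀ σ h₀ T) x₀) r := by
  have hV := contDiff_ctrlField' hσ₀ hσ
  have hV1 : ContDiff ℝ 1 (ctrlField σ₀ σ) := hV.of_le (by exact_mod_cast le_top)
  obtain ⟨z, hz, hzx⟩ := (isInitialCovector_iff (hT := hT) hσ₀ hσ).1 hp₀
  set u := toCtl hT (Euc m) (momentumPath (fun i => (hσ i).1) z) with hu
  rw [isSol_hamField_iff hσ₀.1 (fun i => (hσ i).1) hu] at hz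
  set x := ctrlSol hT (ctrlField σ₀ σ) h₀ x₀ with hx
  obtain ⟨p, hzp⟩ : ∃ p, z = x.prodMk p :=
    ⟨(⟨Prod.snd, continuous_snd⟩ : C(Euc d × Euc d, Euc d)).comp z,
      ContinuousMap.ext fun t => Prod.ext (hzx t) rfl⟩
  rw [hzp, isSol_lift_iff hV] at hz
  obtain ⟨hux, hadj⟩ := hz
  have hhx : IsSol hT (ctrlField σ₀ σ) (aug h₀) x₀ x :=
    (globalSol_ctrlField hσ₀ hσ).isSol_ctrlSol h₀ x₀
  have horth : inner ℝ u (h₀ - u) = 0 := by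
    have := inner_sub_eq_zero_of_isSol hσ₀ hσ hhx hux hadj
    rwa [← hzp] at this
  have hend : endpoint σ₀ σ x₀ u = endpoint σ₀ σ x₀ h₀ := by
    rw [endpoint_eq hT hσ₀ hσ, endpoint_eq hT hσ₀ hσ, ← hx]
    exact congrArg (fun f => f (finalTime hT)) (hux.eq_sol hV1)
  have huh : h₀ = u := by
    have h1 := hmin u hend
    have h2 : ‖h₀‖ ^ 2 = ‖u‖ ^ 2 + ‖h₀ - u‖ ^ 2 := by
      have h3 := norm_add_sq_real u (h₀ - u)
      rw [horth] at h3
      simpa using h3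
    have h4 : ‖h₀‖ ^ 2 ≤ ‖u‖ ^ 2 := by gcongr
    have h5 : ‖h₀ - u‖ ^ 2 = 0 := le_antisymm (by linarith) (sq_nonneg _)
    exact sub_eq_zero.1 (norm_eq_zero.1 (pow_eq_zero_iff two_ne_zero |>.1 h5))
  have hadj' : IsAdj hT (ctrlField σ₀ σ) (aug h₀) x p₀ p := huh ▸ hadj
  have hpT : p (finalTime hT) = r := by
    have h1 := adjoint_fderiv_endpoint_of_isAdj hT hσ₀ hσ x₀ hadj'
    rw [← hx, ← hzp, ← hu, ← huh] at h1
    refine ext_inner_right ℝ fun v => ?_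
    obtain ⟨k, rfl⟩ := hs v
    rw [← ContinuousLinearMap.adjoint_inner_left, ← ContinuousLinearMap.adjoint_inner_left, h1,
      ← hr]
  rw [← hpT, adjoint_fderiv_controlFlow_of_isAdj hT hσ₀ hσ x₀ hadj']

end InitialCovector

/-! ### The derivative of the backward projection -/

section Backward

variable {l n m : ℕ} {T : ℝ} {σ₀ : Euc (l + n) → Euc (l + n)}
  {σ : Fin m → Euc (l + n) → Euc (l + n)} {x₀ p₀ : Euc (l + n)}

lemma hamFlow_eq_finalTime {d : ℕ} {σ₀ : Euc d → Euc d} {σ : Fin m → Euc d → Euc d}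
    (hT : 0 ≤ T) (hσ₀ : ContDiff ℝ ∞ σ₀) (hσ : ∀ i, ContDiff ℝ ∞ (σ i)) {ζ : Euc d × Euc d}
    {z : C(Icc (0 : ℝ) T, Euc d × Euc d)}
    (hz : IsSol hT (autField (hamField σ₀ σ)) (constCtl T 1) ζ z) :
    hamFlow σ₀ σ 0 T ζ = z (finalTime hT) := by
  have h1 := isHamCurve_of_isSol hσ₀ hσ (s := 0) one_ne_zero hT hz
  rw [show (0 : ℝ) + 1 * T = T by ring] at h1
  rw [hamFlow_eq hσ₀ hσ h1, show (T - 0) / 1 = T by ring, projIcc_right]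
  rfl

/-- The backward flow from the perturbed terminal points is defined and differentiable, and its
derivative is read off from the solutions of the linearised Hamiltonian equation. -/
lemma exists_hasFDerivAt_backwardProj {hT : 0 ≤ T} (hσ₀ : ContDiff ℝ ∞ σ₀)
    (hσ : ∀ i, ContDiff ℝ ∞ (σ i)) {z : C(Icc (0 : ℝ) T, Euc (l + n) × Euc (l + n))}
    (hz : IsSol hT (autField (hamField σ₀ σ)) (constCtl T 1) (x₀, p₀) z) :
    (∀ᶠ w in 𝓝 0, terminalPoint T σ₀ σ x₀ p₀ w ∈ hamDomain σ₀ σ T 0) ∧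
    ∃ D : Euc n × Euc l →L[ℝ] Euc (l + n), HasFDerivAt (backwardProj T σ₀ σ x₀ p₀) D 0 ∧
      ∀ w, ∃ δ Ξ, IsLin hT (autField (hamField σ₀ σ)) (constCtl T 1) z 0 (D w, δ) Ξ ∧
        Ξ (finalTime hT) = (padLeft w.1, padRight w.2) := by
  obtain ⟨hdom, D, hD, hΞ, hex⟩ := exists_hasFDerivAt_hamFlow_backward hσ₀ hσ hz
  set P : Euc n × Euc l →L[ℝ] Euc (l + n) × Euc (l + n) :=
    (padLeftCLM l n).prodMap (padRightCLM l n) with hP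
  have hterm : ∀ w, terminalPoint T σ₀ σ x₀ p₀ w = z (finalTime hT) + P w := fun w => by
    rw [terminalPoint, hamFlow_eq_finalTime hT hσ₀ hσ hz]
    rfl
  have hlim : z (finalTime hT) + P 0 = z (finalTime hT) := by rw [map_zero, add_zero]
  have hcont : ContinuousAt (fun w => z (finalTime hT) + P w) 0 := by fun_prop
  have hPd : HasFDerivAt (fun w => z (finalTime hT) + P w) P 0 := P.hasFDerivAt.const_add _
  refine ⟨?_, ContinuousLinearMap.fst ℝ _ _ ∘L D ∘L P, ?_, fun w => ?_⟩
  · simp only [hterm]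
    refine hcont.eventually ?_
    beta_reduce
    rwa [hlim]
  · have h1 : backwardProj T σ₀ σ x₀ p₀ = fun w =>
        (hamFlow σ₀ σ T 0 (z (finalTime hT) + P w)).1 :=
      funext fun w => by rw [backwardProj, hterm]
    rw [h1]
    rw [← hlim] at hD
    exact (hD.comp 0 hPd).fst
  · obtain ⟨δ, Ξ, h1, h2⟩ := hex (P w)
    have h3 : D (P w) = δ := by rw [← h2]; exact hΞ δ Ξ h1
    refine ⟨δ.2, Ξ, ?_, h2⟩
    have h4 : (D (P w)).1 = δ.1 := by rw [h3]
    have h5 : ((ContinuousLinearMap.fst ℝ _ _ ∘L D ∘L P) w, δ.2) = δ := Prod.ext h4 rfl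
    rwa [h5]

end Backward

/-! ### The radical of the Hessian and the kernel of the backward projection -/

section Radical

variable {d m : ℕ} {T : ℝ} {hT : 0 ≤ T} {σ₀ : Euc d → Euc d} {σ : Fin m → Euc d → Euc d}
  {x₀ r : Euc d} {h k : CameronMartin m T}

/-- The linearised lifted equation can be solved with a prescribed terminal covector and a fixed
starting point. -/
lemma exists_isLin_lift_of_terminal (hσ₀ : SmoothBounded σ₀) (hσ : ∀ i, SmoothBounded (σ i))
    (δr : Euc d) :
    ∃ δ Ξ, IsLin hT (lift (ctrlField σ₀ σ)) (aug h) (covectorPath hT σ₀ σ x₀ r h)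
      (augL T m k) (0, δ) Ξ ∧ (Ξ (finalTime hT)).2 = δr := by
  have hV := contDiff_ctrlField' hσ₀ hσ
  obtain ⟨δ, hΞ⟩ := isLin_fderiv_covectorPath hT hσ₀ hσ x₀ r h k
  obtain ⟨p, -, hz⟩ := exists_covectorPath_eq hT hσ₀ hσ x₀ r h
  obtain ⟨q, hq, -⟩ := exists_covectorPath_eq hT hσ₀ hσ x₀ (-δr) h
  have hvert := IsAdj.isLin_lift hV (p := p) hq
  rw [← hz] at hvert
  have hdiff := hΞ.sub (contDiff_lift hV) hvert
  rw [sub_zero, Prod.mk_sub_mk, sub_zero] at hdiff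
  refine ⟨_, _, hdiff, ?_⟩
  have h1 := snd_fderiv_covectorPath_finalTime hT hσ₀ hσ x₀ r h k
  have h2 := isAdj_finalTime hT hσ₀ hσ x₀ hq
  rw [ContinuousMap.sub_apply, Prod.snd_sub, h1]
  simp [h2]

/-- The base component of a variation of the lifted path is the variation of the endpoint. -/
lemma fst_finalTime_of_isLin_lift (hσ₀ : SmoothBounded σ₀) (hσ : ∀ i, SmoothBounded (σ i))
    {δ : Euc d} {Ξ : C(Icc (0 : ℝ) T, Euc d × Euc d)}
    (hΞ : IsLin hT (lift (ctrlField σ₀ σ)) (aug h) (covectorPath hT σ₀ σ x₀ r h)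
      (augL T m k) (0, δ) Ξ) :
    (Ξ (finalTime hT)).1 = fderiv ℝ (endpoint σ₀ σ x₀) h k := by
  have hV := contDiff_ctrlField' hσ₀ hσ
  have h1 := IsLin.fst_lift hV hΞ
  have h2 := isLin_fderiv_ctrlSol hV (globalSol_ctrlField (hT := hT) hσ₀ hσ) (h, x₀) (k, 0)
  have h3 : (⟨Prod.fst, continuous_fst⟩ : C(Euc d × Euc d, Euc d)).comp
      (covectorPath hT σ₀ σ x₀ r h) = ctrlSol hT (ctrlField σ₀ σ) h x₀ :=
    ContinuousMap.ext (fst_covectorPath hT hσ₀ hσ x₀ r h)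
  rw [h3] at h1
  rw [fderiv_endpoint_apply hT hσ₀ hσ, ← h1.unique hV h2]
  rfl

end Radical

section Equivalence

variable {l n m : ℕ} {T : ℝ} {hT : 0 ≤ T} {σ₀ : Euc (l + n) → Euc (l + n)}
  {σ : Fin m → Euc (l + n) → Euc (l + n)} {x₀ : Euc (l + n)} {q : Euc l}
  {h₀ : CameronMartin m T}

/-- The kernel of the derivative of the backward projection corresponds to the radical of the form
`⟨k - Dg k, k'⟩` on `ker Dψ`, where `g(h) = Dψ(h)^* q`: a variation `k` lies in the radical precisely
when it is the variation of the momenta along a solution of the linearised Hamiltonian equation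
which starts in the fibre over `x₀` and ends in the conormal directions `((0, z), (q, 0))`. -/
lemma injective_iff_radical_trivial (hσ₀ : SmoothBounded σ₀) (hσ : ∀ i, SmoothBounded (σ i))
    (hs : Function.Surjective (fderiv ℝ (endpoint σ₀ σ x₀) h₀))
    (hq : h₀ = ContinuousLinearMap.adjoint (fderiv ℝ (endpoint σ₀ σ x₀) h₀) (padRight q))
    {D : Euc n × Euc l →L[ℝ] Euc (l + n)}
    (hD : ∀ w, ∃ δ Ξ, IsLin hT (autField (hamField σ₀ σ)) (constCtl T 1)
      (covectorPath hT σ₀ σ x₀ (padRight q) h₀) 0 (D w, δ) Ξ ∧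
        Ξ (finalTime hT) = (padLeft w.1, padRight w.2)) :
    Function.Injective D ↔ ∀ k ∈ kerSpace σ₀ σ x₀ h₀,
      (∀ k' ∈ kerSpace σ₀ σ x₀ h₀, inner ℝ (k - fderiv ℝ (fun h =>
        ContinuousLinearMap.adjoint (fderiv ℝ (projEndpoint σ₀ σ x₀) h) q) h₀ k) k' = 0) →
      k = 0 := by
  have hg : (fun h : CameronMartin m T =>
      ContinuousLinearMap.adjoint (fderiv ℝ (projEndpoint σ₀ σ x₀) h) q) = fun h =>
        ContinuousLinearMap.adjoint (fderiv ℝ (endpoint σ₀ σ x₀) h) (padRight q) :=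
    funext fun h => adjoint_fderiv_projEndpoint hT hσ₀ hσ h q
  have hmem : ∀ k, k ∈ kerSpace σ₀ σ x₀ h₀ ↔
      proj l n (fderiv ℝ (endpoint σ₀ σ x₀) h₀ k) = 0 := fun k => by
    rw [kerSpace, fderiv_projEndpoint hT hσ₀ hσ]
    rfl
  have hmom := hq.trans (adjoint_fderiv_endpoint hT hσ₀ hσ x₀ (padRight q) h₀)
  have hX := contDiff_hamField hσ₀.1 fun i => (hσ i).1
  rw [hg]
  set z := covectorPath hT σ₀ σ x₀ (padRight q) h₀ with hz
  constructor
  · intro hinj k hk hrad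
    obtain ⟨δq, hδq⟩ := exists_adjoint_eq_of_orthogonal_ker
      (fderiv ℝ (projEndpoint σ₀ σ x₀) h₀) (fun k' hk' => hrad k' hk')
    rw [adjoint_fderiv_projEndpoint hT hσ₀ hσ] at hδq
    obtain ⟨δ, Ξ, hΞ, hΞT⟩ := exists_isLin_lift_of_terminal (hT := hT) (h := h₀) (k := k)
      (x₀ := x₀) (r := padRight q) hσ₀ hσ (padRight δq)
    have h1 := fderiv_gradient_add_adjoint hT hσ₀ hσ x₀ _ _ h₀ k hΞ hΞT
    rw [← hδq, add_sub_cancel] at h1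
    have hham := (isLin_hamField_iff hσ₀ hσ hmom h1).2 hΞ
    have hfst := fst_finalTime_of_isLin_lift hσ₀ hσ hΞ
    obtain ⟨v, hv⟩ := exists_padLeft_eq ((hmem k).1 hk)
    -- `Ξ` is the solution with the terminal value prescribed by `(v, δq)`
    obtain ⟨δ', Ξ', hΞ', hΞT'⟩ := hD (v, δq)
    have hΞΞ : Ξ = Ξ' := hham.eq_of_finalTime hX hΞ'
      ((Prod.ext (hfst.trans hv) hΞT : Ξ (finalTime hT) = (padLeft v, padRight δq)).trans hΞT'.symm)
    have hD0 : D (v, δq) = 0 := by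
      have h2 := hham.apply_zero
      rw [hΞΞ, hΞ'.apply_zero] at h2
      exact congrArg Prod.fst h2
    have hw : (v, δq) = 0 := hinj (hD0.trans (map_zero D).symm)
    have hΞ0 : Ξ = 0 := by
      refine hham.eq_of_finalTime hX (isLin_zero (contDiff_autField hX)) ?_
      rw [hΞΞ, hΞT', hw]
      exact Prod.ext (map_zero (padLeftCLM l n)) (map_zero (padRightCLM l n))
    rw [h1, hΞ0, dMomentumPath, map_zero, map_zero]
  · intro hrad
    rw [injective_iff_map_eq_zero]
    intro w hw
    obtain ⟨δ, Ξ, hΞ, hΞT⟩ := hD w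
    rw [hw] at hΞ
    set k := toCtl hT (Euc m) (dMomentumPath hσ z Ξ) with hk
    have hlin := (isLin_hamField_iff hσ₀ hσ hmom hk).1 hΞ
    have hfst := fst_finalTime_of_isLin_lift hσ₀ hσ hlin
    have h1 := fderiv_gradient_add_adjoint hT hσ₀ hσ x₀ _ _ h₀ k hlin rfl
    rw [← hz, ← hk] at h1
    rw [hΞT] at hfst h1
    have hk0 : k = 0 := by
      refine hrad k ((hmem k).2 ?_) fun k' hk' => ?_
      · rw [← hfst]
        exact proj_padLeft w.1
      · rw [sub_eq_of_eq_add' h1.symm, ← adjoint_fderiv_projEndpoint hT hσ₀ hσ,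
          ContinuousLinearMap.adjoint_inner_left]
        have : fderiv ℝ (projEndpoint σ₀ σ x₀) h₀ k' = 0 := hk'
        rw [this, inner_zero_right]
    rw [hk0, map_zero] at hfst
    rw [hk0, map_zero, zero_add] at h1
    refine Prod.ext (padLeft_injective (hfst.trans (map_zero (padLeftCLM l n)).symm)) ?_
    have h2 : (padRight w.2 : Euc (l + n)) = 0 := by
      refine ext_inner_right ℝ fun v => ?_
      obtain ⟨k', rfl⟩ := hs v
      rw [← ContinuousLinearMap.adjoint_inner_left, h1, inner_zero_left, inner_zero_left]
    rw [← proj_padRight (n := n) w.2, h2]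
    exact map_zero (projCLM l n)

lemma bijective_iff_injective (D : Euc n × Euc l →L[ℝ] Euc (l + n)) :
    Function.Bijective D ↔ Function.Injective D := by
  refine ⟨fun h => h.1, fun h => ⟨h, ?_⟩⟩
  refine (LinearMap.injective_iff_surjective_of_finrank_eq_finrank (f := D.toLinearMap) ?_).1 h
  simp [add_comm]

end Equivalence

/-! ### Non-degeneracy and conclusion -/

lemma nondegenerate_iff_radical_trivial {V : Type*} [AddCommGroup V] [Module ℝ V]
    {B : LinearMap.BilinForm ℝ V} (hB : B.IsSymm) :
    B.Nondegenerate ↔ ∀ k, (∀ k', B k k' = 0) → k = 0 := by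
  exact LinearMap.IsRefl.nondegenerate_iff_separatingLeft (B := B)
    fun x y h => by rw [hB.eq y x, h]

end

end NonFocality

theorem mainTheorem2 (l n m : ℕ) (hl : 1 ≤ l) (T : ℝ) (hT : 0 < T)
    (σ₀ : NonFocality.Euc (l + n) → NonFocality.Euc (l + n))
    (σ : Fin m → NonFocality.Euc (l + n) → NonFocality.Euc (l + n))
    (hσ₀ : NonFocality.SmoothBounded σ₀) (hσ : ∀ i, NonFocality.SmoothBounded (σ i))
    (x₀ : NonFocality.Euc (l + n)) (a : NonFocality.Euc l)
    (h₀ : NonFocality.CameronMartin m T)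
    (hmin : h₀ ∈ NonFocality.minimizers T σ₀ σ x₀ a)
    (hC : IsUnit (NonFocality.malliavin σ₀ σ x₀ h₀)) :
    -- the covector attached to the minimizer is well defined
    (∃! p₀, NonFocality.IsInitialCovector σ₀ σ x₀ h₀ p₀) ∧
    -- the tangent space at the minimizer and the Hessian there are well defined
    NonFocality.IsTangentSpaceAt (NonFocality.admissible T σ₀ σ x₀ a) h₀
      (NonFocality.kerSpace σ₀ σ x₀ h₀) ∧
    (∃! B, NonFocality.IsHessianAt (NonFocality.admissible T σ₀ σ x₀ a) NonFocality.energy h₀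
      (NonFocality.kerSpace σ₀ σ x₀ h₀) B) ∧
    ∀ p₀, NonFocality.IsInitialCovector σ₀ σ x₀ h₀ p₀ →
      -- `p₀` lies in the pullback of the span of `dx¹, …, dx^l`
      (∃ q : NonFocality.Euc l, p₀ = ContinuousLinearMap.adjoint
        (fderiv ℝ (NonFocality.controlFlow σ₀ σ h₀ T) x₀) (NonFocality.padRight q)) ∧
      -- the backward flow is defined near the terminal point and can be differentiated there
      (∀ᶠ w in 𝓝 0,
        NonFocality.terminalPoint T σ₀ σ x₀ p₀ w ∈ NonFocality.hamDomain σ₀ σ T 0) ∧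
      DifferentiableAt ℝ (NonFocality.backwardProj T σ₀ σ x₀ p₀) 0 ∧
      -- positivity of the Hessian, its non-degeneracy, and non-focality are equivalent
      ∀ B, NonFocality.IsHessianAt (NonFocality.admissible T σ₀ σ x₀ a) NonFocality.energy h₀
          (NonFocality.kerSpace σ₀ σ x₀ h₀) B →
        ((∀ k, k ≠ 0 → 0 < B k k) ↔ NonFocality.NonFocal T σ₀ σ x₀ p₀) ∧
        (B.Nondegenerate ↔ NonFocality.NonFocal T σ₀ σ x₀ p₀) := by
  have hT' := hT.le
  have hψ := NonFocality.contDiff_projEndpoint (x₀ := x₀) hT' hσ₀ hσ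
  have hψ2 := contDiff_infty.1 hψ 2
  have hs := NonFocality.surjective_fderiv_projEndpoint hT' hσ₀ hσ hC
  have hsφ := NonFocality.surjective_of_isUnit_malliavin hC
  have hnorm := NonFocality.norm_le_of_mem_minimizers hmin
  have htan := NonFocality.isTangentSpaceAt_levelSet hψ2 hs
  obtain ⟨q, hq⟩ := NonFocality.exists_multiplier_of_isMin_norm hψ2 hs hnorm
  obtain ⟨B₀, hB₀, hB₀g, hB₀nn⟩ := NonFocality.exists_isHessianAt_levelSet hψ2 hs hnorm hq
  have hqφ := hq.trans (NonFocality.adjoint_fderiv_projEndpoint hT' hσ₀ hσ h₀ q)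
  have hinit := NonFocality.isInitialCovector_of_eq hT' hσ₀ hσ hqφ
  have huniq : ∀ p₀, NonFocality.IsInitialCovector σ₀ σ x₀ h₀ p₀ →
      p₀ = ContinuousLinearMap.adjoint (fderiv ℝ (NonFocality.controlFlow σ₀ σ h₀ T) x₀)
        (NonFocality.padRight q) := fun p₀ hp₀ =>
    hp₀.eq_of_isMin hT' hσ₀ hσ hsφ
      (fun u hu => hnorm u (congrArg (NonFocality.proj l n) hu)) hqφ
  rw [NonFocality.admissible_eq hmin]
  refine ⟨⟨_, hinit, huniq⟩, htan, ⟨B₀, hB₀, fun B hB => hB.unique htan hB₀⟩, fun p₀ hp₀ => ?_⟩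
  obtain rfl := huniq p₀ hp₀
  obtain ⟨hdom, D, hD, hDΞ⟩ := NonFocality.exists_hasFDerivAt_backwardProj hσ₀.1
    (fun i => (hσ i).1) (NonFocality.isSol_hamField_covectorPath (hT := hT') hσ₀ hσ hqφ)
  refine ⟨⟨q, rfl⟩, hdom, hD.differentiableAt, fun B hB => ?_⟩
  obtain rfl := hB.unique htan hB₀
  have hnf : B.Nondegenerate ↔ NonFocality.NonFocal T σ₀ σ x₀
      (ContinuousLinearMap.adjoint (fderiv ℝ (NonFocality.controlFlow σ₀ σ h₀ T) x₀)
        (NonFocality.padRight q)) := by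
    rw [NonFocality.NonFocal, hD.fderiv, NonFocality.bijective_iff_injective,
      NonFocality.injective_iff_radical_trivial hσ₀ hσ hsφ hqφ hDΞ,
      NonFocality.nondegenerate_iff_radical_trivial hB.1]
    constructor
    · intro h k hk hrad
      have := h ⟨k, hk⟩ fun k' => (hB₀g ⟨k, hk⟩ k').trans (hrad k' k'.2)
      exact congrArg Subtype.val this
    · intro h k hrad
      exact Subtype.ext (h k k.2 fun k' hk' => (hB₀g k ⟨k', hk'⟩).symm.trans (hrad ⟨k', hk'⟩))
  exact ⟨(LinearMap.BilinForm.nondegenerate_iff' B hB₀nn ⟨hB.1.eq⟩).symm.trans hnf, hnf⟩
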